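/- All vector spaces and Lie algebras are over $\mathbb{C}$. Let $e_1,e_2,e_3\in\mathbb{C}$ and consider the Krichever–Novikov equation $$u_t=F(u_0,u_1,u_2,u_3),\qquad F=u_3-\frac32\frac{u_2^2}{u_1}+\frac{(u_0-e_1)(u_0-e_2)(u_0-e_3)}{u_1},\qquad u_k=\frac{\partial^k u}{\partial x^k}.$$ Its infinite prolongation $\mathcal{E}$ is the set of points $(x,t,u_0,u_1,u_2,\dots)$ with complex coordinates and $u_1\neq0$, with total derivatives $$D_x=\frac{\partial}{\partial x}+\sum_{k\ge0}u_{k+1}\frac{\partial}{\partial u_k},\qquad D_t=\frac{\partial}{\partial t}+\sum_{k\ge0}D_x^k(F)\frac{\partial}{\partial u_k}.$$ Let $a=(x_a,t_a,a_0,a_1,\dots)\in\mathcal{E}$, so $a_1\ne0$. For $p\ge0$ let $\mathbb{F}^p(\mathcal{E},a)$ be the Lie algebra given by generators $\mathbb{A}^{l_1,l_2}_{i_0\dots i_p}$, $\mathbb{B}^{l_1,l_2}_{j_0\dots j_{p+2}}$ (all indices in $\mathbb{Z}_{\ge0}$) and the following relations. Form the formal power series $$\mathbb{A}=\sum (x-x_a)^{l_1}(t-t_a)^{l_2}\prod_{k=0}^{p}(u_k-a_k)^{i_k}\,\mathbb{A}^{l_1,l_2}_{i_0\dots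 i_p},\qquad \mathbb{B}=\sum (x-x_a)^{l_1}(t-t_a)^{l_2}\prod_{k=0}^{p+2}(u_k-a_k)^{j_k}\,\mathbb{B}^{l_1,l_2}_{j_0\dots j_{p+2}}.$$ The relations are: all coefficients of $D_x(\mathbb{B})-D_t(\mathbb{A})+[\mathbb{A},\mathbb{B}]$ vanish (with $F$ replaced by its Taylor series at $a$); $\mathbb{A}^{l_1,l_2}_{0\dots0}=0$ and $\mathbb{B}^{0,l_2}_{0\dots0}=0$ for all $l_1,l_2$; and $\mathbb{A}^{l_1,l_2}_{i_0\dots i_p}=0$ for all $l_1,l_2$ whenever there is $r\in\{1,\dots,p\}$ with $i_r=1$ and $i_q=0$ for all $q>r$. For $p\ge1$ let $\varphi_p:\mathbb{F}^p(\mathcal{E},a)\to\mathbb{F}^{p-1}(\mathcal{E},a)$ be the homomorphism $$\mathbb{A}^{l_1,l_2}_{i_0\dots i_p}\mapsto\delta_{0,i_p}\mathbb{A}^{l_1,l_2}_{i_0\dots i_{p-1}},\qquad \mathbb{B}^{l_1,l_2}_{j_0\dots j_{p+2}}\mapsto\delta_{0,j_{p+2}}\mathbb{B}^{l_1,l_2}_{j_0\dots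 j_{p+1}}.$$ For pairwise distinct $e_1,e_2,e_3$ let $E=\mathbb{C}[v_1,v_2,v_3]/(v_i^2-v_j^2+e_i-e_j,\ i,j=1,2,3)$, let $\hat v_i\in E$ be the image of $v_i$, let $\alpha_1,\alpha_2,\alpha_3$ be a basis of $\mathfrak{so}_3(\mathbb{C})$ with $[\alpha_1,\alpha_2]=\alpha_3$, $[\alpha_2,\alpha_3]=\alpha_1$, $[\alpha_3,\alpha_1]=\alpha_2$, and let $\mathfrak{R}_{e_1,e_2,e_3}$ be the Lie subalgebra of $\mathfrak{so}_3(\mathbb{C})\otimes_{\mathbb{C}}E$ (bracket $[\alpha\otimes g,\beta\otimes h]=[\alpha,\beta]\otimes gh$) generated by $\alpha_i\otimes\hat v_i$, $i=1,2,3$. A Lie algebra $L_1$ is obtained from $L$ by central extension if $L_1$ has an ideal $I$ contained in its center with $L_1/I\cong L$; $L_2$ is obtained from $L$ by applying several times the operation of central extension if there are Lie algebras $\mathfrak{g}_0\cong L,\ \mathfrak{g}_1,\dots,\mathfrak{g}_m\cong L_2$ such that each $\mathfrak{g}_i$ ($1\le i\le m$) is obtained from $\mathfrak{g}_{i-1}$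 by central extension. **Theorem.** For all $e_1,e_2,e_3\in\mathbb{C}$ and all $a\in\mathcal{E}$: 1. $\mathbb{F}^0(\mathcal{E},a)=0$. 2. Every $\varphi_p$ ($p\ge1$) is surjective. For each $k\ge2$ the kernel of $\varphi_k$ is contained in the center of $\mathbb{F}^k(\mathcal{E},a)$, that is, $[v_1,v_2]=0$ for all $v_1\in\ker\varphi_k$ and $v_2\in\mathbb{F}^k(\mathcal{E},a)$; in particular $\mathbb{F}^k(\mathcal{E},a)$ is obtained from $\mathbb{F}^{k-1}(\mathcal{E},a)$ by central extension. 3. For each $k\ge1$ the kernel of the composition $\varphi_2\circ\dots\circ\varphi_k:\mathbb{F}^k(\mathcal{E},a)\to\mathbb{F}^1(\mathcal{E},a)$ is a nilpotent Lie algebra (for $k=1$ the map is the identity). 4. If $e_1,e_2,e_3$ are pairwise distinct, then $\mathbb{F}^1(\mathcal{E},a)\cong\mathfrak{R}_{e_1,e_2,e_3}$, and for each $k\ge2$ the algebra $\mathbb{F}^k(\mathcal{E},a)$ is obtained from $\mathfrak{R}_{e_1,e_2,e_3}$ by applying several times the operation of central extension. -/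

import Mathlib

namespace ZCR

open Finset TensorProduct

noncomputable section

/-! ### Coordinates and formal power series on the infinite prolongation -/

/-- The coordinates `x`, `t`, `u₀`, `u₁`, `u₂`, … on the infinite prolongation of a scalar
`(1+1)`-dimensional evolution equation. A point is a function `a : Coord → ℂ`. -/
inductive Coord : Type
  | x : Coord
  | t : Coord
  | u (k : ℕ) : Coord
  deriving DecidableEq

/-- Exponents of monomials in `x - x_a`, `t - t_a`, `u_k - a_k`. -/
abbrev Mon : Type := Coord →₀ ℕ

section Series

variable {M : Type*} [AddCommGroup M] [Module ℂ M]

/-- The partial derivative with respect to the coordinate `s` of a formal power series in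
the variables `x - x_a`, `t - t_a`, `u_k - a_k` with coefficients in a vector space `M`. -/
def pd (s : Coord) (f : MvPowerSeries Coord M) : MvPowerSeries Coord M :=
  fun m => (m s + 1) • f (m + Finsupp.single s 1)

/-- The product of a scalar power series and a power series with coefficients in `M`. -/
def mulSeries (f : MvPowerSeries Coord ℂ) (g : MvPowerSeries Coord M) : MvPowerSeries Coord M :=
  fun m => ∑ q ∈ antidiagonal m, f q.1 • g q.2

/-- The coordinate function `s = a_s + (s - a_s)` as a power series at the point `a`. -/
def coordSeries (a : Coord → ℂ) (s : Coord) : MvPowerSeries Coord ℂ :=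
  MvPowerSeries.C (a s) + MvPowerSeries.X s

/-- The total derivative `D_x = ∂/∂x + ∑ u_{k+1} ∂/∂u_k` on series at `a` that
depend only on `x`, `t` and the `u_k` with `k < n`. -/
def totalDx (a : Coord → ℂ) (n : ℕ) (f : MvPowerSeries Coord M) : MvPowerSeries Coord M :=
  pd .x f + ∑ k ∈ range n, mulSeries (coordSeries a (.u (k + 1))) (pd (.u k) f)

/-- `D_x^k(F)` for a series `F` at `a` that depends only on `x`, `t`, `u₀, …, u_d`. -/
def dxPow (a : Coord → ℂ) (d : ℕ) (F : MvPowerSeries Coord ℂ) : ℕ → MvPowerSeries Coord ℂ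
  | 0 => F
  | k + 1 => totalDx a (d + k + 1) (dxPow a d F k)

/-- The total derivative `D_t = ∂/∂t + ∑ D_x^k(F) ∂/∂u_k` of the equation
`u_t = F(x,t,u₀,…,u_d)` on series at `a` that depend only on `x`, `t` and the `u_k` with `k < n`. -/
def totalDt (a : Coord → ℂ) (d : ℕ) (F : MvPowerSeries Coord ℂ) (n : ℕ)
    (f : MvPowerSeries Coord M) : MvPowerSeries Coord M :=
  pd .t f + ∑ k ∈ range n, mulSeries (dxPow a d F k) (pd (.u k) f)

end Series

/-- The bracket of two power series with coefficients in a Lie algebra. -/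
def lieSeries {L : Type*} [LieRing L] (f g : MvPowerSeries Coord L) : MvPowerSeries Coord L :=
  fun m => ∑ q ∈ antidiagonal m, ⁅f q.1, g q.2⁆

/-- The left-hand side `D_x(B) - D_t(A) + [A,B]` of the zero-curvature equation at `a`, where
`A = A(x,t,u₀,…,u_p)` and `B = B(x,t,u₀,…,u_{p+d-1})` have coefficients in a Lie algebra. -/
def zeroCurvature {L : Type*} [LieRing L] [LieAlgebra ℂ L] (a : Coord → ℂ) (d : ℕ)
    (F : MvPowerSeries Coord ℂ) (p : ℕ) (A B : MvPowerSeries Coord L) : MvPowerSeries Coord L :=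
  totalDx a (p + d) B - totalDt a d F (p + 1) A + lieSeries A B

/-! ### The Lie algebras `𝔽^p(ℰ,a)` -/

/-- The generators of `𝔽^p`: one symbol `A m` for each monomial `m` in `x, t, u₀, …, u_p` and one
symbol `B m` for each monomial `m` in `x, t, u₀, …, u_{p+d-1}`. -/
inductive Gen (p d : ℕ) : Type
  | A (m : Mon) (hm : ∀ k, p < k → m (.u k) = 0) : Gen p d
  | B (m : Mon) (hm : ∀ k, p + d ≤ k → m (.u k) = 0) : Gen p d

open Classical in
/-- The power series `𝔸` in `x, t, u₀, …, u_p` whose coefficients are the free generators. -/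
def seriesA (p d : ℕ) : MvPowerSeries Coord (FreeLieAlgebra ℂ (Gen p d)) :=
  fun m => if hm : ∀ k, p < k → m (.u k) = 0 then FreeLieAlgebra.of ℂ (Gen.A m hm) else 0

open Classical in
/-- The power series `𝔹` in `x, t, u₀, …, u_{p+d-1}` whose coefficients are the free generators. -/
def seriesB (p d : ℕ) : MvPowerSeries Coord (FreeLieAlgebra ℂ (Gen p d)) :=
  fun m => if hm : ∀ k, p + d ≤ k → m (.u k) = 0 then FreeLieAlgebra.of ℂ (Gen.B m hm) else 0

/-- The exponents with `(i₀,…,i_p) = (i₀,…,i_{r-1},1,0,…,0)` for some `r ∈ {1,…,p}`. -/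
def IsNormalExp (p : ℕ) (m : Mon) : Prop :=
  ∃ r, 1 ≤ r ∧ r ≤ p ∧ m (.u r) = 1 ∧ ∀ q, r < q → q ≤ p → m (.u q) = 0

/-- The defining relations of `𝔽^p`: the coefficients of the zero-curvature equation for `𝔸`, `𝔹`,
and the vanishing of the coefficients that are zero in the normal form. -/
inductive Rel (a : Coord → ℂ) (d : ℕ) (F : MvPowerSeries Coord ℂ) (p : ℕ) :
    FreeLieAlgebra ℂ (Gen p d) → Prop
  | zcr (m : Mon) : Rel a d F p (zeroCurvature a d F p (seriesA p d) (seriesB p d) m)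
  | zeroA (m : Mon) (hm : ∀ k, m (.u k) = 0) : Rel a d F p (seriesA p d m)
  | zeroB (m : Mon) (hx : m .x = 0) (hm : ∀ k, m (.u k) = 0) : Rel a d F p (seriesB p d m)
  | normalA (m : Mon) (hm : ∀ k, p < k → m (.u k) = 0) (hn : IsNormalExp p m) :
      Rel a d F p (seriesA p d m)

/-- The ideal generated by the relations. -/
def relIdeal (a : Coord → ℂ) (d : ℕ) (F : MvPowerSeries Coord ℂ) (p : ℕ) :
    LieIdeal ℂ (FreeLieAlgebra ℂ (Gen p d)) :=
  LieSubmodule.lieSpan ℂ (FreeLieAlgebra ℂ (Gen p d)) {r | Rel a d F p r}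

/-- The Lie algebra `𝔽^p(ℰ,a)` of the evolution equation `u_t = F(x,t,u₀,…,u_d)`, where the analytic
function `F` is given by its Taylor series at the point `a`. -/
abbrev Fd (a : Coord → ℂ) (d : ℕ) (F : MvPowerSeries Coord ℂ) (p : ℕ) : Type :=
  FreeLieAlgebra ℂ (Gen p d) ⧸ relIdeal a d F p

/-! ### The homomorphisms `𝔽^{p+1} → 𝔽^p` -/

/-- The quotient map from the free Lie algebra. -/
def Fd.mk (a : Coord → ℂ) (d : ℕ) (F : MvPowerSeries Coord ℂ) (p : ℕ) :
    FreeLieAlgebra ℂ (Gen p d) →ₗ⁅ℂ⁆ Fd a d F p :=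
  { (LieSubmodule.Quotient.mk' (relIdeal a d F p) : _ →ₗ[ℂ] Fd a d F p) with
    map_lie' := fun {x y} => LieSubmodule.Quotient.mk_bracket (I := relIdeal a d F p) x y }

/-- The map on free generators: `𝔸_m` and `𝔹_m` go to the generators with the same monomial if
`m` does not contain the highest variable (`u_{p+1}`, respectively `u_{p+d}`), and to `0` if it
does. -/
def Fd.mapFree (a : Coord → ℂ) (d : ℕ) (F : MvPowerSeries Coord ℂ) (p : ℕ) :
    FreeLieAlgebra ℂ (Gen (p + 1) d) →ₗ⁅ℂ⁆ Fd a d F p :=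
  FreeLieAlgebra.lift ℂ fun
    | .A m _ => Fd.mk a d F p (seriesA p d m)
    | .B m _ => Fd.mk a d F p (seriesB p d m)

section Helpers

variable {L L' : Type*} [LieRing L] [LieAlgebra ℂ L] [LieRing L'] [LieAlgebra ℂ L']

/-- Apply a Lie algebra homomorphism to the coefficients of a power series. -/
def mapSeries (φ : L →ₗ⁅ℂ⁆ L') (f : MvPowerSeries Coord L) : MvPowerSeries Coord L' :=
  fun m => φ (f m)

theorem sum_series_apply {ι M : Type*} [AddCommGroup M] (s : Finset ι)
    (f : ι → MvPowerSeries Coord M) (m : Mon) : (∑ i ∈ s, f i) m = ∑ i ∈ s, f i m :=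
  Finset.sum_apply (M := fun _ : Mon => M) m s f

theorem pd_mapSeries (φ : L →ₗ⁅ℂ⁆ L') (s : Coord) (f : MvPowerSeries Coord L) :
    pd s (mapSeries φ f) = mapSeries φ (pd s f) := by
  funext m
  simp [pd, mapSeries, map_nsmul]

theorem mulSeries_mapSeries (φ : L →ₗ⁅ℂ⁆ L') (g : MvPowerSeries Coord ℂ)
    (f : MvPowerSeries Coord L) :
    mulSeries g (mapSeries φ f) = mapSeries φ (mulSeries g f) := by
  funext m
  simp [mulSeries, mapSeries]

theorem zeroCurvature_mapSeries (φ : L →ₗ⁅ℂ⁆ L') (a : Coord → ℂ) (d : ℕ)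
    (F : MvPowerSeries Coord ℂ) (p : ℕ) (A B : MvPowerSeries Coord L) (m : Mon) :
    φ (zeroCurvature a d F p A B m) =
      zeroCurvature a d F p (mapSeries φ A) (mapSeries φ B) m := by
  have h1 : ∀ (n : ℕ) (f : MvPowerSeries Coord L),
      φ (totalDx a n f m) = totalDx a n (mapSeries φ f) m := by
    intro n f
    change φ (pd .x f m + (∑ k ∈ range n, _ : MvPowerSeries Coord L) m) =
      pd .x _ m + (∑ k ∈ range n, _ : MvPowerSeries Coord L') m
    simp only [sum_series_apply, pd_mapSeries, mulSeries_mapSeries, map_add, map_sum]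
    rfl
  have h2 : ∀ (n : ℕ) (f : MvPowerSeries Coord L),
      φ (totalDt a d F n f m) = totalDt a d F n (mapSeries φ f) m := by
    intro n f
    change φ (pd .t f m + (∑ k ∈ range n, _ : MvPowerSeries Coord L) m) =
      pd .t _ m + (∑ k ∈ range n, _ : MvPowerSeries Coord L') m
    simp only [sum_series_apply, pd_mapSeries, mulSeries_mapSeries, map_add, map_sum]
    rfl
  have h3 : φ (lieSeries A B m) = lieSeries (mapSeries φ A) (mapSeries φ B) m := by
    simp [lieSeries, mapSeries]
  change φ (totalDx a (p + d) B m - totalDt a d F (p + 1) A m + lieSeries A B m) =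
    totalDx a (p + d) _ m - totalDt a d F (p + 1) _ m + lieSeries _ _ m
  rw [map_add, map_sub, h1, h2, h3]

/-- Raising the order by one does not change the zero-curvature equation for `A` and `B` that do
not depend on the additional variables. -/
theorem zeroCurvature_succ (a : Coord → ℂ) (d : ℕ) (F : MvPowerSeries Coord ℂ) (p : ℕ)
    (A B : MvPowerSeries Coord L) (hA : pd (.u (p + 1)) A = 0) (hB : pd (.u (p + d)) B = 0) :
    zeroCurvature a d F (p + 1) A B = zeroCurvature a d F p A B := by
  have hz : ∀ g : MvPowerSeries Coord ℂ, mulSeries g (0 : MvPowerSeries Coord L) = 0 := by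
    intro g
    funext m
    exact Finset.sum_eq_zero fun q _ => smul_zero _
  have e : p + 1 + d = p + d + 1 := by omega
  simp only [zeroCurvature, totalDx, totalDt, e, Finset.sum_range_succ _ (p + d),
    Finset.sum_range_succ _ (p + 1), hA, hB, hz, add_zero]

end Helpers

theorem seriesA_pd (p d : ℕ) : pd (.u (p + 1)) (seriesA p d) = 0 := by
  funext m
  have : ¬ ∀ k, p < k → (m + Finsupp.single (Coord.u (p + 1)) 1 : Mon) (.u k) = 0 := by
    intro h
    simpa using h (p + 1) (by omega)
  simp only [pd, seriesA, dif_neg this, smul_zero]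
  rfl

theorem seriesB_pd (p d : ℕ) : pd (.u (p + d)) (seriesB p d) = 0 := by
  funext m
  have : ¬ ∀ k, p + d ≤ k → (m + Finsupp.single (Coord.u (p + d)) 1 : Mon) (.u k) = 0 := by
    intro h
    simpa using h (p + d) le_rfl
  simp only [pd, seriesB, dif_neg this, smul_zero]
  rfl

theorem mapFree_seriesA (a : Coord → ℂ) (d : ℕ) (F : MvPowerSeries Coord ℂ) (p : ℕ) (m : Mon) :
    Fd.mapFree a d F p (seriesA (p + 1) d m) = Fd.mk a d F p (seriesA p d m) := by
  by_cases h : ∀ k, p + 1 < k → m (.u k) = 0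
  · simp only [seriesA, dif_pos h, Fd.mapFree, FreeLieAlgebra.lift_of_apply]
  · have h' : ¬ ∀ k, p < k → m (.u k) = 0 := fun h' => h fun k hk => h' k (by omega)
    simp only [seriesA, dif_neg h, dif_neg h', map_zero]

theorem mapFree_seriesB (a : Coord → ℂ) (d : ℕ) (F : MvPowerSeries Coord ℂ) (p : ℕ) (m : Mon) :
    Fd.mapFree a d F p (seriesB (p + 1) d m) = Fd.mk a d F p (seriesB p d m) := by
  by_cases h : ∀ k, p + 1 + d ≤ k → m (.u k) = 0
  · simp only [seriesB, dif_pos h, Fd.mapFree, FreeLieAlgebra.lift_of_apply]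
  · have h' : ¬ ∀ k, p + d ≤ k → m (.u k) = 0 := fun h' => h fun k hk => h' k (by omega)
    simp only [seriesB, dif_neg h, dif_neg h', map_zero]

theorem Fd.mk_rel (a : Coord → ℂ) (d : ℕ) (F : MvPowerSeries Coord ℂ) (p : ℕ)
    {r : FreeLieAlgebra ℂ (Gen p d)} (h : Rel a d F p r) : Fd.mk a d F p r = 0 :=
  (LieSubmodule.Quotient.mk_eq_zero (N := relIdeal a d F p)).mpr (LieSubmodule.subset_lieSpan h)

theorem mapFree_rel (a : Coord → ℂ) (d : ℕ) (F : MvPowerSeries Coord ℂ) (p : ℕ)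
    {r : FreeLieAlgebra ℂ (Gen (p + 1) d)} (h : Rel a d F (p + 1) r) :
    Fd.mapFree a d F p r = 0 := by
  cases h with
  | zcr m =>
    have hA : mapSeries (Fd.mapFree a d F p) (seriesA (p + 1) d) =
        mapSeries (Fd.mk a d F p) (seriesA p d) := funext fun m => mapFree_seriesA a d F p m
    have hB : mapSeries (Fd.mapFree a d F p) (seriesB (p + 1) d) =
        mapSeries (Fd.mk a d F p) (seriesB p d) := funext fun m => mapFree_seriesB a d F p m
    have hz : mapSeries (Fd.mk a d F p) 0 = 0 := funext fun m => map_zero _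
    rw [zeroCurvature_mapSeries, hA, hB, zeroCurvature_succ, ← zeroCurvature_mapSeries]
    · exact Fd.mk_rel a d F p (.zcr m)
    · rw [pd_mapSeries, seriesA_pd, hz]
    · rw [pd_mapSeries, seriesB_pd, hz]
  | zeroA m hm => rw [mapFree_seriesA]; exact Fd.mk_rel a d F p (.zeroA m hm)
  | zeroB m hx hm => rw [mapFree_seriesB]; exact Fd.mk_rel a d F p (.zeroB m hx hm)
  | normalA m hm hn =>
    rw [mapFree_seriesA]
    by_cases h : ∀ k, p < k → m (.u k) = 0
    · obtain ⟨r, h1, h2, h3, h4⟩ := hn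
      have hr : r ≤ p := by
        by_contra hr
        have := h r (by omega)
        omega
      exact Fd.mk_rel a d F p (.normalA m h ⟨r, h1, hr, h3, fun q h5 h6 => h4 q h5 (by omega)⟩)
    · rw [seriesA, dif_neg h, map_zero]

theorem relIdeal_le_ker (a : Coord → ℂ) (d : ℕ) (F : MvPowerSeries Coord ℂ) (p : ℕ) :
    relIdeal a d F (p + 1) ≤ (Fd.mapFree a d F p).ker :=
  LieSubmodule.lieSpan_le.mpr fun _ hr => (LieHom.mem_ker).mpr (mapFree_rel a d F p hr)

/-- The homomorphism `φ_{p+1} : 𝔽^{p+1}(ℰ,a) → 𝔽^p(ℰ,a)`. -/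
def Fd.map (a : Coord → ℂ) (d : ℕ) (F : MvPowerSeries Coord ℂ) (p : ℕ) :
    Fd a d F (p + 1) →ₗ⁅ℂ⁆ Fd a d F p :=
  { (relIdeal a d F (p + 1)).toSubmodule.liftQ
      (Fd.mapFree a d F p : FreeLieAlgebra ℂ (Gen (p + 1) d) →ₗ[ℂ] Fd a d F p)
      (fun _ hr => relIdeal_le_ker a d F p hr) with
    map_lie' := by
      intro x y
      obtain ⟨x, rfl⟩ := LieSubmodule.Quotient.surjective_mk' _ x
      obtain ⟨y, rfl⟩ := LieSubmodule.Quotient.surjective_mk' _ y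
      exact (Fd.mapFree a d F p).map_lie x y }

/-- The composition `𝔽^{n+k}(ℰ,a) → 𝔽^{n+k-1}(ℰ,a) → ⋯ → 𝔽^n(ℰ,a)`. -/
def Fd.down (a : Coord → ℂ) (d : ℕ) (F : MvPowerSeries Coord ℂ) (n : ℕ) :
    (k : ℕ) → Fd a d F (n + k) →ₗ⁅ℂ⁆ Fd a d F n
  | 0 => LieHom.id
  | k + 1 => (Fd.down a d F n k).comp (Fd.map a d F (n + k))

/-! ### The Krichever–Novikov equation -/

/-- The infinite prolongation of the Krichever–Novikov equation: the points with `u₁ ≠ 0`. -/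
def knProlongation : Set (Coord → ℂ) := {a | a (.u 1) ≠ 0}

/-- The Taylor series at `a` of the right-hand side
`u₃ - (3/2) u₂² / u₁ + (u₀ - e₁)(u₀ - e₂)(u₀ - e₃) / u₁` of the Krichever–Novikov equation. The
power series inverse of `u₁` is meaningful because `a₁ ≠ 0`. -/
def knRHS (e : Fin 3 → ℂ) (a : Coord → ℂ) : MvPowerSeries Coord ℂ :=
  let u : ℕ → MvPowerSeries Coord ℂ := fun k => coordSeries a (.u k)
  u 3 - MvPowerSeries.C (3 / 2) * u 2 ^ 2 * (u 1)⁻¹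
    + (u 0 - MvPowerSeries.C (e 0)) * (u 0 - MvPowerSeries.C (e 1))
      * (u 0 - MvPowerSeries.C (e 2)) * (u 1)⁻¹

/-- The algebra `𝔽^p(ℰ,a)` of the Krichever–Novikov equation. -/
abbrev KNFd (e : Fin 3 → ℂ) (a : Coord → ℂ) (p : ℕ) : Type := Fd a 3 (knRHS e a) p

/-- The homomorphism `φ_{p+1} : 𝔽^{p+1}(ℰ,a) → 𝔽^p(ℰ,a)` for the Krichever–Novikov equation. -/
abbrev KNFd.map (e : Fin 3 → ℂ) (a : Coord → ℂ) (p : ℕ) : KNFd e a (p + 1) →ₗ⁅ℂ⁆ KNFd e a p :=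
  Fd.map a 3 (knRHS e a) p

/-- The composition `𝔽^{n+k}(ℰ,a) → ⋯ → 𝔽^n(ℰ,a)` for the Krichever–Novikov equation. -/
abbrev KNFd.down (e : Fin 3 → ℂ) (a : Coord → ℂ) (n k : ℕ) :
    KNFd e a (n + k) →ₗ⁅ℂ⁆ KNFd e a n :=
  Fd.down a 3 (knRHS e a) n k

/-! ### The elliptic `𝔰𝔬₃`-valued Lie algebra -/

/-- The ideal generated by the polynomials `v_i² - v_j² + e_i - e_j`. -/
def curveIdeal (e : Fin 3 → ℂ) : Ideal (MvPolynomial (Fin 3) ℂ) :=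
  Ideal.span {f | ∃ i j, f = MvPolynomial.X i ^ 2 - MvPolynomial.X j ^ 2
    + MvPolynomial.C (e i) - MvPolynomial.C (e j)}

/-- The algebra of polynomial functions on the curve `v_i² - v_j² + e_i - e_j = 0`. -/
abbrev CurveAlg (e : Fin 3 → ℂ) : Type := MvPolynomial (Fin 3) ℂ ⧸ curveIdeal e

/-- The image of the variable `v_i` in the algebra of functions on the curve. -/
def vHat (e : Fin 3 → ℂ) (i : Fin 3) : CurveAlg e :=
  Ideal.Quotient.mk (curveIdeal e) (MvPolynomial.X i)

/-- The Lie algebra `𝔰𝔬₃(ℂ)` of skew-symmetric matrices. -/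
abbrev SO3 : Type := LieAlgebra.Orthogonal.so (Fin 3) ℂ

/-- A basis of `𝔰𝔬₃(ℂ)` with `[α₁,α₂] = α₃`, `[α₂,α₃] = α₁`, `[α₃,α₁] = α₂`. -/
def IsStandardBasis (α : Module.Basis (Fin 3) ℂ SO3) : Prop :=
  ⁅α 0, α 1⁆ = α 2 ∧ ⁅α 1, α 2⁆ = α 0 ∧ ⁅α 2, α 0⁆ = α 1

/-- The Lie subalgebra of `𝔰𝔬₃(ℂ) ⊗ E` generated by the `α_i ⊗ v̂_i`, where `E` is the algebra of
functions on the curve and `[α ⊗ g, β ⊗ h] = [α,β] ⊗ gh`. The tensor factors are written in the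
order in which Mathlib defines this Lie algebra structure. -/
def ellipticAlg (e : Fin 3 → ℂ) (α : Module.Basis (Fin 3) ℂ SO3) :
    LieSubalgebra ℂ (CurveAlg e ⊗[ℂ] SO3) :=
  LieSubalgebra.lieSpan ℂ (CurveAlg e ⊗[ℂ] SO3) (Set.range fun i => vHat e i ⊗ₜ[ℂ] α i)

/-! ### Central extensions -/

/-- `L₁` is obtained from `L` by central extension. -/
def IsCentralExtension (L L₁ : Type*) [LieRing L] [LieAlgebra ℂ L] [LieRing L₁]
    [LieAlgebra ℂ L₁] : Prop :=
  ∃ I : LieIdeal ℂ L₁, I ≤ LieAlgebra.center ℂ L₁ ∧ Nonempty ((L₁ ⧸ I) ≃ₗ⁅ℂ⁆ L)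

/-- `L₂` is obtained from `L` by applying several times the operation of central extension: there
are Lie algebras `g 0 ≅ L`, `g 1`, …, `g k ≅ L₂` such that each is obtained from the previous one by
central extension (the `g i` with `i > k` play no role). -/
def IsIteratedCentralExtension.{v} (L L₂ : Type v) [LieRing L] [LieAlgebra ℂ L] [LieRing L₂]
    [LieAlgebra ℂ L₂] : Prop :=
  ∃ (k : ℕ) (g : ℕ → Type v) (_ : ∀ i, LieRing (g i)) (_ : ∀ i, LieAlgebra ℂ (g i)),
    Nonempty (g 0 ≃ₗ⁅ℂ⁆ L) ∧ Nonempty (g k ≃ₗ⁅ℂ⁆ L₂) ∧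
      ∀ i < k, IsCentralExtension (g i) (g (i + 1))

end

end ZCR

namespace ZCR

open Finset TensorProduct

noncomputable section

/-! ### Power series with coefficients in a vector space or a Lie algebra -/

section Convolution

variable {M M₁ M₂ M₃ : Type*} [AddCommGroup M] [AddCommGroup M₁] [AddCommGroup M₂]
  [AddCommGroup M₃]

/-! The algebra 𝔽^p is universal: a zero-curvature representation (A, B) of order p in normal form
with coefficients in L is the same as a homomorphism 𝔽^p → L (`Fd.isNormalZCR`,
`IsNormalZCR.exists_lift`, `Fd.hom_ext`). The coefficients of A alone generate, because D_x B +
[A,B] = D_t A recovers B from A (`Fd.lieSpan_A`). Everything thus reduces to the study of such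
pairs. The normal form acts as a gauge fixing: a solution C of D_x C + [A,C] = 0 of finite order
depends on t only, and all its coefficients commute with those of A
(`IsNormalZCR.lie_coeff_eq_zero`).

Centrality. For order k ≥ 2, differentiating the zero-curvature equation by its highest variables
shows that S = ∂_k²A satisfies 3(D_x S + [A,S]) = 2 (∂F/∂u₂) S. Here ∂F/∂u₂ = -3u₂/u₁, so u₁²S is
covariantly constant and S is central. The terms of A linear in u_k are excluded by the normal form,
so modulo the center A does not depend on u_k. By universality the projection of 𝔽^k onto its
quotient by the center factors through φ_k, hence ker φ_k is central (`ker_map_le_center`).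
Nilpotency of the kernels of compositions follows. In order 0 the same differentiation leaves
(∂²F/∂u₂²) ∂₀A = 0, which forces A = 0.

Order one, upper bound. The compatibility ∂₁∂₂B = ∂₂∂₁B gives A = (u₁⁻¹ + b u₁) α + γ with b = a₁⁻²,
where α depends on x, t, u₀ only and γ on x, t only. The remaining equation is a polynomial of
degree 4 in u₁ (`zeroCurvature_normal`). With ∇ = ∂₀ + b ad α, its coefficients say that ∇³α = 0,
that 3[α,[α,∇α]] = 2P∇α - P'α for the cubic P = (u₀-e₁)(u₀-e₂)(u₀-e₃), and how α and γ evolve in x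
and t. So 𝔽^1 is generated by three elements ∇^kα(a), k = 0, 1, 2, which behave like the
coefficients of a quadratic polynomial in u₀. Expanding this polynomial in (z - e_i)² - P'(e_i),
available for distinct e_i, turns the relation into those of an `EllipticTriple`.

Order one, lower bound. A Lie algebra generated by an elliptic triple is spanned by elements that
correspond to α_i ⊗ λⁿv_i and α_i ⊗ λⁿv_{i+1}v_{i+2}, by a simultaneous induction on n
(`lieXX_succ`, `lieXY_succ`). Evaluation at points of the curve shows that nothing more collapses
under a map to 𝔰𝔬₃ ⊗ E (`EllipticTriple.injective`). Such a map exists because the quadratic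
polynomial built from any elliptic triple can be gauge transformed into a representation in normal
form (`exists_isReducedZCR`, `KNFd.exists_hom`). -/

theorem sum_antidiagonal_assoc (φ : Mon → Mon → Mon → M) (m : Mon) :
    ∑ q ∈ antidiagonal m, ∑ r ∈ antidiagonal q.1, φ r.1 r.2 q.2 =
      ∑ q ∈ antidiagonal m, ∑ r ∈ antidiagonal q.2, φ q.1 r.1 r.2 := by
  simp only [Finset.sum_sigma']
  refine Finset.sum_nbij' (fun x ↦ ⟨(x.2.1, x.2.2 + x.1.2), (x.2.2, x.1.2)⟩)
    (fun x ↦ ⟨(x.1.1 + x.2.1, x.2.2), (x.1.1, x.2.1)⟩) ?_ ?_ ?_ ?_ ?_ <;>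
  · rintro ⟨⟨i, j⟩, ⟨k, l⟩⟩ h
    simp only [mem_sigma, HasAntidiagonal.mem_antidiagonal] at h
    obtain ⟨rfl, rfl⟩ := h
    simp [add_assoc]

theorem sum_antidiagonal_left_comm (φ : Mon → Mon → Mon → M) (m : Mon) :
    ∑ q ∈ antidiagonal m, ∑ r ∈ antidiagonal q.2, φ q.1 r.1 r.2 =
      ∑ q ∈ antidiagonal m, ∑ r ∈ antidiagonal q.2, φ r.1 q.1 r.2 := by
  rw [← sum_antidiagonal_assoc, ← sum_antidiagonal_assoc (fun i j k => φ j i k)]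
  refine Finset.sum_congr rfl fun q _ => ?_
  exact Finsupp.sum_antidiagonal_swap q.1 fun a b => φ a b q.2

/-- The convolution of two power series with respect to a biadditive map. -/
def conv (β : M₁ →+ M₂ →+ M₃) (f : MvPowerSeries Coord M₁) (g : MvPowerSeries Coord M₂) :
    MvPowerSeries Coord M₃ :=
  fun m => ∑ q ∈ antidiagonal m, β (f q.1) (g q.2)

theorem coeff_pd [Module ℂ M] (s : Coord) (f : MvPowerSeries Coord M) (m : Mon) :
    pd s f m = (m s + 1) • f (m + Finsupp.single s 1) := rfl

theorem series_add_apply (f g : MvPowerSeries Coord M) (m : Mon) : (f + g) m = f m + g m := rfl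

theorem series_zero_apply (m : Mon) : (0 : MvPowerSeries Coord M) m = 0 := rfl

theorem series_sub_apply (f g : MvPowerSeries Coord M) (m : Mon) : (f - g) m = f m - g m := rfl

theorem series_neg_apply (f : MvPowerSeries Coord M) (m : Mon) : (-f) m = -f m := rfl

/-- The factor `q.1 s` kills the splittings whose first part lacks `s`; all others are shifts by `s`
of splittings of `m`. This is the reindexing behind the Leibniz rule. -/
theorem sum_antidiagonal_single (φ : Mon → Mon → M) (s : Coord) (m : Mon) :
    ∑ q ∈ (antidiagonal (m + Finsupp.single s 1) : Finset (Mon × Mon)), q.1 s • φ q.1 q.2 =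
      ∑ q ∈ (antidiagonal m : Finset (Mon × Mon)), (q.1 s + 1) • φ (q.1 + Finsupp.single s 1) q.2 := by
  symm
  refine Finset.sum_of_injOn (fun q => (q.1 + Finsupp.single s 1, q.2)) ?_ ?_ ?_ ?_
  · rintro ⟨a, b⟩ _ ⟨c, d⟩ _ h
    simpa using h
  · rintro ⟨a, b⟩ h
    simp only [mem_coe, HasAntidiagonal.mem_antidiagonal] at h
    subst h
    simp [add_right_comm]
  · rintro ⟨a, b⟩ h h'
    simp only [HasAntidiagonal.mem_antidiagonal] at h
    have : a s = 0 := by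
      by_contra ha
      apply h'
      have hle : Finsupp.single s 1 ≤ a := by
        rw [Finsupp.single_le_iff]; omega
      refine ⟨(a - Finsupp.single s 1, b), ?_, ?_⟩
      · simp only [mem_coe, HasAntidiagonal.mem_antidiagonal]
        have := tsub_add_cancel_of_le hle
        rw [← this] at h
        rw [add_right_comm] at h
        exact add_right_cancel h
      · simp [tsub_add_cancel_of_le hle]
    simp [this]
  · rintro ⟨a, b⟩ _
    simp

/-- Split the multiplicity of `s` in the monomial into its shares in the two factors. Proved for a
general biadditive map, so that products, scalar multiples and brackets share one Leibniz rule. -/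
theorem pd_conv [Module ℂ M₁] [Module ℂ M₂] [Module ℂ M₃] (β : M₁ →+ M₂ →+ M₃) (s : Coord)
    (f : MvPowerSeries Coord M₁) (g : MvPowerSeries Coord M₂) :
    pd s (conv β f g) = conv β (pd s f) g + conv β f (pd s g) := by
  funext m
  have h2 := sum_antidiagonal_single (fun a b => β (f b) (g a)) s m
  rw [Finsupp.sum_antidiagonal_swap _ (fun a b => a s • β (f b) (g a)),
    Finsupp.sum_antidiagonal_swap _ (fun a b => (a s + 1) • β (f b) (g (a + _)))] at h2
  have h1 := sum_antidiagonal_single (fun a b => β (f a) (g b)) s m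
  simp only [coeff_pd, conv, series_add_apply, map_nsmul, AddMonoidHom.nsmul_apply]
  rw [← h1, ← h2, Finset.smul_sum, ← Finset.sum_add_distrib]
  refine Finset.sum_congr rfl fun q hq => ?_
  rw [← add_smul]
  congr 1
  have := DFunLike.congr_fun (HasAntidiagonal.mem_antidiagonal.mp hq) s
  simpa using this.symm

theorem pd_comm [Module ℂ M] (s s' : Coord) (f : MvPowerSeries Coord M) :
    pd s (pd s' f) = pd s' (pd s f) := by
  rcases eq_or_ne s s' with rfl | h
  · rfl
  funext m
  simp only [coeff_pd, smul_smul, Finsupp.add_apply, Finsupp.single_eq_of_ne h,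
    Finsupp.single_eq_of_ne h.symm, add_zero]
  rw [mul_comm, add_right_comm]

theorem pd_add [Module ℂ M] (s : Coord) (f g : MvPowerSeries Coord M) :
    pd s (f + g) = pd s f + pd s g := by
  funext m; simp [coeff_pd, series_add_apply]

theorem pd_zero [Module ℂ M] (s : Coord) : pd s (0 : MvPowerSeries Coord M) = 0 := by
  funext m; simp [coeff_pd, series_zero_apply]

theorem pd_neg [Module ℂ M] (s : Coord) (f : MvPowerSeries Coord M) :
    pd s (-f) = -pd s f := by
  funext m; simp [coeff_pd, series_neg_apply]

theorem pd_sub [Module ℂ M] (s : Coord) (f g : MvPowerSeries Coord M) :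
    pd s (f - g) = pd s f - pd s g := by
  rw [sub_eq_add_neg, pd_add, pd_neg, sub_eq_add_neg]

theorem pd_sum [Module ℂ M] {ι : Type*} (S : Finset ι) (s : Coord)
    (f : ι → MvPowerSeries Coord M) : pd s (∑ i ∈ S, f i) = ∑ i ∈ S, pd s (f i) := by
  classical
  induction S using Finset.induction_on with
  | empty => simp [pd_zero]
  | insert i S hi ih => rw [Finset.sum_insert hi, Finset.sum_insert hi, pd_add, ih]

/-- A series with vanishing derivative with respect to `s` has no monomials containing `s`. -/
theorem coeff_eq_zero_of_pd [Module ℂ M] {s : Coord} {f : MvPowerSeries Coord M}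
    (h : pd s f = 0) {m : Mon} (hm : m s ≠ 0) : f m = 0 := by
  have hle : Finsupp.single s 1 ≤ m := by rw [Finsupp.single_le_iff]; omega
  have h1 := congrFun h (m - Finsupp.single s 1)
  rw [coeff_pd, tsub_add_cancel_of_le hle, series_zero_apply, ← Nat.cast_smul_eq_nsmul ℂ] at h1
  exact (smul_eq_zero.mp h1).resolve_left (Nat.cast_ne_zero.mpr (Nat.succ_ne_zero _))

theorem mulSeries_eq_mul (f g : MvPowerSeries Coord ℂ) : mulSeries f g = f * g := by
  ext m
  rw [MvPowerSeries.coeff_mul]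
  rfl

end Convolution

section Module

variable {M : Type*} [AddCommGroup M] [Module ℂ M]

/-- Power series with coefficients in a vector space form a module over the scalar series. -/
instance (priority := low) seriesModule :
    Module (MvPowerSeries Coord ℂ) (MvPowerSeries Coord M) where
  smul f g := mulSeries f g
  one_smul g := by
    funext m
    refine (Finset.sum_eq_single (0, m) ?_ ?_).trans ?_
    · rintro ⟨a, b⟩ h h'
      have : a ≠ 0 := by
        rintro rfl
        apply h'
        simpa using h
      have h1 : (1 : MvPowerSeries Coord ℂ) a = 0 := by
        rw [← MvPowerSeries.coeff_apply (1 : MvPowerSeries Coord ℂ), MvPowerSeries.coeff_one,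
          if_neg this]
      simp [h1]
    · intro h
      simp at h
    · have h1 : (1 : MvPowerSeries Coord ℂ) (0 : Mon) = 1 :=
        MvPowerSeries.coeff_zero_one (σ := Coord) (R := ℂ)
      simp [h1]
  mul_smul f g h := by
    funext m
    change mulSeries (f * g) h m = mulSeries f (mulSeries g h) m
    rw [← mulSeries_eq_mul]
    simp only [mulSeries, Finset.sum_smul, Finset.smul_sum, smul_eq_mul, mul_smul]
    exact sum_antidiagonal_assoc (fun a b c => f a • g b • h c) m
  smul_zero f := by
    funext m
    exact Finset.sum_eq_zero fun q _ => smul_zero _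
  zero_smul f := by
    funext m
    exact Finset.sum_eq_zero fun q _ => zero_smul _ _
  smul_add f g h := by
    funext m
    change mulSeries f (g + h) m = mulSeries f g m + mulSeries f h m
    simp only [mulSeries, series_add_apply, smul_add, Finset.sum_add_distrib]
  add_smul f g h := by
    funext m
    change mulSeries (f + g) h m = mulSeries f h m + mulSeries g h m
    simp only [mulSeries, series_add_apply, add_smul, Finset.sum_add_distrib]

theorem pd_mulSeries (s : Coord) (f : MvPowerSeries Coord ℂ) (g : MvPowerSeries Coord M) :
    pd s (mulSeries f g) = mulSeries (pd s f) g + mulSeries f (pd s g) :=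
  pd_conv (smulAddHom ℂ M) s f g

theorem pd_mul (s : Coord) (f g : MvPowerSeries Coord ℂ) :
    pd s (f * g) = pd s f * g + f * pd s g := by
  simpa only [mulSeries_eq_mul] using pd_mulSeries s f g

theorem pd_C (s : Coord) (c : ℂ) : pd s (MvPowerSeries.C c) = 0 := by
  funext m
  have : (MvPowerSeries.C c : MvPowerSeries Coord ℂ) (m + Finsupp.single s 1) = 0 := by
    rw [← MvPowerSeries.coeff_apply (MvPowerSeries.C c), MvPowerSeries.coeff_C, if_neg]
    intro h
    simpa using DFunLike.congr_fun h s
  rw [coeff_pd, this, smul_zero]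
  rfl

theorem pd_X_self (s : Coord) : pd s (MvPowerSeries.X s) = (1 : MvPowerSeries Coord ℂ) := by
  ext m
  change pd s (MvPowerSeries.X s) m = _
  rw [coeff_pd, ← MvPowerSeries.coeff_apply (MvPowerSeries.X s), MvPowerSeries.coeff_X,
    MvPowerSeries.coeff_one]
  by_cases h : m = 0
  · simp [h]
  · simp [h]

theorem pd_X_of_ne {s s' : Coord} (h : s ≠ s') :
    pd s (MvPowerSeries.X s') = (0 : MvPowerSeries Coord ℂ) := by
  ext m
  change pd s (MvPowerSeries.X s') m = _
  rw [coeff_pd, ← MvPowerSeries.coeff_apply (MvPowerSeries.X s'), MvPowerSeries.coeff_X, if_neg,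
    smul_zero]
  · rfl
  · intro h'
    have := DFunLike.congr_fun h' s
    simp [h.symm] at this

theorem pd_coordSeries_self (a : Coord → ℂ) (s : Coord) : pd s (coordSeries a s) = 1 := by
  rw [coordSeries, pd_add, pd_C, pd_X_self, zero_add]

theorem pd_coordSeries_of_ne (a : Coord → ℂ) {s s' : Coord} (h : s ≠ s') :
    pd s (coordSeries a s') = 0 := by
  rw [coordSeries, pd_add, pd_C, pd_X_of_ne h, zero_add]

theorem pd_one (s : Coord) : pd s (1 : MvPowerSeries Coord ℂ) = 0 := by
  rw [← map_one MvPowerSeries.C, pd_C]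

end Module

section LieSeries

variable {L : Type*} [LieRing L]

theorem lieSeries_add (f g h : MvPowerSeries Coord L) :
    lieSeries f (g + h) = lieSeries f g + lieSeries f h := by
  funext m
  simp only [lieSeries, series_add_apply, lie_add, Finset.sum_add_distrib]

theorem lieSeries_skew (f g : MvPowerSeries Coord L) : lieSeries f g = -lieSeries g f := by
  funext m
  simp only [lieSeries, series_neg_apply]
  rw [Finsupp.sum_antidiagonal_swap _ (fun a b => ⁅f a, g b⁆), ← Finset.sum_neg_distrib]
  exact Finset.sum_congr rfl fun q _ => (lie_skew _ _).symm

variable [LieAlgebra ℂ L]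

/-- Power series with coefficients in a Lie algebra form a Lie ring. -/
instance (priority := low) seriesLieRing : LieRing (MvPowerSeries Coord L) where
  bracket f g := lieSeries f g
  add_lie f g h := by
    funext m
    change lieSeries (f + g) h m = lieSeries f h m + lieSeries g h m
    simp only [lieSeries, series_add_apply, add_lie, Finset.sum_add_distrib]
  lie_add := lieSeries_add
  lie_self f := by
    change lieSeries f f = 0
    have h : (2 : ℂ) • lieSeries f f = 0 := by
      rw [two_smul]
      nth_rewrite 1 [lieSeries_skew]
      exact neg_add_cancel _
    exact (smul_eq_zero.mp h).resolve_left two_ne_zero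
  leibniz_lie f g h := by
    funext m
    change lieSeries f (lieSeries g h) m =
      lieSeries (lieSeries f g) h m + lieSeries g (lieSeries f h) m
    simp only [lieSeries, lie_sum, sum_lie]
    rw [sum_antidiagonal_assoc (fun a b c => ⁅⁅f a, g b⁆, h c⁆),
      sum_antidiagonal_left_comm (fun a b c => ⁅g a, ⁅f b, h c⁆⁆)]
    simp only [← Finset.sum_add_distrib, ← leibniz_lie]

theorem mulSeries_eq_smul' (f : MvPowerSeries Coord ℂ) (g : MvPowerSeries Coord L) :
    mulSeries f g = f • g := rfl

instance (priority := low) seriesLieAlgebra :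
    LieAlgebra (MvPowerSeries Coord ℂ) (MvPowerSeries Coord L) where
  lie_smul f g h := by
    funext m
    change lieSeries g (mulSeries f h) m = mulSeries f (lieSeries g h) m
    simp only [lieSeries, mulSeries, lie_sum, Finset.smul_sum]
    rw [sum_antidiagonal_left_comm (fun a b c => ⁅g a, f b • h c⁆)]
    simp only [lie_smul]

instance (priority := high) seriesNatAlgebra : Algebra ℕ (MvPowerSeries Coord ℂ) :=
  Semiring.toNatAlgebra

instance (priority := high) seriesIntAlgebra : Algebra ℤ (MvPowerSeries Coord ℂ) :=
  Ring.toIntAlgebra _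

theorem coeff_lie (f g : MvPowerSeries Coord L) (m : Mon) :
    ⁅f, g⁆ m = ∑ q ∈ antidiagonal m, ⁅f q.1, g q.2⁆ := rfl

theorem coeff_smul (f : MvPowerSeries Coord ℂ) (g : MvPowerSeries Coord L) (m : Mon) :
    (f • g) m = ∑ q ∈ antidiagonal m, f q.1 • g q.2 := rfl

theorem pd_smul (s : Coord) (f : MvPowerSeries Coord ℂ) (g : MvPowerSeries Coord L) :
    pd s (f • g) = pd s f • g + f • pd s g := pd_mulSeries s f g

theorem pd_lie (s : Coord) (f g : MvPowerSeries Coord L) :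
    pd s ⁅f, g⁆ = ⁅pd s f, g⁆ + ⁅f, pd s g⁆ :=
  pd_conv (AddMonoidHom.mk' (fun x => AddMonoidHom.mk' (fun y => ⁅x, y⁆) (lie_add x))
    (fun x y => by ext z; exact add_lie x y z)) s f g

end LieSeries

/-! ### Total derivatives and their commutators with partial derivatives -/

section TotalDerivative

variable {M : Type*} [AddCommGroup M] [Module ℂ M] {L : Type*} [LieRing L] [LieAlgebra ℂ L]

theorem mulSeries_add (f : MvPowerSeries Coord ℂ) (g h : MvPowerSeries Coord M) :
    mulSeries f (g + h) = mulSeries f g + mulSeries f h :=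
  seriesModule.smul_add f g h

theorem mulSeries_zero (f : MvPowerSeries Coord ℂ) :
    mulSeries f (0 : MvPowerSeries Coord M) = 0 :=
  seriesModule.smul_zero f

theorem totalDx_add (a : Coord → ℂ) (n : ℕ) (f g : MvPowerSeries Coord M) :
    totalDx a n (f + g) = totalDx a n f + totalDx a n g := by
  simp only [totalDx, pd_add, mulSeries_add, Finset.sum_add_distrib]
  abel

theorem totalDx_zero (a : Coord → ℂ) (n : ℕ) : totalDx a n (0 : MvPowerSeries Coord M) = 0 := by
  simp [totalDx, pd_zero, mulSeries_zero]

theorem totalDx_neg (a : Coord → ℂ) (n : ℕ) (f : MvPowerSeries Coord M) :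
    totalDx a n (-f) = -totalDx a n f := by
  rw [eq_neg_iff_add_eq_zero, ← totalDx_add, neg_add_cancel, totalDx_zero]

theorem totalDx_sub (a : Coord → ℂ) (n : ℕ) (f g : MvPowerSeries Coord M) :
    totalDx a n (f - g) = totalDx a n f - totalDx a n g := by
  rw [sub_eq_add_neg, totalDx_add, totalDx_neg, sub_eq_add_neg]

theorem totalDx_mulSeries (a : Coord → ℂ) (n : ℕ) (f : MvPowerSeries Coord ℂ)
    (g : MvPowerSeries Coord M) :
    totalDx a n (mulSeries f g) = mulSeries (totalDx a n f) g + mulSeries f (totalDx a n g) := by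
  let _ := seriesModule (M := M)
  have e : ∀ (f : MvPowerSeries Coord ℂ) (g : MvPowerSeries Coord M),
    mulSeries f g = f • g := fun _ _ => rfl
  simp only [totalDx, pd_mulSeries, mulSeries_eq_mul]
  simp only [e, smul_add, add_smul, Finset.sum_smul, Finset.smul_sum, mul_smul,
    Finset.sum_add_distrib]
  simp only [smul_comm f]
  abel

theorem totalDx_mul (a : Coord → ℂ) (n : ℕ) (f g : MvPowerSeries Coord ℂ) :
    totalDx a n (f * g) = totalDx a n f * g + f * totalDx a n g := by
  simpa only [mulSeries_eq_mul] using totalDx_mulSeries a n f g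

theorem totalDx_smul (a : Coord → ℂ) (n : ℕ) (f : MvPowerSeries Coord ℂ)
    (g : MvPowerSeries Coord L) :
    totalDx a n (f • g) = totalDx a n f • g + f • totalDx a n g :=
  totalDx_mulSeries a n f g

theorem totalDx_lie (a : Coord → ℂ) (n : ℕ) (f g : MvPowerSeries Coord L) :
    totalDx a n ⁅f, g⁆ = ⁅totalDx a n f, g⁆ + ⁅f, totalDx a n g⁆ := by
  simp only [totalDx, pd_lie, mulSeries_eq_smul', add_lie, lie_add, sum_lie, lie_sum, smul_add,
    smul_lie, lie_smul, Finset.sum_add_distrib]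
  abel

theorem totalDx_C (a : Coord → ℂ) (n : ℕ) (c : ℂ) : totalDx a n (MvPowerSeries.C c) = 0 := by
  simp [totalDx, pd_C, mulSeries_zero]

theorem totalDx_one (a : Coord → ℂ) (n : ℕ) :
    totalDx a n (1 : MvPowerSeries Coord ℂ) = 0 := by
  rw [← map_one MvPowerSeries.C, totalDx_C]

theorem totalDx_coordSeries_u (a : Coord → ℂ) {n k : ℕ} (h : k < n) :
    totalDx a n (coordSeries a (.u k)) = coordSeries a (.u (k + 1)) := by
  rw [totalDx, pd_coordSeries_of_ne a (by simp), zero_add, Finset.sum_eq_single k]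
  · rw [pd_coordSeries_self, mulSeries_eq_mul, mul_one]
  · intro i _ hi
    rw [pd_coordSeries_of_ne a (by simpa using hi), mulSeries_zero]
  · intro h'
    exact absurd (mem_range.mpr h) h'

theorem zero_mulSeries (g : MvPowerSeries Coord M) : mulSeries 0 g = 0 := seriesModule.zero_smul g

theorem one_mulSeries (g : MvPowerSeries Coord M) : mulSeries 1 g = g := seriesModule.one_smul g

theorem pd_totalDx (a : Coord → ℂ) (n : ℕ) (s : Coord) (f : MvPowerSeries Coord M) :
    pd s (totalDx a n f) = totalDx a n (pd s f) +
      ∑ k ∈ range n, mulSeries (pd s (coordSeries a (.u (k + 1)))) (pd (.u k) f) := by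
  simp only [totalDx, pd_add, pd_sum, pd_mulSeries, Finset.sum_add_distrib]
  rw [pd_comm s .x]
  simp only [pd_comm s (.u _)]
  abel

/-- The commutator of `∂/∂u_{j+1}` with `D_x` is `∂/∂u_j`. Every descent through the variables `u_k`
below rests on it. -/
theorem pd_u_succ_totalDx (a : Coord → ℂ) {n j : ℕ} (h : j < n) (f : MvPowerSeries Coord M) :
    pd (.u (j + 1)) (totalDx a n f) = totalDx a n (pd (.u (j + 1)) f) + pd (.u j) f := by
  rw [pd_totalDx, Finset.sum_eq_single j]
  · rw [pd_coordSeries_self, one_mulSeries]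
  · intro i _ hi
    rw [pd_coordSeries_of_ne a (by simpa using hi.symm), zero_mulSeries]
  · intro h'
    exact absurd (mem_range.mpr h) h'

theorem pd_totalDx_of_ne (a : Coord → ℂ) {n : ℕ} {s : Coord} (h : ∀ k < n, s ≠ .u (k + 1))
    (f : MvPowerSeries Coord M) :
    pd s (totalDx a n f) = totalDx a n (pd s f) := by
  rw [pd_totalDx, Finset.sum_eq_zero, add_zero]
  intro k hk
  rw [pd_coordSeries_of_ne a (h k (mem_range.mp hk)), zero_mulSeries]

/-- The total derivative may be truncated at any order not smaller than that of the series. -/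
theorem totalDx_eq_of_le (a : Coord → ℂ) {n n' : ℕ} (h : n ≤ n') (f : MvPowerSeries Coord M)
    (hf : ∀ k, n ≤ k → pd (.u k) f = 0) : totalDx a n' f = totalDx a n f := by
  rw [totalDx, totalDx]
  congr 1
  symm
  refine Finset.sum_subset (range_subset_range.mpr h) fun k _ hk => ?_
  rw [hf k (by simpa using hk), mulSeries_zero]

end TotalDerivative

end
end ZCR

namespace ZCR

open Finset TensorProduct

noncomputable section

/-! ### The Lie algebra presented by the relations of the elliptic algebra -/

section Presentation

variable {L : Type*} [LieRing L] [LieAlgebra ℂ L]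

/-- Three elements of a Lie algebra that satisfy the relations of the elliptic algebra. -/
structure EllipticTriple (e : Fin 3 → ℂ) (p : Fin 3 → L) : Prop where
  lie_lie_eq_zero : ∀ i, ⁅p i, ⁅p (i + 1), p (i + 2)⁆⁆ = 0
  lie_lie_sub : ∀ i, ⁅p i, ⁅p i, p (i + 2)⁆⁆ - ⁅p (i + 1), ⁅p (i + 1), p (i + 2)⁆⁆ =
    (e i - e (i + 1)) • p (i + 2)

theorem fin3_add (i : Fin 3) : i + 1 + 1 = i + 2 ∧ i + 1 + 2 = i ∧ i + 2 + 1 = i ∧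
    i + 2 + 2 = i + 1 := by
  fin_cases i <;> decide

/-- The elements corresponding to `α_i ⊗ λⁿ v_i` and `α_i ⊗ λⁿ v_{i+1} v_{i+2}`. -/
def ellipticXY (e : Fin 3 → ℂ) (p : Fin 3 → L) : ℕ → (Fin 3 → L) × (Fin 3 → L)
  | 0 => (p, fun k => ⁅p (k + 1), p (k + 2)⁆)
  | n + 1 =>
    (fun k => ⁅p (k + 1), (ellipticXY e p n).2 (k + 2)⁆ + e (k + 1) • (ellipticXY e p n).1 k,
     fun k => ⁅p (k + 1), ⁅p (k + 2 + 1), (ellipticXY e p n).2 (k + 2 + 2)⁆ +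
      e (k + 2 + 1) • (ellipticXY e p n).1 (k + 2)⁆)

/-- The element corresponding to `α_i ⊗ λⁿ v_i`. -/
def ellipticX (e : Fin 3 → ℂ) (p : Fin 3 → L) (n : ℕ) : Fin 3 → L := (ellipticXY e p n).1

/-- The element corresponding to `α_i ⊗ λⁿ v_{i+1} v_{i+2}`. -/
def ellipticY (e : Fin 3 → ℂ) (p : Fin 3 → L) (n : ℕ) : Fin 3 → L := (ellipticXY e p n).2

variable (e : Fin 3 → ℂ) (p : Fin 3 → L)

theorem ellipticX_zero : ellipticX e p 0 = p := rfl

/-- In the model, `v_{k+1} · (v_k v_{k+1}) = (λ - e_{k+1}) v_k`; the added term restores a full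
factor `λ`. -/
theorem ellipticX_succ (n : ℕ) (k : Fin 3) : ellipticX e p (n + 1) k =
    ⁅p (k + 1), ellipticY e p n (k + 2)⁆ + e (k + 1) • ellipticX e p n k := rfl

theorem ellipticY_eq (n : ℕ) (k : Fin 3) :
    ellipticY e p n k = ⁅p (k + 1), ellipticX e p n (k + 2)⁆ := by
  cases n <;> rfl

/-- The brackets of `X_i^a` and `X_j^b` for `a + b = n`. -/
def LieXX (n : ℕ) : Prop := ∀ a b, a + b = n → ∀ i,
  ⁅ellipticX e p a i, ellipticX e p b i⁆ = 0 ∧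
  ⁅ellipticX e p a i, ellipticX e p b (i + 1)⁆ = ellipticY e p n (i + 2)

/-- The brackets of `Y_i^a` and `Y_j^b` for `a + b = n`. -/
def LieYY (n : ℕ) : Prop := ∀ a b, a + b = n → ∀ i,
  ⁅ellipticY e p a i, ellipticY e p b i⁆ = 0 ∧
  ⁅ellipticY e p a i, ellipticY e p b (i + 1)⁆ =
    ellipticY e p (n + 1) (i + 2) - e (i + 2) • ellipticY e p n (i + 2)

/-- The brackets of `X_i^a` and `Y_j^b` for `a + b = n`. -/
def LieXY (n : ℕ) : Prop := ∀ a b, a + b = n → ∀ i,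
  ⁅ellipticX e p a i, ellipticY e p b i⁆ = 0 ∧
  ⁅ellipticX e p a i, ellipticY e p b (i + 1)⁆ =
    ellipticX e p (n + 1) (i + 2) - e i • ellipticX e p n (i + 2) ∧
  ⁅ellipticX e p a (i + 1), ellipticY e p b i⁆ =
    -(ellipticX e p (n + 1) (i + 2) - e (i + 1) • ellipticX e p n (i + 2))

variable {e p}

theorem lieXX_zero : LieXX e p 0 := by
  intro a b h i
  obtain ⟨rfl, rfl⟩ : a = 0 ∧ b = 0 := by omega
  obtain ⟨h1, h2, h3, h4⟩ := fin3_add i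
  rw [ellipticY_eq, ellipticX_zero, h3, h4]
  exact ⟨lie_self _, rfl⟩

theorem EllipticTriple.lieXY_zero (hp : EllipticTriple e p) : LieXY e p 0 := by
  intro a b h i
  obtain ⟨rfl, rfl⟩ : a = 0 ∧ b = 0 := by omega
  obtain ⟨h1, h2, h3, h4⟩ := fin3_add i
  simp only [ellipticY_eq, ellipticX_succ, ellipticX_zero, h1, h2, h3, h4]
  have hs : ⁅p (i + 2), p i⁆ = -⁅p i, p (i + 2)⁆ := (lie_skew _ _).symm
  refine ⟨hp.lie_lie_eq_zero i, by abel, ?_⟩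
  rw [hs, lie_neg]
  have := hp.lie_lie_sub i
  linear_combination (norm := module) -this

variable {n : ℕ}

/-- The element `X_i^{n+1}` can be reached through either of the two other indices. The first
expression is the definition, the second is a relation at level `n`; playing them against each other
drives the induction. -/
theorem LieXY.succ_eq (h : LieXY e p n) (i : Fin 3) :
    ellipticX e p (n + 1) i =
      ⁅p (i + 1), ellipticY e p n (i + 2)⁆ + e (i + 1) • ellipticX e p n i ∧
    ellipticX e p (n + 1) i =
      -⁅p (i + 2), ellipticY e p n (i + 1)⁆ + e (i + 2) • ellipticX e p n i := by
  obtain ⟨h1, h2, h3, h4⟩ := fin3_add i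
  refine ⟨rfl, ?_⟩
  have := (h 0 n (by omega) (i + 1)).2.2
  rw [h1, h2, ellipticX_zero] at this
  rw [this]
  abel

/-- Expand the factor of raised degree by one of the two formulas and use Jacobi. Both placements of
the additional `λ` lead to the same right-hand side, so it may be moved from one factor to the
other. -/
theorem lieXX_lieYY_offdiag (hX : ∀ k ≤ n, LieXX e p k) (hY : ∀ k ≤ n, LieXY e p k) {a b : ℕ}
    (hab : a + b = n) (i : Fin 3) :
    ⁅ellipticX e p (a + 1) i, ellipticX e p b (i + 1)⁆ =
      ⁅ellipticY e p b i, ellipticY e p a (i + 1)⁆ + e (i + 2) • ellipticY e p n (i + 2) ∧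
    ⁅ellipticX e p a i, ellipticX e p (b + 1) (i + 1)⁆ =
      ⁅ellipticY e p b i, ellipticY e p a (i + 1)⁆ + e (i + 2) • ellipticY e p n (i + 2) := by
  obtain ⟨h1, h2, h3, h4⟩ := fin3_add i
  constructor
  · rw [((hY a (by omega)).succ_eq i).2, add_lie, smul_lie, (hX n le_rfl a b hab i).2, neg_lie,
      lie_lie, ← lie_skew (ellipticY e p a (i + 1)) (ellipticX e p b (i + 1)),
      (hY n le_rfl b a (by omega) (i + 1)).1, neg_zero, lie_zero]
    have := (hX b (by omega) b 0 (by omega) (i + 1)).2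
    rw [h1, h2, ellipticX_zero] at this
    rw [← lie_skew (p (i + 2)), this, lie_neg, ← lie_skew (ellipticY e p b i)]
    abel
  · rw [((hY b (by omega)).succ_eq (i + 1)).1, lie_add, lie_smul, (hX n le_rfl a b hab i).2,
      h1, h2, leibniz_lie, (hY n le_rfl a b hab i).1, lie_zero]
    have := (hX a (by omega) 0 a (by omega) (i + 2)).2
    rw [h3, h4, ellipticX_zero] at this
    rw [← lie_skew (ellipticX e p a i) (p (i + 2)), this, neg_lie, lie_skew]
    abel

/-- One expansion of `X_i^{a+1}` for each of the two formulas of `LieXY.succ_eq`. Their comparison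
relates the diagonal brackets of different indices. -/
theorem lieXX_diag (hX : ∀ k ≤ n, LieXX e p k) (hY : ∀ k ≤ n, LieXY e p k) {a b : ℕ}
    (hab : a + b = n) (i : Fin 3) :
    ⁅ellipticX e p (a + 1) i, ellipticX e p b i⁆ =
      ⁅p (i + 1), ellipticX e p (n + 1) (i + 1)⁆ +
        ⁅ellipticY e p a (i + 2), ellipticY e p b (i + 2)⁆ ∧
    ⁅ellipticX e p (a + 1) i, ellipticX e p b i⁆ =
      ⁅p (i + 2), ellipticX e p (n + 1) (i + 2)⁆ +
        ⁅ellipticY e p a (i + 1), ellipticY e p b (i + 1)⁆ := by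
  obtain ⟨h1, h2, h3, h4⟩ := fin3_add i
  have z : ∀ i, ⁅p i, ellipticX e p n i⁆ = 0 := fun i => (hX n le_rfl 0 n (by omega) i).1
  constructor
  · have t1 := (hY n le_rfl b a (by omega) (i + 2)).2.2
    have t2 := (hX b (by omega) b 0 (by omega) i).2
    rw [h3, h4] at t1
    rw [ellipticX_zero] at t2
    rw [((hY a (by omega)).succ_eq i).1, add_lie, smul_lie, (hX n le_rfl a b hab i).1, lie_lie,
      ← lie_skew (ellipticY e p a (i + 2)) (ellipticX e p b i), t1, neg_neg, lie_sub, lie_smul, z,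
      ← lie_skew (p (i + 1)) (ellipticX e p b i), t2, lie_neg]
    module
  · have t1 := (hY n le_rfl b a (by omega) i).2.1
    have t2 := (hX b (by omega) 0 b (by omega) (i + 2)).2
    rw [h3, h4, ellipticX_zero] at t2
    rw [((hY a (by omega)).succ_eq i).2, add_lie, smul_lie, (hX n le_rfl a b hab i).1, neg_lie,
      lie_lie, ← lie_skew (ellipticY e p a (i + 1)) (ellipticX e p b i), t1, lie_neg, lie_sub,
      lie_smul, z, t2]
    module

/-- Moving `λ` between the factors settles distinct indices. For equal indices all brackets are odd
multiples of one obstruction `z`, which skew-symmetry kills; the brackets of the `Y` at level `n`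
are then read off. -/
theorem lieXX_succ (hX : ∀ k ≤ n, LieXX e p k) (hY : ∀ k ≤ n, LieXY e p k) :
    LieXX e p (n + 1) ∧ LieYY e p n := by
  have off : ∀ (i : Fin 3) (a b : ℕ), a + b = n + 1 →
      ⁅ellipticX e p a i, ellipticX e p b (i + 1)⁆ = ellipticY e p (n + 1) (i + 2) := by
    intro i a
    obtain ⟨h1, h2, h3, h4⟩ := fin3_add i
    induction a with
    | zero =>
      intro b hb
      obtain rfl : b = n + 1 := by omega
      rw [ellipticY_eq, h3, h4]
      rfl
    | succ a ih =>
      intro b hb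
      obtain ⟨o1, o2⟩ := lieXX_lieYY_offdiag hX hY (show a + b = n by omega) i
      rw [o1, ← o2]
      exact ih _ (by omega)
  set z : Fin 3 → L := fun i => ⁅p i, ellipticX e p (n + 1) i⁆ with hz
  -- Add the expansion of the bracket with `a` and `b` exchanged: the brackets of the `Y` cancel by
  -- skew-symmetry and twice the obstruction remains.
  have step : ∀ i a b, a + b = n → 
      ⁅ellipticX e p (a + 1) i, ellipticX e p b i⁆ =
        ⁅ellipticX e p a i, ellipticX e p (b + 1) i⁆ + (2 : ℂ) • z (i + 1) ∧
      ⁅ellipticX e p (a + 1) i, ellipticX e p b i⁆ =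
        ⁅ellipticX e p a i, ellipticX e p (b + 1) i⁆ + (2 : ℂ) • z (i + 2) := by
    intro i a b hab
    obtain ⟨d1, d2⟩ := lieXX_diag hX hY hab i
    obtain ⟨d3, d4⟩ := lieXX_diag hX hY (show b + a = n by omega) i
    rw [← lie_skew] at d3 d4
    have s1 := lie_skew (ellipticY e p a (i + 2)) (ellipticY e p b (i + 2))
    have s2 := lie_skew (ellipticY e p a (i + 1)) (ellipticY e p b (i + 1))
    constructor
    · simp only [hz]
      linear_combination (norm := module) d1 + d3 - s1
    · simp only [hz]
      linear_combination (norm := module) d2 + d4 - s2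
  have zeq : ∀ i, z (i + 1) = z (i + 2) := by
    intro i
    obtain ⟨d1, d2⟩ := step i 0 n (by omega)
    have : (2 : ℂ) • z (i + 1) = (2 : ℂ) • z (i + 2) := add_left_cancel (d1.symm.trans d2)
    exact smul_right_injective _ two_ne_zero this
  have zeq' : ∀ i, z (i + 1) = z i := by
    intro i
    obtain ⟨h1, h2, h3, h4⟩ := fin3_add i
    have := zeq (i + 1)
    rw [h1, h2] at this
    rw [zeq, this]
  have lad : ∀ i a b, a + b = n + 1 →
      ⁅ellipticX e p a i, ellipticX e p b i⁆ = (2 * a + 1 : ℂ) • z i := by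
    intro i a
    induction a with
    | zero =>
      intro b hb
      obtain rfl : b = n + 1 := by omega
      simp [hz, ellipticX_zero]
    | succ a ih =>
      intro b hb
      rw [(step i a b (by omega)).1, ih _ (by omega), zeq', ← add_smul]
      push_cast
      congr 1
      ring
  have z0 : ∀ i, z i = 0 := by
    intro i
    have h1 := lad i (n + 1) 0 (by omega)
    have h2 := lad i 0 (n + 1) (by omega)
    rw [← lie_skew, h2, ← neg_smul, ← sub_eq_zero, ← sub_smul] at h1
    refine (smul_eq_zero.mp h1).resolve_left ?_
    push_cast
    -- Exchanging the factors turns the multiple `2(n+1)+1` of `z` into `-1` times `z`, so `2n+4`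
    -- annihilates it.
    have : (-(2 * 0 + 1) - (2 * (n + 1) + 1) : ℂ) = -((2 * n + 4 : ℕ) : ℂ) := by push_cast; ring
    rw [this]
    exact neg_ne_zero.mpr (Nat.cast_ne_zero.mpr (by omega))
  refine ⟨fun a b hab i => ⟨by rw [lad i a b hab, z0, smul_zero], off i a b hab⟩,
    fun a b hab i => ⟨?_, ?_⟩⟩
  · obtain ⟨h1, h2, h3, h4⟩ := fin3_add i
    have d1 := (lieXX_diag hX hY hab (i + 1)).1
    rw [lad _ _ _ (by omega), h2, h1] at d1
    have e1 : ⁅p (i + 2), ellipticX e p (n + 1) (i + 2)⁆ = 0 := z0 (i + 2)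
    rw [z0, smul_zero, e1, zero_add] at d1
    exact d1.symm
  · have d1 := (lieXX_lieYY_offdiag hX hY (show b + a = n by omega) i).2
    rw [off i _ _ (by omega)] at d1
    rw [d1]
    abel

theorem lieXY_succ_aux (hXY : ∀ k ≤ n, LieXY e p k)
    (hYY : LieYY e p n) {a b : ℕ} (hab : a + b = n) (i : Fin 3) :
    ⁅ellipticX e p (a + 1) i, ellipticY e p b i⁆ = ⁅p (i + 1), ellipticY e p (n + 1) (i + 1)⁆ -
      ⁅ellipticX e p (b + 1) (i + 2), ellipticY e p a (i + 2)⁆ ∧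
    ⁅ellipticX e p (a + 1) i, ellipticY e p b i⁆ = ⁅p (i + 2), ellipticY e p (n + 1) (i + 2)⁆ -
      ⁅ellipticX e p (b + 1) (i + 1), ellipticY e p a (i + 1)⁆ := by
  obtain ⟨h1, h2, h3, h4⟩ := fin3_add i
  have z : ∀ i, ⁅p i, ellipticY e p n i⁆ = 0 := fun i => (hXY n le_rfl 0 n (by omega) i).1
  constructor
  · have t1 := (hYY a b hab (i + 2)).2
    have t2 := (hXY b (by omega) 0 b (by omega) i).2.2
    have t3 := (hXY n le_rfl b a (by omega) (i + 2)).1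
    rw [h3, h4] at t1
    rw [ellipticX_zero] at t2
    rw [((hXY a (by omega)).succ_eq i).1, add_lie, smul_lie, (hXY n le_rfl a b hab i).1, lie_lie,
      t1, t2, lie_sub, lie_smul, z, lie_neg, lie_sub, lie_smul,
      ← lie_skew (ellipticY e p a (i + 2)) (ellipticX e p b (i + 2)), t3,
      ← lie_skew (ellipticX e p (b + 1) (i + 2))]
    simp
  · have t1 := (hYY b a (by omega) i).2
    have t2 := (hXY b (by omega) 0 b (by omega) (i + 2)).2.1
    have t3 := (hXY n le_rfl b a (by omega) (i + 1)).1
    rw [h3, h4, ellipticX_zero] at t2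
    rw [((hXY a (by omega)).succ_eq i).2, add_lie, smul_lie, (hXY n le_rfl a b hab i).1, neg_lie,
      lie_lie, ← lie_skew (ellipticY e p a (i + 1)) (ellipticY e p b i), t1, t2, lie_neg, lie_sub,
      lie_smul, z, lie_sub, lie_smul,
      ← lie_skew (ellipticY e p a (i + 1)) (ellipticX e p b (i + 1)), t3,
      ← lie_skew (ellipticX e p (b + 1) (i + 1))]
    module

/-- For distinct indices the bracket depends only on the sum of the degrees. For equal indices the
obstructions `ρ i` all coincide, the brackets are odd multiples of them, and the Jacobi identity
gives a nonzero multiple of `ρ` equal to zero. -/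
theorem lieXY_succ (hX : ∀ k ≤ n + 1, LieXX e p k) (hXY : ∀ k ≤ n, LieXY e p k)
    (hYY : LieYY e p n) : LieXY e p (n + 1) := by
  have Q1 : ∀ i a b, a + b = n + 1 → ⁅ellipticX e p a i, ellipticY e p b (i + 1)⁆ =
      ⁅p i, ellipticY e p (n + 1) (i + 1)⁆ := by
    intro i a b hab
    obtain ⟨h1, h2, h3, h4⟩ := fin3_add i
    have t1 := (hX b (by omega) b 0 (by omega) (i + 2)).2
    have t2 := (hX (n + 1) le_rfl b a (by omega) (i + 2)).2
    rw [h3, h4] at t1 t2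
    rw [← t1, leibniz_lie, (hX a (by omega) a 0 (by omega) i).1, lie_zero, add_zero, ← lie_skew,
      ← lie_skew (ellipticX e p a i), t2, lie_neg, neg_neg, ellipticX_zero]
  have Q2 : ∀ i a b, a + b = n + 1 → ⁅ellipticX e p a (i + 1), ellipticY e p b i⁆ =
      ⁅p (i + 1), ellipticY e p (n + 1) i⁆ := by
    intro i a b hab
    obtain ⟨h1, h2, h3, h4⟩ := fin3_add i
    have t1 := (hX b (by omega) 0 b (by omega) (i + 1)).2
    have t2 := (hX (n + 1) le_rfl a b hab (i + 1)).2
    rw [h1, h2] at t1 t2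
    rw [← t1, leibniz_lie, (hX a (by omega) a 0 (by omega) (i + 1)).1, zero_lie, zero_add, t2,
      ellipticX_zero]
  have def1 : ∀ i, ⁅p i, ellipticY e p (n + 1) (i + 1)⁆ =
      ellipticX e p (n + 1 + 1) (i + 2) - e i • ellipticX e p (n + 1) (i + 2) := by
    intro i
    obtain ⟨h1, h2, h3, h4⟩ := fin3_add i
    rw [ellipticX_succ e p (n + 1), h3, h4, add_sub_cancel_right]
  -- Expand `X_i^1` in `[X_i^1, Y_{i+1}^n]`, which `Q1` identifies with the left-hand side.
  have Q3 : ∀ i, ⁅p i, ellipticY e p (n + 1) (i + 1)⁆ = -⁅p (i + 1), ellipticY e p (n + 1) i⁆ +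
      (e (i + 1) - e i) • ellipticX e p (n + 1) (i + 2) := by
    intro i
    obtain ⟨h1, h2, h3, h4⟩ := fin3_add i
    have t1 := (hYY n 0 (by omega) (i + 1)).2
    rw [h1, h2] at t1
    have t2 := (hXY n le_rfl 0 n (by omega) (i + 1)).1
    have t3 := (hXY n le_rfl 0 n (by omega) i).2.1
    have t4 := (hXY n le_rfl 0 n (by omega) i).2.2
    rw [ellipticX_zero] at t2 t3 t4
    have t5 := Q1 i 1 n (by omega)
    rw [((hXY 0 (by omega)).succ_eq i).1, add_lie, smul_lie, ellipticX_zero, t3, lie_lie, t2,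
      ← lie_skew (ellipticY e p 0 (i + 2)), t1, lie_zero, lie_neg, lie_sub, lie_smul, t4] at t5
    rw [← t5]
    module
  set ρ : Fin 3 → L := fun i => ⁅p i, ellipticY e p (n + 1) i⁆ with hρ
  -- The Jacobi identity of `X_i^a`, `X_{i+1}^c`, `X_{i+2}^d`, whose inner brackets are already
  -- known to be `Y`'s.
  have jac : ∀ i a c d, a + c + d = n + 1 → ⁅ellipticX e p a i, ellipticY e p (c + d) i⁆ +
      ⁅ellipticX e p c (i + 1), ellipticY e p (a + d) (i + 1)⁆ +
      ⁅ellipticX e p d (i + 2), ellipticY e p (a + c) (i + 2)⁆ = 0 := by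
    intro i a c d hacd
    obtain ⟨h1, h2, h3, h4⟩ := fin3_add i
    have t1 := (hX (c + d) (by omega) c d rfl (i + 1)).2
    have t2 := (hX (a + d) (by omega) d a (by omega) (i + 2)).2
    have t3 := (hX (a + c) (by omega) a c rfl i).2
    rw [h1, h2] at t1
    rw [h3, h4] at t2
    rw [← t1, ← t2, ← t3]
    exact lie_jacobi _ _ _
  have one1 : ∀ i, ⁅ellipticX e p 1 (i + 1), ellipticY e p n (i + 1)⁆ =
      (2 : ℂ) • ρ i + ρ (i + 1) := by
    intro i
    obtain ⟨h1, h2, h3, h4⟩ := fin3_add i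
    have j := jac i 0 0 (n + 1) (by omega)
    have s := (lieXY_succ_aux hXY hYY (show n + 0 = n by omega) (i + 2)).1
    simp only [h3, h4, zero_add, ellipticX_zero] at j s
    rw [s] at j
    simp only [hρ]
    linear_combination (norm := module) -j
  have one2 : ∀ i, ⁅ellipticX e p 1 i, ellipticY e p n i⁆ = ρ i + (2 : ℂ) • ρ (i + 1) := by
    intro i
    obtain ⟨h1, h2, h3, h4⟩ := fin3_add i
    have j := jac i 0 0 (n + 1) (by omega)
    have s := (lieXY_succ_aux hXY hYY (show n + 0 = n by omega) (i + 2)).2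
    simp only [h3, h4, zero_add, ellipticX_zero] at j s
    rw [s] at j
    simp only [hρ]
    linear_combination (norm := module) -j
  have ρeq' : ∀ i, ρ (i + 2) = ρ i := by
    intro i
    obtain ⟨h1, h2, h3, h4⟩ := fin3_add i
    have := (one1 i).symm.trans (one2 (i + 1))
    rw [h1] at this
    have h6 : (2 : ℂ) • ρ (i + 2) = (2 : ℂ) • ρ i := by
      linear_combination (norm := module) -this
    exact smul_right_injective _ two_ne_zero h6
  have ρeq : ∀ i, ρ (i + 1) = ρ i := fun i => by
    rw [← (fin3_add i).2.2.2, ρeq', ρeq']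
  have lad : ∀ i a b, a + b = n + 1 →
      ⁅ellipticX e p a i, ellipticY e p b i⁆ = (2 * a + 1 : ℂ) • ρ i := by
    intro i a
    induction a with
    | zero =>
      intro b hb
      obtain rfl : b = n + 1 := by omega
      simp [hρ, ellipticX_zero]
    | succ a ih =>
      intro b hb
      have j1 := jac i (a + 1) 0 b (by omega)
      have j2 := jac i a 1 b (by omega)
      have o := one1 i
      rw [show a + b = n by omega, show 1 + b = b + 1 by omega, ih (b + 1) (by omega), o] at j2
      rw [show a + 1 + b = n + 1 by omega, zero_add, ellipticX_zero] at j1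
      have e1 : ⁅p (i + 1), ellipticY e p (n + 1) (i + 1)⁆ = ρ i := ρeq i
      rw [e1] at j1
      rw [ρeq] at j2
      push_cast
      linear_combination (norm := module) j1 - j2
  have ρ0 : ∀ i, ρ i = 0 := by
    intro i
    obtain ⟨h1, h2, h3, h4⟩ := fin3_add i
    have j := jac i 0 0 (n + 1) (by omega)
    rw [lad _ _ _ (by omega), lad _ _ _ (by omega), lad _ _ _ (by omega), ρeq', ρeq,
      ← add_smul, ← add_smul] at j
    refine (smul_eq_zero.mp j).resolve_left ?_
    -- The three terms of `jac` at degrees `0, 0, n+1` contribute `1 + 1 + (2n+3)`.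
    have : (2 * (0 : ℕ) + 1 + (2 * (0 : ℕ) + 1) + (2 * (n + 1 : ℕ) + 1) : ℂ) =
      ((2 * n + 5 : ℕ) : ℂ) := by push_cast; ring
    rw [this]
    exact Nat.cast_ne_zero.mpr (by omega)
  intro a b hab i
  refine ⟨by rw [lad i a b hab, ρ0, smul_zero], (Q1 i a b hab).trans (def1 i), ?_⟩
  rw [Q2 i a b hab]
  have q3 := Q3 i
  have d1 := def1 i
  linear_combination (norm := module) q3 - d1

theorem EllipticTriple.lieXX_lieXY (hp : EllipticTriple e p) (n : ℕ) :
    ∀ k ≤ n, LieXX e p k ∧ LieXY e p k := by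
  induction n with
  | zero =>
    intro k hk
    obtain rfl : k = 0 := by omega
    exact ⟨lieXX_zero, hp.lieXY_zero⟩
  | succ n ih =>
    intro k hk
    rcases Nat.lt_or_ge k (n + 1) with h | h
    · exact ih k (by omega)
    obtain rfl : k = n + 1 := by omega
    obtain ⟨h1, h2⟩ := lieXX_succ (fun k hk => (ih k hk).1) (fun k hk => (ih k hk).2)
    refine ⟨h1, lieXY_succ ?_ (fun k hk => (ih k hk).2) h2⟩
    intro k hk
    rcases Nat.lt_or_ge k (n + 1) with h | h
    · exact (ih k (by omega)).1
    · obtain rfl : k = n + 1 := by omega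
      exact h1

theorem EllipticTriple.lieXX (hp : EllipticTriple e p) (n : ℕ) : LieXX e p n :=
  (hp.lieXX_lieXY n n le_rfl).1

theorem EllipticTriple.lieXY (hp : EllipticTriple e p) (n : ℕ) : LieXY e p n :=
  (hp.lieXX_lieXY n n le_rfl).2

/-- The linear span of the elements `X_i^n` and `Y_i^n`. -/
def ellipticSpan (e : Fin 3 → ℂ) (p : Fin 3 → L) : Submodule ℂ L :=
  Submodule.span ℂ (Set.range (fun x : ℕ × Fin 3 => ellipticX e p x.1 x.2) ∪
    Set.range (fun x : ℕ × Fin 3 => ellipticY e p x.1 x.2))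

theorem ellipticX_mem (n : ℕ) (i : Fin 3) : ellipticX e p n i ∈ ellipticSpan e p :=
  Submodule.subset_span (Or.inl ⟨(n, i), rfl⟩)

theorem ellipticY_mem (n : ℕ) (i : Fin 3) : ellipticY e p n i ∈ ellipticSpan e p :=
  Submodule.subset_span (Or.inr ⟨(n, i), rfl⟩)

theorem EllipticTriple.lie_p_mem (hp : EllipticTriple e p) (i : Fin 3) {y : L}
    (hy : y ∈ ellipticSpan e p) : ⁅p i, y⁆ ∈ ellipticSpan e p := by
  induction hy using Submodule.span_induction with
  | zero => rw [lie_zero]; exact zero_mem _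
  | add x y _ _ hx hy => rw [lie_add]; exact add_mem hx hy
  | smul c x _ hx => rw [lie_smul]; exact Submodule.smul_mem _ c hx
  | mem y hy =>
    have key : ∀ j : Fin 3, j = i ∨ j = i + 1 ∨ i = j + 1 := by
      revert i; decide
    rcases hy with ⟨⟨n, j⟩, rfl⟩ | ⟨⟨n, j⟩, rfl⟩
    · dsimp only
      rcases key j with rfl | rfl | rfl
      · have := (hp.lieXX n 0 n (by omega) j).1
        rw [ellipticX_zero] at this
        rw [this]
        exact zero_mem _
      · have := (hp.lieXX n 0 n (by omega) i).2
        rw [ellipticX_zero] at this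
        rw [this]
        exact ellipticY_mem _ _
      · have := (hp.lieXX n n 0 (by omega) j).2
        rw [ellipticX_zero] at this
        rw [← lie_skew, this]
        exact neg_mem (ellipticY_mem _ _)
    · dsimp only
      rcases key j with rfl | rfl | rfl
      · have := (hp.lieXY n 0 n (by omega) j).1
        rw [ellipticX_zero] at this
        rw [this]
        exact zero_mem _
      · have := (hp.lieXY n 0 n (by omega) i).2.1
        rw [ellipticX_zero] at this
        rw [this]
        exact sub_mem (ellipticX_mem _ _) (Submodule.smul_mem _ _ (ellipticX_mem _ _))
      · have := (hp.lieXY n 0 n (by omega) j).2.2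
        rw [ellipticX_zero] at this
        rw [this]
        exact neg_mem (sub_mem (ellipticX_mem _ _) (Submodule.smul_mem _ _ (ellipticX_mem _ _)))

/-- The span is stable under the generators, hence under everything they generate. It is therefore a
subalgebra containing the generators. -/
theorem EllipticTriple.span_eq_top (hp : EllipticTriple e p)
    (hg : LieSubalgebra.lieSpan ℂ L (Set.range p) = ⊤) : ellipticSpan e p = ⊤ := by
  have hn : ∀ x ∈ LieSubalgebra.lieSpan ℂ L (Set.range p), ∀ y ∈ ellipticSpan e p,
      ⁅x, y⁆ ∈ ellipticSpan e p := by
    intro x hx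
    induction hx using LieSubalgebra.lieSpan_induction with
    | mem x hx =>
      obtain ⟨i, rfl⟩ := hx
      exact fun y hy => hp.lie_p_mem i hy
    | zero => intro y _; rw [zero_lie]; exact zero_mem _
    | add x x' _ _ h h' => intro y hy; rw [add_lie]; exact add_mem (h y hy) (h' y hy)
    | smul c x _ h => intro y hy; rw [smul_lie]; exact Submodule.smul_mem _ c (h y hy)
    | lie x x' _ _ h h' =>
      intro y hy
      rw [lie_lie]
      exact sub_mem (h _ (h' y hy)) (h' _ (h y hy))
  have hle : LieSubalgebra.lieSpan ℂ L (Set.range p) ≤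
      { ellipticSpan e p with
        lie_mem' := fun {x y} _ hy => hn x (hg ▸ LieSubalgebra.mem_top x) y hy } := by
    rw [LieSubalgebra.lieSpan_le]
    rintro _ ⟨i, rfl⟩
    exact ellipticX_mem 0 i
  rw [eq_top_iff]
  exact fun x _ => hle (hg.symm ▸ LieSubalgebra.mem_top x)

end Presentation

/-! ### Faithfulness: evaluation at points of the curve -/

section Injective

variable {L : Type*} [LieRing L] [LieAlgebra ℂ L]

/-- Evaluation of functions on the curve at a point. -/
def curveEval (e : Fin 3 → ℂ) (s : Fin 3 → ℂ) (hs : ∀ i j, s i ^ 2 - s j ^ 2 + e i - e j = 0) :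
    CurveAlg e →ₐ[ℂ] ℂ :=
  Ideal.Quotient.liftₐ (curveIdeal e) (MvPolynomial.aeval s) (by
    intro f hf
    have : curveIdeal e ≤ RingHom.ker (MvPolynomial.aeval s : MvPolynomial (Fin 3) ℂ →ₐ[ℂ] ℂ) := by
      rw [curveIdeal, Ideal.span_le]
      rintro _ ⟨i, j, rfl⟩
      simpa [RingHom.mem_ker] using hs i j
    exact this hf)

theorem curveEval_vHat (e s : Fin 3 → ℂ) (hs : ∀ i j, s i ^ 2 - s j ^ 2 + e i - e j = 0)
    (i : Fin 3) : curveEval e s hs (vHat e i) = s i := by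
  change MvPolynomial.aeval s (MvPolynomial.X i) = s i
  simp

theorem curve_smul_def (e : Fin 3 → ℂ) (c : ℂ) (g : CurveAlg e) :
    c • g = algebraMap ℂ (CurveAlg e) c * g := by
  obtain ⟨g, rfl⟩ := Ideal.Quotient.mk_surjective g
  exact congrArg (Ideal.Quotient.mk (curveIdeal e)) (MvPolynomial.smul_eq_C_mul g c)

/-- The functional on `E ⊗ 𝔰𝔬₃` given by evaluation at a point and a coordinate. -/
def curveFunctional (e : Fin 3 → ℂ) (α : Module.Basis (Fin 3) ℂ SO3) (s : Fin 3 → ℂ)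
    (hs : ∀ i j, s i ^ 2 - s j ^ 2 + e i - e j = 0) (i : Fin 3) : CurveAlg e ⊗[ℂ] SO3 →ₗ[ℂ] ℂ :=
  TensorProduct.lift ((LinearMap.mul ℂ ℂ).compl₁₂ (curveEval e s hs).toLinearMap (α.coord i))

theorem curveFunctional_tmul (e : Fin 3 → ℂ) (α : Module.Basis (Fin 3) ℂ SO3) (s : Fin 3 → ℂ)
    (hs : ∀ i j, s i ^ 2 - s j ^ 2 + e i - e j = 0) (i : Fin 3) (g : CurveAlg e) (j : Fin 3) :
    curveFunctional e α s hs i (g ⊗ₜ α j) = if j = i then curveEval e s hs g else 0 := by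
  simp only [curveFunctional, TensorProduct.lift.tmul, LinearMap.compl₁₂_apply,
    LinearMap.mul_apply', Module.Basis.coord_apply, Module.Basis.repr_self,
    Finsupp.single_apply, AlgHom.toLinearMap_apply]
  split_ifs <;> simp

/-- The function `λ = v_i² + e_i` on the curve. -/
def curveLambda (e : Fin 3 → ℂ) : CurveAlg e := vHat e 0 ^ 2 + algebraMap ℂ _ (e 0)

theorem curveLambda_eq (e : Fin 3 → ℂ) (i : Fin 3) :
    curveLambda e = vHat e i ^ 2 + algebraMap ℂ _ (e i) := by
  rw [curveLambda, ← sub_eq_zero]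
  have h : (MvPolynomial.X 0 ^ 2 - MvPolynomial.X i ^ 2 + MvPolynomial.C (e 0)
      - MvPolynomial.C (e i) : MvPolynomial (Fin 3) ℂ) ∈ curveIdeal e :=
    Ideal.subset_span ⟨0, i, rfl⟩
  have h2 := Ideal.Quotient.eq_zero_iff_mem.mpr h
  simp only [map_sub, map_add, map_pow] at h2
  refine Eq.trans ?_ h2
  change _ = vHat e 0 ^ 2 - vHat e i ^ 2 + algebraMap ℂ (CurveAlg e) (e 0) -
    algebraMap ℂ (CurveAlg e) (e i)
  ring

theorem ellipticXY_tensor {e : Fin 3 → ℂ} {α : Module.Basis (Fin 3) ℂ SO3}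
    (hα : IsStandardBasis α) {p : Fin 3 → L} {ψ : L →ₗ⁅ℂ⁆ CurveAlg e ⊗[ℂ] SO3}
    (hψ : ∀ i, ψ (p i) = vHat e i ⊗ₜ α i) (n : ℕ) : ∀ i,
    ψ (ellipticX e p n i) = (curveLambda e ^ n * vHat e i) ⊗ₜ α i ∧
    ψ (ellipticY e p n i) = (curveLambda e ^ n * (vHat e (i + 1) * vHat e (i + 2))) ⊗ₜ α i := by
  have hb : ∀ i : Fin 3, ⁅α (i + 1), α (i + 2)⁆ = α i := by
    obtain ⟨h1, h2, h3⟩ := hα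
    intro i
    fin_cases i
    · exact h2
    · exact h3
    · exact h1
  have hY : ∀ n, (∀ i, ψ (ellipticX e p n i) = (curveLambda e ^ n * vHat e i) ⊗ₜ α i) →
      ∀ i, ψ (ellipticY e p n i) =
        (curveLambda e ^ n * (vHat e (i + 1) * vHat e (i + 2))) ⊗ₜ α i := by
    intro n h i
    rw [ellipticY_eq, LieHom.map_lie, hψ, h, LieAlgebra.ExtendScalars.bracket_tmul, hb]
    congr 1
    ring
  induction n with
  | zero =>
    have h : ∀ i, ψ (ellipticX e p 0 i) = (curveLambda e ^ 0 * vHat e i) ⊗ₜ α i := by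
      intro i
      rw [ellipticX_zero, hψ, pow_zero, one_mul]
    exact fun i => ⟨h i, hY 0 h i⟩
  | succ n ih =>
    have h : ∀ i, ψ (ellipticX e p (n + 1) i) =
        (curveLambda e ^ (n + 1) * vHat e i) ⊗ₜ α i := by
      intro i
      obtain ⟨h1, h2, h3, h4⟩ := fin3_add i
      rw [ellipticX_succ, map_add, map_smul, LieHom.map_lie, hψ, (ih _).1, (ih _).2,
        LieAlgebra.ExtendScalars.bracket_tmul, hb, h3, h4, TensorProduct.smul_tmul',
        ← TensorProduct.add_tmul]
      have hs : e (i + 1) • (curveLambda e ^ n * vHat e i) =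
        algebraMap ℂ (CurveAlg e) (e (i + 1)) * (curveLambda e ^ n * vHat e i) :=
        curve_smul_def e _ _
      rw [hs]
      congr 1
      linear_combination -(curveLambda e ^ n * vHat e i) * curveLambda_eq e (i + 1)
    exact fun i => ⟨h i, hY _ h i⟩

/-- The linear combination of the members of a sequence with the coefficients of a polynomial. -/
def polyComb (x : ℕ → L) : Polynomial ℂ →ₗ[ℂ] L :=
  Polynomial.lsum fun n => LinearMap.toSpanSingleton ℂ L (x n)

theorem polyComb_monomial (x : ℕ → L) (n : ℕ) (c : ℂ) :
    polyComb x (Polynomial.monomial n c) = c • x n := by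
  rw [polyComb, Polynomial.lsum_apply, Polynomial.sum_monomial_index]
  · rfl
  · simp

theorem exists_polyComb {e : Fin 3 → ℂ} {p : Fin 3 → L} {y : L} (hy : y ∈ ellipticSpan e p) :
    ∃ f g : Fin 3 → Polynomial ℂ, y = ∑ i, (polyComb (fun n => ellipticX e p n i) (f i) +
      polyComb (fun n => ellipticY e p n i) (g i)) := by
  induction hy using Submodule.span_induction with
  | zero => exact ⟨0, 0, by simp⟩
  | add x y _ _ hx hy =>
    obtain ⟨f, g, rfl⟩ := hx
    obtain ⟨f', g', rfl⟩ := hy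
    refine ⟨f + f', g + g', ?_⟩
    rw [← Finset.sum_add_distrib]
    refine Finset.sum_congr rfl fun i _ => ?_
    rw [Pi.add_apply, Pi.add_apply, map_add, map_add]
    abel
  | smul c x _ hx =>
    obtain ⟨f, g, rfl⟩ := hx
    refine ⟨c • f, c • g, ?_⟩
    rw [Finset.smul_sum]
    refine Finset.sum_congr rfl fun i _ => ?_
    rw [Pi.smul_apply, Pi.smul_apply, map_smul, map_smul, smul_add]
  | mem y hy =>
    rcases hy with ⟨⟨n, j⟩, rfl⟩ | ⟨⟨n, j⟩, rfl⟩
    · refine ⟨Pi.single j (Polynomial.monomial n 1), 0, ?_⟩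
      rw [Finset.sum_eq_single j]
      · simp [polyComb_monomial]
      · intro i _ hi
        simp [hi]
      · simp
    · refine ⟨0, Pi.single j (Polynomial.monomial n 1), ?_⟩
      rw [Finset.sum_eq_single j]
      · simp [polyComb_monomial]
      · intro i _ hi
        simp [hi]
      · simp

theorem curveFunctional_polyComb {e : Fin 3 → ℂ} {α : Module.Basis (Fin 3) ℂ SO3}
    {ψ : L →ₗ⁅ℂ⁆ CurveAlg e ⊗[ℂ] SO3} {x : ℕ → L} {j : Fin 3} {g : CurveAlg e}
    (hx : ∀ n, ψ (x n) = (curveLambda e ^ n * g) ⊗ₜ α j) (s : Fin 3 → ℂ)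
    (hs : ∀ i j, s i ^ 2 - s j ^ 2 + e i - e j = 0) (i : Fin 3) (f : Polynomial ℂ) :
    curveFunctional e α s hs i (ψ (polyComb x f)) =
      if j = i then f.eval (s 0 ^ 2 + e 0) * curveEval e s hs g else 0 := by
  induction f using Polynomial.induction_on' with
  | add f f' h h' =>
    rw [map_add, map_add, map_add, h, h']
    split_ifs <;> simp [add_mul]
  | monomial n c =>
    rw [polyComb_monomial, map_smul, map_smul, hx, curveFunctional_tmul, map_mul, map_pow]
    have : curveEval e s hs (curveLambda e) = s 0 ^ 2 + e 0 := by
      rw [curveLambda, map_add, map_pow, curveEval_vHat, AlgHom.commutes]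
      rfl
    rw [this]
    split_ifs <;> simp [mul_assoc]

/-- An element is a combination of `X`'s and `Y`'s with polynomial coefficients `f i`, `g i` in `λ`.
If its image vanishes, so do its coordinates at every point of the curve, and the sign symmetry of
the curve separates `f i` from `g i`. -/
theorem EllipticTriple.injective {e : Fin 3 → ℂ} {α : Module.Basis (Fin 3) ℂ SO3}
    (hα : IsStandardBasis α) {p : Fin 3 → L} (hp : EllipticTriple e p)
    (hg : LieSubalgebra.lieSpan ℂ L (Set.range p) = ⊤) {ψ : L →ₗ⁅ℂ⁆ CurveAlg e ⊗[ℂ] SO3}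
    (hψ : ∀ i, ψ (p i) = vHat e i ⊗ₜ α i) : Function.Injective ψ := by
  rw [injective_iff_map_eq_zero]
  intro y hy
  obtain ⟨f, g, rfl⟩ := exists_polyComb (e := e) (p := p)
    (show y ∈ ellipticSpan e p by rw [hp.span_eq_top hg]; trivial)
  have key : ∀ (s : Fin 3 → ℂ) (hs : ∀ i j, s i ^ 2 - s j ^ 2 + e i - e j = 0) (i : Fin 3),
      (f i).eval (s 0 ^ 2 + e 0) * s i + (g i).eval (s 0 ^ 2 + e 0) * (s (i + 1) * s (i + 2)) =
        0 := by
    intro s hs i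
    have h1 := congrArg (curveFunctional e α s hs i) hy
    rw [map_zero, map_sum, map_sum] at h1
    rw [Finset.sum_eq_single i] at h1
    · rw [map_add, map_add,
        curveFunctional_polyComb (fun n => (ellipticXY_tensor hα hψ n i).1),
        curveFunctional_polyComb (fun n => (ellipticXY_tensor hα hψ n i).2), if_pos rfl,
        if_pos rfl, map_mul, curveEval_vHat, curveEval_vHat, curveEval_vHat] at h1
      exact h1
    · intro j _ hj
      rw [map_add, map_add,
        curveFunctional_polyComb (fun n => (ellipticXY_tensor hα hψ n j).1),
        curveFunctional_polyComb (fun n => (ellipticXY_tensor hα hψ n j).2), if_neg hj,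
        if_neg hj, add_zero]
    · simp
  have hz : ∀ i, ∀ z : ℂ, z ≠ e i → z ≠ e (i + 1) → z ≠ e (i + 2) →
      (f i).eval z = 0 ∧ (g i).eval z = 0 := by
    intro i z h0 h1 h2
    -- Square roots of `z - e_j` are the coordinates of a point of the curve over `λ = z`.
    choose s hs using fun j => IsAlgClosed.exists_pow_nat_eq (z - e j) (n := 2) (by norm_num)
    have hsn : ∀ j, z ≠ e j → s j ≠ 0 := by
      intro j hj h
      have := hs j
      rw [h] at this
      apply hj
      linear_combination -this
    have k1 := key s (fun j k => by rw [hs, hs]; ring) i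
    -- Changing the sign of the `i`-th coordinate keeps the point on the curve, reverses the term
    -- with `f i` and fixes the term with `g i`.
    have k2 := key (Function.update s i (-s i)) (fun j k => by
      have hsq : ∀ j, Function.update s i (-s i) j ^ 2 = z - e j := by
        intro j
        rcases eq_or_ne j i with rfl | hj
        · rw [Function.update_self, neg_sq, hs]
        · rw [Function.update_of_ne hj, hs]
      rw [hsq, hsq]; ring) i
    obtain ⟨n1, n2⟩ := (by decide : ∀ i : Fin 3, i + 1 ≠ i ∧ i + 2 ≠ i) i
    have hsq : Function.update s i (-s i) 0 ^ 2 = s 0 ^ 2 := by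
      rcases eq_or_ne 0 i with rfl | hj
      · rw [Function.update_self, neg_sq]
      · rw [Function.update_of_ne hj]
    rw [hsq, Function.update_self, Function.update_of_ne n1, Function.update_of_ne n2] at k2
    have hz0 : s 0 ^ 2 + e 0 = z := by rw [hs]; ring
    rw [hz0] at k1 k2
    constructor
    · have : (f i).eval z * s i = 0 := by linear_combination (k1 - k2) / 2
      exact (mul_eq_zero.mp this).resolve_right (hsn i h0)
    · have : (g i).eval z * (s (i + 1) * s (i + 2)) = 0 := by linear_combination (k1 + k2) / 2
      exact (mul_eq_zero.mp this).resolve_right (mul_ne_zero (hsn _ h1) (hsn _ h2))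
  have inf : ∀ i, ({e i, e (i + 1), e (i + 2)}ᶜ : Set ℂ).Infinite := fun i =>
    (Set.toFinite _).infinite_compl
  have hf : ∀ i, f i = 0 := fun i =>
    Polynomial.eq_zero_of_infinite_isRoot _ ((inf i).mono fun z hzm => by
      simp only [Set.mem_compl_iff, Set.mem_insert_iff, Set.mem_singleton_iff, not_or] at hzm
      exact (hz i z hzm.1 hzm.2.1 hzm.2.2).1)
  have hgz : ∀ i, g i = 0 := fun i =>
    Polynomial.eq_zero_of_infinite_isRoot _ ((inf i).mono fun z hzm => by
      simp only [Set.mem_compl_iff, Set.mem_insert_iff, Set.mem_singleton_iff, not_or] at hzm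
      exact (hz i z hzm.1 hzm.2.1 hzm.2.2).2)
  simp [hf, hgz]

/-- A Lie algebra generated by an elliptic triple that maps to the standard one is isomorphic to
the elliptic algebra. -/
theorem EllipticTriple.nonempty_equiv {e : Fin 3 → ℂ} {α : Module.Basis (Fin 3) ℂ SO3}
    (hα : IsStandardBasis α) {p : Fin 3 → L} (hp : EllipticTriple e p)
    (hg : LieSubalgebra.lieSpan ℂ L (Set.range p) = ⊤) {ψ : L →ₗ⁅ℂ⁆ CurveAlg e ⊗[ℂ] SO3}
    (hψ : ∀ i, ψ (p i) = vHat e i ⊗ₜ α i) : Nonempty (L ≃ₗ⁅ℂ⁆ ellipticAlg e α) := by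
  have hr : ψ.range = ellipticAlg e α := by
    rw [LieHom.range_eq_map, ← hg, LieSubalgebra.map_lieSpan, ← Set.range_comp, ellipticAlg]
    congr 2
    funext i
    exact hψ i
  exact ⟨(LieEquiv.ofInjective ψ (hp.injective hα hg hψ)).trans (LieEquiv.ofEq _ _ (by rw [hr]))⟩

end Injective
end
end ZCR

namespace ZCR

open Finset TensorProduct

noncomputable section

/-! ### Normalized zero-curvature representations -/

section Values

variable {L : Type*} [LieRing L] [LieAlgebra ℂ L]

/-- The coefficients of the series `f` lie in the subspace `N`. -/
def Vals (N : Submodule ℂ L) (f : MvPowerSeries Coord L) : Prop := ∀ m, f m ∈ N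

variable {N : Submodule ℂ L} {f g : MvPowerSeries Coord L}

theorem vals_zero : Vals N (0 : MvPowerSeries Coord L) := fun _ => zero_mem N

theorem Vals.add (hf : Vals N f) (hg : Vals N g) : Vals N (f + g) :=
  fun m => add_mem (hf m) (hg m)

theorem Vals.sub (hf : Vals N f) (hg : Vals N g) : Vals N (f - g) :=
  fun m => sub_mem (hf m) (hg m)

theorem Vals.sum {ι : Type*} {S : Finset ι} {f : ι → MvPowerSeries Coord L}
    (hf : ∀ i ∈ S, Vals N (f i)) : Vals N (∑ i ∈ S, f i) := by
  intro m
  rw [sum_series_apply]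
  exact sum_mem fun i hi => hf i hi m

theorem Vals.smul (c : MvPowerSeries Coord ℂ) (hf : Vals N f) : Vals N (c • f) :=
  fun _ => sum_mem fun _ _ => N.smul_mem _ (hf _)

theorem Vals.pd (s : Coord) (hf : Vals N f) : Vals N (pd s f) :=
  fun _ => N.smul_of_tower_mem _ (hf _)

theorem Vals.totalDx (a : Coord → ℂ) (n : ℕ) (hf : Vals N f) : Vals N (totalDx a n f) :=
  (hf.pd _).add (Vals.sum fun _ _ => (hf.pd _).smul _)

theorem Vals.totalDt (a : Coord → ℂ) (d : ℕ) (F : MvPowerSeries Coord ℂ) (n : ℕ)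
    (hf : Vals N f) : Vals N (totalDt a d F n f) :=
  (hf.pd _).add (Vals.sum fun _ _ => (hf.pd _).smul _)

theorem Vals.lie_right (hN : ∀ m, ∀ y ∈ N, ⁅g m, y⁆ ∈ N) (hf : Vals N f) : Vals N ⁅g, f⁆ :=
  fun _ => sum_mem fun _ _ => hN _ _ (hf _)

theorem Vals.coeff_mem {s : Coord} (hf : Vals N (ZCR.pd s f)) {m : Mon} (hm : m s ≠ 0) :
    f m ∈ N := by
  have hle : Finsupp.single s 1 ≤ m := by rw [Finsupp.single_le_iff]; omega
  have h1 := hf (m - Finsupp.single s 1)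
  rw [coeff_pd, tsub_add_cancel_of_le hle, ← Nat.cast_smul_eq_nsmul ℂ] at h1
  exact (N.smul_mem_iff (Nat.cast_ne_zero.mpr (Nat.succ_ne_zero _))).mp h1

theorem vals_bot_iff : Vals (⊥ : Submodule ℂ L) f ↔ f = 0 :=
  ⟨fun h => funext fun m => (Submodule.mem_bot ℂ).mp (h m), fun h m => by rw [h]; exact zero_mem _⟩

theorem lie_eq_sum_of_coeff {m : Mon} (h : ∀ q r, q + r = m → ⁅f q, g r⁆ = 0) : ⁅f, g⁆ m = 0 :=
  Finset.sum_eq_zero fun _ hq => h _ _ (HasAntidiagonal.mem_antidiagonal.mp hq)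

end Values

section Normal

variable {L : Type*} [LieRing L] [LieAlgebra ℂ L]

/-- The series `A` of order `p` is in normal form. -/
structure IsNormalSeries (p : ℕ) (A : MvPowerSeries Coord L) : Prop where
  pd_eq_zero : ∀ k, p < k → pd (.u k) A = 0
  coeff_zero : ∀ m : Mon, (∀ k, m (.u k) = 0) → A m = 0
  coeff_normal : ∀ m : Mon, (∀ k, p < k → m (.u k) = 0) → IsNormalExp p m → A m = 0

/-- The series `A` and `B` form a zero-curvature representation of order `p` in normal form. -/
structure IsNormalZCR (a : Coord → ℂ) (d : ℕ) (F : MvPowerSeries Coord ℂ) (p : ℕ)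
    (A B : MvPowerSeries Coord L) : Prop extends IsNormalSeries p A where
  pd_B : ∀ k, p + d ≤ k → pd (.u k) B = 0
  zcr : totalDx a (p + d) B - totalDt a d F (p + 1) A + ⁅A, B⁆ = 0
  coeff_B : ∀ m : Mon, m .x = 0 → (∀ k, m (.u k) = 0) → B m = 0

variable {p : ℕ} {A : MvPowerSeries Coord L}

/-- The normal form removes the terms whose last variable occurs linearly. Equivalently,
`∂A/∂u_{j+1}` vanishes once `u_k = a_k` for all `k > j`. -/
theorem IsNormalSeries.coeff_pd_succ (hA : IsNormalSeries p A) (j : ℕ) {m : Mon}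
    (hm : ∀ k, j < k → m (.u k) = 0) : pd (.u (j + 1)) A m = 0 := by
  rcases Nat.lt_or_ge p (j + 1) with h | h
  · rw [hA.pd_eq_zero _ h]; rfl
  have hz : ∀ k, k ≠ j + 1 → j < k → (m + Finsupp.single (Coord.u (j + 1)) 1 : Mon) (.u k) = 0 := by
    intro k hk hk'
    rw [Finsupp.add_apply, hm k hk', zero_add, Finsupp.single_eq_of_ne (by simpa using hk)]
  rw [coeff_pd, hA.coeff_normal, smul_zero]
  · intro k hk
    exact hz k (by omega) (by omega)
  · refine ⟨j + 1, by omega, h, ?_, fun q hq _ => hz q (by omega) (by omega)⟩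
    rw [Finsupp.add_apply, hm _ (by omega), Finsupp.single_eq_same]

/-- A series that is covariantly constant modulo a subspace depends on `t` only, modulo the
subspace. -/
theorem IsNormalSeries.vals_of_covariantlyConstant (hA : IsNormalSeries p A) {N : Submodule ℂ L}
    (hN : ∀ q, ∀ y ∈ N, ⁅A q, y⁆ ∈ N) (a : Coord → ℂ) {n : ℕ} {C : MvPowerSeries Coord L}
    (hC : ∀ k, n ≤ k → Vals N (pd (.u k) C)) (h : Vals N (totalDx a n C + ⁅A, C⁆)) :
    (∀ k, Vals N (pd (.u k) C)) ∧ Vals N (pd .x C) := by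
  -- Downward in `j`: modulo `N`, the derivative of the equation by `u_{j+1}` is `∂_j C + [∂_{j+1}A,
  -- C]`. The bracket has no coefficient at monomials free of the `u_k` with `k > j`; at the other
  -- monomials the derivatives already treated apply.
  have step : ∀ j, (∀ k, j < k → Vals N (pd (.u k) C)) → Vals N (pd (.u j) C) := by
    intro j hj m
    rcases Nat.lt_or_ge j n with hn | hn
    swap
    · exact hC j hn m
    by_cases hm : ∃ k, j < k ∧ m (.u k) ≠ 0
    · obtain ⟨k, hk, hm⟩ := hm
      rw [coeff_pd]
      refine N.smul_of_tower_mem _ ((hj k hk).coeff_mem ?_)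
      rw [Finsupp.add_apply]
      omega
    · push Not at hm
      have h1 := h.pd (.u (j + 1))
      rw [pd_add, pd_u_succ_totalDx a hn, pd_lie] at h1
      have h2 := (h1.sub ((hj (j + 1) (by omega)).totalDx a n)).sub
        ((hj (j + 1) (by omega)).lie_right hN) m
      have e : totalDx a n (pd (.u (j + 1)) C) + pd (.u j) C +
          (⁅pd (.u (j + 1)) A, C⁆ + ⁅A, pd (.u (j + 1)) C⁆) - totalDx a n (pd (.u (j + 1)) C) -
          ⁅A, pd (.u (j + 1)) C⁆ = pd (.u j) C + ⁅pd (.u (j + 1)) A, C⁆ := by abel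
      rw [e, series_add_apply, lie_eq_sum_of_coeff, add_zero] at h2
      · exact h2
      · intro q r hqr
        rw [hA.coeff_pd_succ j, zero_lie]
        intro k hk
        have := hm k hk
        rw [← hqr, Finsupp.add_apply] at this
        omega
  have all : ∀ i k, n ≤ k + i → Vals N (pd (.u k) C) := by
    intro i
    induction i with
    | zero => exact fun k hk => hC k hk
    | succ i ih => exact fun k hk => step k fun l hl => ih l (by omega)
  have allk : ∀ k, Vals N (pd (.u k) C) := fun k => all n k (by omega)
  refine ⟨allk, fun m => ?_⟩
  by_cases hm : ∃ k, m (.u k) ≠ 0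
  · obtain ⟨k, hk⟩ := hm
    rw [coeff_pd]
    refine N.smul_of_tower_mem _ ((allk k).coeff_mem ?_)
    rw [Finsupp.add_apply]
    omega
  · push Not at hm
    -- At monomials in `x` and `t` alone the normal form makes `A` vanish, so only `∂C/∂x` survives
    -- in the equation.
    have h2 := (h.sub (Vals.sum (S := range n) fun k _ =>
      (allk k).smul (coordSeries a (.u (k + 1))))) m
    rw [totalDx] at h2
    simp only [mulSeries_eq_smul'] at h2
    rw [add_sub_right_comm, add_sub_cancel_right, series_add_apply, lie_eq_sum_of_coeff,
      add_zero] at h2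
    · exact h2
    · intro q r hqr
      rw [hA.coeff_zero, zero_lie]
      intro k
      have := hm k
      rw [← hqr, Finsupp.add_apply] at this
      omega

variable {a : Coord → ℂ} {d : ℕ} {F : MvPowerSeries Coord ℂ} {B : MvPowerSeries Coord L}

/-- The coefficients of `B` lie in the subalgebra generated by the coefficients of `A`. -/
theorem IsNormalZCR.vals_B (h : IsNormalZCR a d F p A B) {S : LieSubalgebra ℂ L}
    (hA : Vals S.toSubmodule A) : Vals S.toSubmodule B := by
  -- Here `D_x B + [A,B] = D_t A` has coefficients in `S`. The terms of `B` in `t` alone, which this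
  -- does not control, are zero by normalization.
  obtain ⟨h1, h2⟩ := h.toIsNormalSeries.vals_of_covariantlyConstant (N := S.toSubmodule)
    (fun q y hy => S.lie_mem (hA q) hy) a (n := p + d) (C := B)
    (fun k hk => by rw [h.pd_B k hk]; exact vals_zero) (by
      have := hA.totalDt a d F (p + 1)
      have e := h.zcr
      rw [sub_add_eq_add_sub, sub_eq_zero] at e
      rwa [e])
  intro m
  by_cases hm : ∃ k, m (.u k) ≠ 0
  · obtain ⟨k, hk⟩ := hm
    exact (h1 k).coeff_mem hk
  push Not at hm
  by_cases hx : m .x = 0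
  · rw [h.coeff_B m hx hm]
    exact zero_mem _
  · exact h2.coeff_mem hx

theorem totalDt_lie (a : Coord → ℂ) (d : ℕ) (F : MvPowerSeries Coord ℂ) (n : ℕ)
    (f g : MvPowerSeries Coord L) :
    totalDt a d F n ⁅f, g⁆ = ⁅totalDt a d F n f, g⁆ + ⁅f, totalDt a d F n g⁆ := by
  simp only [totalDt, pd_lie, mulSeries_eq_smul', add_lie, lie_add, sum_lie, lie_sum, smul_add,
    smul_lie, lie_smul, Finset.sum_add_distrib]
  abel

theorem totalDt_zero (a : Coord → ℂ) (d : ℕ) (F : MvPowerSeries Coord ℂ) (n : ℕ) :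
    totalDt a d F n (0 : MvPowerSeries Coord L) = 0 := by
  simp [totalDt, pd_zero, mulSeries_zero]

theorem totalDx_eq_zero {n : ℕ} {C : MvPowerSeries Coord L} (hx : pd .x C = 0)
    (hu : ∀ k, pd (.u k) C = 0) : totalDx a n C = 0 := by
  simp [totalDx, hx, hu, mulSeries_zero]

/-- A covariantly constant series depends on `t` only, and its coefficients commute with `A`. -/
theorem IsNormalSeries.eq_zero_of_covariantlyConstant (hA : IsNormalSeries p A) {n : ℕ}
    {C : MvPowerSeries Coord L} (hC : ∀ k, n ≤ k → pd (.u k) C = 0)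
    (h : totalDx a n C + ⁅A, C⁆ = 0) :
    (∀ k, pd (.u k) C = 0) ∧ pd .x C = 0 ∧ ⁅A, C⁆ = 0 := by
  obtain ⟨h1, h2⟩ := hA.vals_of_covariantlyConstant (N := ⊥)
    (fun q y hy => by rw [(Submodule.mem_bot ℂ).mp hy, lie_zero]; exact zero_mem _) a (n := n)
    (C := C) (fun k hk => by rw [hC k hk]; exact vals_zero) (by rw [h]; exact vals_zero)
  simp only [vals_bot_iff] at h1 h2
  refine ⟨h1, h2, ?_⟩
  rwa [totalDx_eq_zero h2 h1, zero_add] at h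

/-- Apply `D_t` to `[A,C] = 0` and substitute `D_t A = D_x B + [A,B]`: the series `∂_t C + [B,C]` is
covariantly constant, hence commutes with `A`. It remains to see that `[B,C] = 0`. -/
theorem IsNormalZCR.lie_pd_t_eq_zero (h : IsNormalZCR a d F p A B) {C : MvPowerSeries Coord L}
    (hu : ∀ k, pd (.u k) C = 0) (hx : pd .x C = 0) (hAC : ⁅A, C⁆ = 0) : ⁅A, pd .t C⁆ = 0 := by
  have ht : ∀ n, totalDt a d F n C = pd .t C := by
    intro n
    simp [totalDt, hu, mulSeries_zero]
  have hxt : pd .x (pd .t C) = 0 := by rw [pd_comm, hx, pd_zero]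
  have hut : ∀ k, pd (.u k) (pd .t C) = 0 := fun k => by rw [pd_comm, hu, pd_zero]
  have h1 : ⁅totalDt a d F (p + 1) A, C⁆ + ⁅A, pd .t C⁆ = 0 := by
    rw [← ht (p + 1), ← totalDt_lie, hAC, totalDt_zero]
  have hB : totalDt a d F (p + 1) A = totalDx a (p + d) B + ⁅A, B⁆ := by
    have := h.zcr
    rw [sub_add_eq_add_sub, sub_eq_zero] at this
    exact this.symm
  have h2 : totalDx a (p + d) (pd .t C + ⁅B, C⁆) + ⁅A, pd .t C + ⁅B, C⁆⁆ = 0 := by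
    rw [totalDx_add, totalDx_eq_zero hxt hut, totalDx_lie, totalDx_eq_zero hx hu, lie_zero,
      lie_add, leibniz_lie A B C, hAC, lie_zero, add_zero, add_zero, zero_add]
    rw [hB, add_lie] at h1
    rw [← h1]
    abel
  obtain ⟨h3, h4, h5⟩ := h.toIsNormalSeries.eq_zero_of_covariantlyConstant (fun k hk => by
    rw [pd_add, hut, pd_lie, h.pd_B k hk, hu, zero_lie, lie_zero, add_zero, add_zero]) h2
  -- The bracket depends on `t` only, while `B` has no terms in `t` alone.
  have h6 : ⁅B, C⁆ = 0 := by
    have k1 : ∀ k, pd (.u k) ⁅B, C⁆ = 0 := fun k => by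
      have := h3 k
      rwa [pd_add, hut, zero_add] at this
    have k2 : pd .x ⁅B, C⁆ = 0 := by rwa [pd_add, hxt, zero_add] at h4
    funext m
    by_cases hm : ∃ k, m (.u k) ≠ 0
    · obtain ⟨k, hk⟩ := hm
      exact coeff_eq_zero_of_pd (k1 k) hk
    push Not at hm
    by_cases hxm : m .x = 0
    · refine lie_eq_sum_of_coeff fun q r hqr => ?_
      rw [h.coeff_B, zero_lie]
      · rw [← hqr, Finsupp.add_apply] at hxm
        omega
      · intro k
        have := hm k
        rw [← hqr, Finsupp.add_apply] at this
        omega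
    · exact coeff_eq_zero_of_pd k2 hxm
  rwa [h6, add_zero] at h5

/-- All `t`-derivatives of `C` commute with `A` as series. Since `C` is a series in `t`, induction
on the power of `t` separates the convolution `[A,C] = 0` into brackets of single coefficients. -/
theorem IsNormalZCR.lie_coeff_eq_zero (h : IsNormalZCR a d F p A B) {n : ℕ}
    {C : MvPowerSeries Coord L} (hC : ∀ k, n ≤ k → pd (.u k) C = 0)
    (hcc : totalDx a n C + ⁅A, C⁆ = 0) (q m : Mon) : ⁅A q, C m⁆ = 0 := by
  have main : ∀ (b : ℕ) (q : Mon), q .t = b → ∀ C : MvPowerSeries Coord L,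
      (∀ k, pd (.u k) C = 0) → pd .x C = 0 → ⁅A, C⁆ = 0 → ∀ m : Mon, ⁅A q, C m⁆ = 0 := by
    intro b
    induction b using Nat.strong_induction_on with
    | _ b ihb =>
    intro q hq
    -- In the coefficient of `[A,C]` at `q`, any term with a positive power of `t` taken from `C`
    -- involves a coefficient of `A` of lower `t`-degree; only the term with `C 0` is left.
    have base : ∀ C : MvPowerSeries Coord L, (∀ k, pd (.u k) C = 0) → pd .x C = 0 →
        ⁅A, C⁆ = 0 → ⁅A q, C 0⁆ = 0 := by
      intro C hu hx hAC
      have h1 : ⁅A, C⁆ q = 0 := by rw [hAC]; rfl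
      rw [coeff_lie, Finset.sum_eq_single (q, 0)] at h1
      · exact h1
      · rintro ⟨r, s⟩ hrs hne
        rw [HasAntidiagonal.mem_antidiagonal] at hrs
        dsimp only at hrs ⊢
        by_cases hs : ∃ c, c ≠ Coord.t ∧ s c ≠ 0
        · obtain ⟨c, hct, hc⟩ := hs
          have : C s = 0 := by
            cases c with
            | x => exact coeff_eq_zero_of_pd hx hc
            | t => exact absurd rfl hct
            | u k => exact coeff_eq_zero_of_pd (hu k) hc
          rw [this, lie_zero]
        · push Not at hs
          have hst : s .t ≠ 0 := by
            intro hst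
            apply hne
            have : s = 0 := by
              ext c
              by_cases hc : c = .t
              · rw [hc, hst]; rfl
              · rw [hs c hc]; rfl
            rw [this, add_zero] at hrs
            rw [this, hrs]
          refine ihb (r .t) ?_ r rfl C hu hx hAC s
          rw [← hq, ← hrs, Finsupp.add_apply]
          omega
      · intro hne
        simp at hne
    intro C hu hx hAC m
    induction hm : m .t generalizing m C with
    | zero =>
      by_cases hm0 : m = 0
      · rw [hm0]
        exact base C hu hx hAC
      · obtain ⟨c, hc⟩ : ∃ c, m c ≠ 0 := by
          by_contra! hcon
          exact hm0 (Finsupp.ext hcon)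
        have : C m = 0 := by
          cases c with
          | x => exact coeff_eq_zero_of_pd hx hc
          | t => exact absurd hm hc
          | u k => exact coeff_eq_zero_of_pd (hu k) hc
        rw [this, lie_zero]
    | succ c ihc =>
      have h1 := ihc (pd .t C) (fun k => by rw [pd_comm, hu, pd_zero])
        (by rw [pd_comm, hx, pd_zero]) (h.lie_pd_t_eq_zero hu hx hAC)
        (m - Finsupp.single .t 1) (by rw [Finsupp.tsub_apply, hm]; simp)
      have hle : Finsupp.single Coord.t 1 ≤ m := by rw [Finsupp.single_le_iff]; omega
      rw [coeff_pd, tsub_add_cancel_of_le hle, ← Nat.cast_smul_eq_nsmul ℂ, lie_smul] at h1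
      exact (smul_eq_zero.mp h1).resolve_left (Nat.cast_ne_zero.mpr (Nat.succ_ne_zero _))
  obtain ⟨h1, h2, h3⟩ := h.toIsNormalSeries.eq_zero_of_covariantlyConstant hC hcc
  exact main _ q rfl C h1 h2 h3 m

theorem mem_center_of_lieSpan {s : Set L} (hs : LieSubalgebra.lieSpan ℂ L s = ⊤) {y : L}
    (h : ∀ x ∈ s, ⁅x, y⁆ = 0) : y ∈ LieAlgebra.center ℂ L := by
  rw [LieModule.mem_maxTrivSubmodule]
  intro x
  have hx : x ∈ LieSubalgebra.lieSpan ℂ L s := by rw [hs]; trivial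
  induction hx using LieSubalgebra.lieSpan_induction with
  | mem x hx => exact h x hx
  | zero => exact zero_lie _
  | add x x' _ _ h1 h2 => rw [add_lie, h1, h2, add_zero]
  | smul c x _ h1 => rw [smul_lie, h1, smul_zero]
  | lie x x' _ _ h1 h2 => rw [lie_lie, h1, h2, lie_zero, lie_zero, sub_zero]

end Normal

/-! ### The universal property of 𝔽^p -/

section Universal

variable (a : Coord → ℂ) (d : ℕ) (F : MvPowerSeries Coord ℂ) (p : ℕ)

/-- The universal series `𝔸` with coefficients in `𝔽^p`. -/
def Fd.A : MvPowerSeries Coord (Fd a d F p) := mapSeries (Fd.mk a d F p) (seriesA p d)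

/-- The universal series `𝔹` with coefficients in `𝔽^p`. -/
def Fd.B : MvPowerSeries Coord (Fd a d F p) := mapSeries (Fd.mk a d F p) (seriesB p d)

theorem pd_eq_zero_of_coeff {M : Type*} [AddCommGroup M] [Module ℂ M] {s : Coord}
    {f : MvPowerSeries Coord M} (h : ∀ m : Mon, m s ≠ 0 → f m = 0) : pd s f = 0 := by
  funext m
  rw [coeff_pd, h _ (by rw [Finsupp.add_apply, Finsupp.single_eq_same]; omega), smul_zero]
  rfl

theorem Fd.isNormalZCR : IsNormalZCR a d F p (Fd.A a d F p) (Fd.B a d F p) where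
  pd_eq_zero k hk := pd_eq_zero_of_coeff fun m hm => by
    have : ¬ ∀ k, p < k → m (.u k) = 0 := fun h => hm (h k hk)
    rw [Fd.A, mapSeries, seriesA, dif_neg this, map_zero]
  coeff_zero m hm := Fd.mk_rel a d F p (.zeroA m hm)
  coeff_normal m hm hn := Fd.mk_rel a d F p (.normalA m hm hn)
  pd_B k hk := pd_eq_zero_of_coeff fun m hm => by
    have : ¬ ∀ k, p + d ≤ k → m (.u k) = 0 := fun h => hm (h k hk)
    rw [Fd.B, mapSeries, seriesB, dif_neg this, map_zero]
  zcr := funext fun m =>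
    (zeroCurvature_mapSeries (Fd.mk a d F p) a d F p (seriesA p d) (seriesB p d) m).symm.trans
      (Fd.mk_rel a d F p (.zcr m))
  coeff_B m hx hm := Fd.mk_rel a d F p (.zeroB m hx hm)

theorem freeLieAlgebra_lieSpan_range_of (X : Type*) :
    LieSubalgebra.lieSpan ℂ (FreeLieAlgebra ℂ X) (Set.range (FreeLieAlgebra.of ℂ)) = ⊤ := by
  set S := LieSubalgebra.lieSpan ℂ (FreeLieAlgebra ℂ X) (Set.range (FreeLieAlgebra.of ℂ))
  let φ : FreeLieAlgebra ℂ X →ₗ⁅ℂ⁆ S := FreeLieAlgebra.lift ℂ fun x =>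
    ⟨FreeLieAlgebra.of ℂ x, LieSubalgebra.subset_lieSpan ⟨x, rfl⟩⟩
  have h : S.incl.comp φ = LieHom.id := by
    apply FreeLieAlgebra.hom_ext
    intro x
    simp [φ]
  rw [eq_top_iff]
  intro x _
  have := congrArg (fun ψ => ψ x) h
  simp only [LieHom.comp_apply, LieHom.id_apply] at this
  rw [← this]
  exact (φ x).2

theorem Fd.mk_surjective : Function.Surjective (Fd.mk a d F p) :=
  LieSubmodule.Quotient.surjective_mk' (relIdeal a d F p)

/-- The generators coming from `𝔹` are redundant by `IsNormalZCR.vals_B`. -/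
theorem Fd.lieSpan_A : LieSubalgebra.lieSpan ℂ (Fd a d F p) (Set.range (Fd.A a d F p)) = ⊤ := by
  set S := LieSubalgebra.lieSpan ℂ (Fd a d F p) (Set.range (Fd.A a d F p)) with hS
  have hA : Vals S.toSubmodule (Fd.A a d F p) := fun m => LieSubalgebra.subset_lieSpan ⟨m, rfl⟩
  have hB := (Fd.isNormalZCR a d F p).vals_B hA
  rw [eq_top_iff]
  intro y _
  obtain ⟨x, rfl⟩ := Fd.mk_surjective a d F p y
  have hx : x ∈ LieSubalgebra.lieSpan ℂ _ (Set.range (FreeLieAlgebra.of ℂ)) := by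
    rw [freeLieAlgebra_lieSpan_range_of]; trivial
  have hle : LieSubalgebra.lieSpan ℂ _ (Set.range (FreeLieAlgebra.of ℂ)) ≤
      S.comap (Fd.mk a d F p) := by
    rw [LieSubalgebra.lieSpan_le]
    rintro _ ⟨g, rfl⟩
    cases g with
    | A m hm =>
      have := hA m
      rw [Fd.A, mapSeries, seriesA, dif_pos hm] at this
      exact this
    | B m hm =>
      have := hB m
      rw [Fd.B, mapSeries, seriesB, dif_pos hm] at this
      exact this
  exact hle hx

variable {a d F p}

/-- The universal property of `𝔽^p`. -/
theorem IsNormalZCR.exists_lift {L : Type*} [LieRing L] [LieAlgebra ℂ L]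
    {A B : MvPowerSeries Coord L} (h : IsNormalZCR a d F p A B) :
    ∃ ψ : Fd a d F p →ₗ⁅ℂ⁆ L, ∀ m, ψ (Fd.A a d F p m) = A m := by
  let φ : FreeLieAlgebra ℂ (Gen p d) →ₗ⁅ℂ⁆ L := FreeLieAlgebra.lift ℂ fun
    | .A m _ => A m
    | .B m _ => B m
  have hφA : mapSeries φ (seriesA p d) = A := by
    funext m
    rw [mapSeries, seriesA]
    split_ifs with hm
    · simp [φ]
    · push Not at hm
      obtain ⟨k, hk, hm⟩ := hm
      rw [map_zero, coeff_eq_zero_of_pd (h.pd_eq_zero k hk) hm]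
  have hφB : mapSeries φ (seriesB p d) = B := by
    funext m
    rw [mapSeries, seriesB]
    split_ifs with hm
    · simp [φ]
    · push Not at hm
      obtain ⟨k, hk, hm⟩ := hm
      rw [map_zero, coeff_eq_zero_of_pd (h.pd_B k hk) hm]
  have hker : relIdeal a d F p ≤ φ.ker := by
    refine LieSubmodule.lieSpan_le.mpr fun r hr => LieHom.mem_ker.mpr ?_
    cases hr with
    | zcr m =>
      rw [zeroCurvature_mapSeries, hφA, hφB]
      exact congrFun h.zcr m
    | zeroA m hm => exact (congrFun hφA m).trans (h.coeff_zero m hm)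
    | zeroB m hx hm => exact (congrFun hφB m).trans (h.coeff_B m hx hm)
    | normalA m hm hn => exact (congrFun hφA m).trans (h.coeff_normal m hm hn)
  refine ⟨{ (relIdeal a d F p).toSubmodule.liftQ
    (φ : FreeLieAlgebra ℂ (Gen p d) →ₗ[ℂ] L) (fun _ hr => hker hr) with
    map_lie' := ?_ }, fun m => congrFun hφA m⟩
  intro x y
  obtain ⟨x, rfl⟩ := LieSubmodule.Quotient.surjective_mk' _ x
  obtain ⟨y, rfl⟩ := LieSubmodule.Quotient.surjective_mk' _ y
  exact φ.map_lie x y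

theorem Fd.map_A (m : Mon) : Fd.map a d F p (Fd.A a d F (p + 1) m) = Fd.A a d F p m :=
  mapFree_seriesA a d F p m

theorem Fd.map_surjective : Function.Surjective (Fd.map a d F p) := by
  have h : (Fd.map a d F p).range = ⊤ := by
    rw [eq_top_iff, ← Fd.lieSpan_A, LieSubalgebra.lieSpan_le]
    rintro _ ⟨m, rfl⟩
    exact ⟨_, Fd.map_A m⟩
  exact (LieHom.range_eq_top _).mp h

theorem Fd.hom_ext {L : Type*} [LieRing L] [LieAlgebra ℂ L] {φ ψ : Fd a d F p →ₗ⁅ℂ⁆ L}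
    (h : ∀ m, φ (Fd.A a d F p m) = ψ (Fd.A a d F p m)) : φ = ψ := by
  ext x
  have hx : x ∈ LieSubalgebra.lieSpan ℂ _ (Set.range (Fd.A a d F p)) := by
    rw [Fd.lieSpan_A]; trivial
  induction hx using LieSubalgebra.lieSpan_induction with
  | mem x hx => obtain ⟨m, rfl⟩ := hx; exact h m
  | zero => rw [map_zero, map_zero]
  | add x x' _ _ h1 h2 => rw [map_add, map_add, h1, h2]
  | smul c x _ h1 => rw [map_smul, map_smul, h1]
  | lie x x' _ _ h1 h2 => rw [LieHom.map_lie, LieHom.map_lie, h1, h2]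

end Universal
end
end ZCR

namespace ZCR

open Finset TensorProduct

noncomputable section

/-! ### The zero-curvature equation of a third-order equation -/

section ThirdOrder

variable {a : Coord → ℂ} {F : MvPowerSeries Coord ℂ}

/-- `F = u₃ + f(x,t,u₀,u₁,u₂)`. -/
structure IsThirdOrder (F : MvPowerSeries Coord ℂ) : Prop where
  pd_three : pd (.u 3) F = 1
  pd_of_lt : ∀ k, 3 < k → pd (.u k) F = 0

theorem IsThirdOrder.pd_pd (hF : IsThirdOrder F) (s : Coord) {k : ℕ} (hk : 3 ≤ k) :
    pd (.u k) (pd s F) = 0 := by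
  rw [pd_comm]
  rcases Nat.lt_or_ge 3 k with h | h
  · rw [hF.pd_of_lt k h, pd_zero]
  · obtain rfl : k = 3 := by omega
    rw [hF.pd_three, pd_one]

theorem IsThirdOrder.pd_dxPow_of_lt (hF : IsThirdOrder F) (j : ℕ) :
    ∀ k, j + 3 < k → pd (.u k) (dxPow a 3 F j) = 0 := by
  induction j with
  | zero => exact fun k hk => hF.pd_of_lt k (by omega)
  | succ j ih =>
    intro k hk
    obtain ⟨k, rfl⟩ : ∃ i, k = i + 1 := ⟨k - 1, by omega⟩
    rw [dxPow]
    rcases Nat.lt_or_ge k (3 + j + 1) with h | h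
    · omega
    · rw [pd_totalDx_of_ne, ih _ (by omega), totalDx_zero]
      intro i hi
      rw [Ne, Coord.u.injEq]
      omega

theorem IsThirdOrder.pd_dxPow_three (hF : IsThirdOrder F) (j : ℕ) :
    pd (.u (j + 3)) (dxPow a 3 F j) = 1 := by
  induction j with
  | zero => exact hF.pd_three
  | succ j ih =>
    rw [dxPow, show j + 1 + 3 = j + 3 + 1 by omega, pd_u_succ_totalDx a (by omega), ih,
      hF.pd_dxPow_of_lt j _ (by omega), totalDx_zero, zero_add]

theorem IsThirdOrder.pd_dxPow_two (hF : IsThirdOrder F) (j : ℕ) :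
    pd (.u (j + 2)) (dxPow a 3 F j) = pd (.u 2) F := by
  induction j with
  | zero => rfl
  | succ j ih =>
    rw [dxPow, show j + 1 + 2 = j + 2 + 1 by omega, pd_u_succ_totalDx a (by omega), ih,
      hF.pd_dxPow_three j, totalDx_one, zero_add]

/-- By the commutator rule each further `D_x` adds one copy of `D_x(∂F/∂u₂)`, because `∂F/∂u₂` is
the coefficient next to the top one. -/
theorem IsThirdOrder.pd_dxPow_one (hF : IsThirdOrder F) (j : ℕ) :
    pd (.u (j + 1)) (dxPow a 3 F j) = pd (.u 1) F + j * totalDx a 3 (pd (.u 2) F) := by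
  induction j with
  | zero => rw [Nat.cast_zero, zero_mul, add_zero]; rfl
  | succ j ih =>
    rw [dxPow, pd_u_succ_totalDx a (by omega), ih, hF.pd_dxPow_two j,
      totalDx_eq_of_le a (show 3 ≤ 3 + j + 1 by omega) _ fun k hk => hF.pd_pd _ hk]
    push_cast
    ring

variable {L : Type*} [LieRing L] [LieAlgebra ℂ L] {p : ℕ} {A B : MvPowerSeries Coord L}

/-- As `A` does not contain `u_{k+1}`, its only contribution comes through the coefficients `D_x^j
F`. The values `k = p+2, p+1, p` determine successively `∂B/∂u_{p+2}`, `∂B/∂u_{p+1}`, `∂B/∂u_p`. -/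
theorem IsNormalZCR.pd_zcr (h : IsNormalZCR a 3 F p A B) {k : ℕ} (hk : p ≤ k) (hk' : k < p + 3) :
    totalDx a (p + 3) (pd (.u (k + 1)) B) + pd (.u k) B -
      ∑ j ∈ range (p + 1), pd (.u (k + 1)) (dxPow a 3 F j) • pd (.u j) A +
      ⁅A, pd (.u (k + 1)) B⁆ = 0 := by
  have hA : pd (.u (k + 1)) A = 0 := h.pd_eq_zero _ (by omega)
  have h1 := congrArg (pd (.u (k + 1))) h.zcr
  simp only [totalDt, mulSeries_eq_smul'] at h1
  rw [pd_zero, pd_add, pd_sub, pd_u_succ_totalDx a hk', pd_lie, pd_add, pd_sum, hA, zero_lie,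
    zero_add, pd_comm _ .t, hA, pd_zero, zero_add] at h1
  have h2 : ∀ j ∈ range (p + 1), pd (.u (k + 1)) (dxPow a 3 F j • pd (.u j) A) =
      pd (.u (k + 1)) (dxPow a 3 F j) • pd (.u j) A := by
    intro j _
    rw [pd_smul, pd_comm, hA, pd_zero, smul_zero, add_zero]
  rw [Finset.sum_congr rfl h2] at h1
  exact h1

theorem IsNormalZCR.pd_B_top (h : IsNormalZCR a 3 F p A B) (hF : IsThirdOrder F) :
    pd (.u (p + 2)) B = pd (.u p) A := by
  have h1 := h.pd_zcr (k := p + 2) (by omega) (by omega)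
  rw [h.pd_B (p + 2 + 1) (by omega), totalDx_zero, lie_zero, zero_add, add_zero,
    Finset.sum_range_succ, Finset.sum_eq_zero, zero_add, hF.pd_dxPow_three, one_smul] at h1
  · exact sub_eq_zero.mp h1
  · intro j hj
    rw [mem_range] at hj
    rw [hF.pd_dxPow_of_lt j _ (by omega), zero_smul]

theorem IsNormalZCR.pd_B_second (h : IsNormalZCR a 3 F (p + 1) A B) (hF : IsThirdOrder F) :
    totalDx a (p + 4) (pd (.u (p + 1)) A) + pd (.u (p + 2)) B -
      (pd (.u p) A + pd (.u 2) F • pd (.u (p + 1)) A) + ⁅A, pd (.u (p + 1)) A⁆ = 0 := by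
  have h1 := h.pd_zcr (k := p + 2) (by omega) (by omega)
  rw [show p + 2 + 1 = p + 1 + 2 by omega, h.pd_B_top hF, Finset.sum_range_succ,
    Finset.sum_range_succ, Finset.sum_eq_zero, zero_add, hF.pd_dxPow_two,
    show p + 1 + 2 = p + 3 by omega, hF.pd_dxPow_three, one_smul] at h1
  · exact h1
  · intro j hj
    rw [mem_range] at hj
    rw [hF.pd_dxPow_of_lt j _ (by omega), zero_smul]

theorem IsNormalZCR.pd_B_third (h : IsNormalZCR a 3 F (p + 2) A B) (hF : IsThirdOrder F) :
    totalDx a (p + 5) (pd (.u (p + 3)) B) + pd (.u (p + 2)) B -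
      (pd (.u p) A + pd (.u 2) F • pd (.u (p + 1)) A +
        (pd (.u 1) F + (p + 2 : ℕ) * totalDx a 3 (pd (.u 2) F)) • pd (.u (p + 2)) A) +
      ⁅A, pd (.u (p + 3)) B⁆ = 0 := by
  have h1 := h.pd_zcr (k := p + 2) (by omega) (by omega)
  rw [Finset.sum_range_succ, Finset.sum_range_succ, Finset.sum_range_succ, Finset.sum_eq_zero,
    zero_add, hF.pd_dxPow_one, show p + 2 + 1 = p + 3 by omega, hF.pd_dxPow_three, one_smul,
    show p + 3 = p + 1 + 2 by omega, hF.pd_dxPow_two] at h1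
  · exact h1
  · intro j hj
    rw [mem_range] at hj
    rw [hF.pd_dxPow_of_lt j _ (by omega), zero_smul]

theorem IsNormalZCR.pd_B_third_one (h : IsNormalZCR a 3 F 1 A B) (hF : IsThirdOrder F) :
    totalDx a 4 (pd (.u 2) B) + pd (.u 1) B -
      (pd (.u 2) F • pd (.u 0) A + (pd (.u 1) F + totalDx a 3 (pd (.u 2) F)) • pd (.u 1) A) +
      ⁅A, pd (.u 2) B⁆ = 0 := by
  have h1 := h.pd_zcr (k := 1) (by omega) (by omega)
  have h2 : pd (.u 2) (dxPow a 3 F 0) = _ := hF.pd_dxPow_two 0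
  have h3 : pd (.u 2) (dxPow a 3 F 1) = _ := hF.pd_dxPow_one 1
  rw [Finset.sum_range_succ, Finset.sum_range_succ, Finset.sum_range_zero, zero_add, h2, h3,
    Nat.cast_one, one_mul] at h1
  exact h1

/-- The second derivative of `A` with respect to the highest variable is covariantly constant up
to a scalar factor. -/
theorem IsNormalZCR.covariant_pd_pd (h : IsNormalZCR a 3 F (p + 2) A B) (hF : IsThirdOrder F) :
    (3 : MvPowerSeries Coord ℂ) • (totalDx a (p + 5) (pd (.u (p + 2)) (pd (.u (p + 2)) A)) +
      ⁅A, pd (.u (p + 2)) (pd (.u (p + 2)) A)⁆) =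
    (2 : MvPowerSeries Coord ℂ) • pd (.u 2) F • pd (.u (p + 2)) (pd (.u (p + 2)) A) := by
  have E2 := h.pd_B_second hF
  have E3 := h.pd_B_third hF
  have hA : ∀ s, pd (.u (p + 3)) (pd s A) = 0 := fun s => by
    rw [pd_comm, h.pd_eq_zero _ (by omega), pd_zero]
  have hF1 := hF.pd_pd (.u 1) (k := p + 3) (by omega)
  have hF2 := hF.pd_pd (.u 2) (k := p + 3) (by omega)
  -- For `p = 0` the factors agree; for `p > 0` the mixed derivative vanishes, since `∂F/∂u₂` has
  -- order at most 2.
  have hc : ((p + 2 : ℕ) : MvPowerSeries Coord ℂ) * pd (.u (p + 2)) (pd (.u 2) F) =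
      2 * pd (.u (p + 2)) (pd (.u 2) F) := by
    rcases Nat.eq_zero_or_pos p with rfl | hp
    · norm_num
    · rw [hF.pd_pd (.u 2) (by omega), mul_zero, mul_zero]
  have hD : pd (.u (p + 3)) (totalDx a 3 (pd (.u 2) F)) = pd (.u (p + 2)) (pd (.u 2) F) := by
    rw [← totalDx_eq_of_le a (show 3 ≤ p + 3 by omega) _ fun k hk => hF.pd_pd _ hk,
      pd_u_succ_totalDx a (by omega), hF2, totalDx_zero, zero_add]
  -- `X2` contains the mixed derivative of `B` by `u_{p+2}` and `u_{p+3}` once and `X3` contains it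
  -- twice, so `2 X2 - X3` eliminates it. `Y2` replaces the second derivative of `B` by `u_{p+3}`,
  -- which supplies the third copy of the covariant derivative.
  have X2 := congrArg (pd (.u (p + 2))) E2
  have Y2 := congrArg (pd (.u (p + 3))) E2
  have X3 := congrArg (pd (.u (p + 3))) E3
  simp only [show p + 1 + 1 = p + 2 by omega, show p + 1 + 2 = p + 3 by omega,
    show p + 1 + 4 = p + 5 by omega] at X2 Y2
  rw [pd_zero, pd_add, pd_sub, pd_add, pd_add, pd_lie, pd_smul,
    pd_u_succ_totalDx a (j := p + 1) (show p + 1 < p + 5 by omega), lie_self,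
    pd_comm (.u (p + 1)) (.u (p + 2))] at X2
  simp only [show p + 1 + 1 = p + 2 by omega] at X2
  simp only [show p + 1 + 2 = p + 3 by omega, pd_zero, pd_add, pd_sub, pd_lie, pd_smul,
    pd_u_succ_totalDx a (j := p + 2) (show p + 2 < p + 5 by omega), hA,
    h.pd_eq_zero (p + 3) (by omega), hF2, totalDx_zero,
    zero_lie, lie_zero, smul_zero, zero_smul] at Y2
  have Y2' : pd (.u (p + 3)) (pd (.u (p + 3)) B) = -pd (.u (p + 2)) (pd (.u (p + 2)) A) := by
    linear_combination (norm := module) Y2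
  rw [pd_zero, pd_add, pd_sub, pd_add, pd_add, pd_add, pd_lie, pd_smul, pd_smul,
    pd_u_succ_totalDx a (j := p + 2) (show p + 2 < p + 5 by omega), hA, hA, hA,
    h.pd_eq_zero (p + 3) (by omega), hF2, Y2', totalDx_neg, pd_add, hF1, pd_mul, hD, hc, show pd (.u (p + 3)) ((p + 2 : ℕ) : MvPowerSeries Coord ℂ) = 0 by
      rw [← map_natCast MvPowerSeries.C, pd_C], lie_neg, pd_comm (.u (p + 3)) (.u (p + 2)),
    zero_lie, smul_zero, zero_smul, smul_zero] at X3
  linear_combination (norm := module) (2 : MvPowerSeries Coord ℂ) • X2 - X3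

end ThirdOrder

/-! ### The Krichever–Novikov equation: central kernels and vanishing in order zero -/

section KricheverNovikov

variable (e : Fin 3 → ℂ) (a : Coord → ℂ)

theorem pd_u_coordSeries (k j : ℕ) :
    pd (.u k) (coordSeries a (.u j)) = if k = j then 1 else 0 := by
  split_ifs with h
  · rw [h, pd_coordSeries_self]
  · exact pd_coordSeries_of_ne a (by simpa using h)

/-- The cubic polynomial `(u₀ - e₁)(u₀ - e₂)(u₀ - e₃)`. -/
def cubic : MvPowerSeries Coord ℂ :=
  (coordSeries a (.u 0) - MvPowerSeries.C (e 0)) * (coordSeries a (.u 0) - MvPowerSeries.C (e 1))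
    * (coordSeries a (.u 0) - MvPowerSeries.C (e 2))

/-- The power series `u₁⁻¹`. -/
def uInv : MvPowerSeries Coord ℂ := (coordSeries a (.u 1))⁻¹

theorem knRHS_eq : knRHS e a = coordSeries a (.u 3) -
    MvPowerSeries.C (3 / 2) * coordSeries a (.u 2) ^ 2 * uInv a + cubic e a * uInv a := rfl

theorem pd_cubic_of_ne {s : Coord} (hs : s ≠ .u 0) : pd s (cubic e a) = 0 := by
  simp [cubic, pd_mul, pd_sub, pd_C, pd_coordSeries_of_ne a hs]

variable {a}

theorem u_mul_uInv (ha : a ∈ knProlongation) : coordSeries a (.u 1) * uInv a = 1 := by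
  apply MvPowerSeries.mul_inv_cancel
  rw [coordSeries, map_add, MvPowerSeries.constantCoeff_C, MvPowerSeries.constantCoeff_X, add_zero]
  exact ha

theorem pd_uInv (ha : a ∈ knProlongation) (s : Coord) :
    pd s (uInv a) = -pd s (coordSeries a (.u 1)) * uInv a ^ 2 := by
  have h := u_mul_uInv ha
  have h1 := congrArg (pd s) h
  rw [pd_mul, pd_one] at h1
  linear_combination uInv a * h1 - pd s (uInv a) * h

theorem totalDx_uInv (ha : a ∈ knProlongation) {n : ℕ} (hn : 1 < n) :
    totalDx a n (uInv a) = -coordSeries a (.u 2) * uInv a ^ 2 := by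
  have h := u_mul_uInv ha
  have h1 := congrArg (totalDx a n) h
  rw [totalDx_mul, totalDx_one, totalDx_coordSeries_u a hn] at h1
  linear_combination uInv a * h1 - totalDx a n (uInv a) * h

theorem C_three_half : 2 * MvPowerSeries.C (3 / 2 : ℂ) = (3 : MvPowerSeries Coord ℂ) := by
  rw [← map_ofNat MvPowerSeries.C, ← map_mul, ← map_ofNat MvPowerSeries.C]
  norm_num

theorem pd_two_knRHS (ha : a ∈ knProlongation) :
    pd (.u 2) (knRHS e a) = -3 * coordSeries a (.u 2) * uInv a := by
  simp only [knRHS_eq, pd_add, pd_sub, pd_mul, pow_two, pd_C, pd_uInv ha, pd_u_coordSeries,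
    pd_cubic_of_ne e a (show Coord.u 2 ≠ .u 0 by simp)]
  simp only [OfNat.ofNat_ne_one, Nat.reduceEqDiff, if_true, if_false]
  linear_combination (-coordSeries a (.u 2) * uInv a) * C_three_half

theorem pd_one_knRHS (ha : a ∈ knProlongation) :
    pd (.u 1) (knRHS e a) = MvPowerSeries.C (3 / 2) * coordSeries a (.u 2) ^ 2 * uInv a ^ 2 -
      cubic e a * uInv a ^ 2 := by
  simp only [knRHS_eq, pd_add, pd_sub, pd_mul, pow_two, pd_C, pd_uInv ha, pd_u_coordSeries,
    pd_cubic_of_ne e a (show Coord.u 1 ≠ .u 0 by simp)]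
  norm_num
  ring

theorem isThirdOrder_knRHS (ha : a ∈ knProlongation) : IsThirdOrder (knRHS e a) where
  pd_three := by
    simp [knRHS_eq, pd_add, pd_sub, pd_mul, pow_two, pd_C, pd_uInv ha, pd_u_coordSeries,
      pd_cubic_of_ne e a (show Coord.u 3 ≠ .u 0 by simp)]
  pd_of_lt k hk := by
    have h3 : k ≠ 3 := by omega
    have h2 : k ≠ 2 := by omega
    have h1 : k ≠ 1 := by omega
    have h0 : k ≠ 0 := by omega
    simp [knRHS_eq, pd_add, pd_sub, pd_mul, pow_two, pd_C, pd_uInv ha, pd_u_coordSeries,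
      pd_cubic_of_ne e a (show Coord.u k ≠ .u 0 by simpa using h0), h1, h2, h3]

variable {e} {L : Type*} [LieRing L] [LieAlgebra ℂ L] {p : ℕ} {A B : MvPowerSeries Coord L}

/-- With `∂F/∂u₂ = -3u₂/u₁` the equation for `S` reads `D_x S + [A,S] = -2(u₂/u₁) S`. The factor
`u₁²`, with `D_x(u₁²) = 2u₁u₂`, absorbs the right-hand side and makes `u₁² S` covariantly constant.
-/
theorem IsNormalZCR.pd_pd_mem_center (h : IsNormalZCR a 3 (knRHS e a) (p + 2) A B)
    (ha : a ∈ knProlongation) (hg : LieSubalgebra.lieSpan ℂ L (Set.range A) = ⊤) :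
    Vals (LieAlgebra.center ℂ L).toSubmodule (pd (.u (p + 2)) (pd (.u (p + 2)) A)) := by
  set S := pd (.u (p + 2)) (pd (.u (p + 2)) A) with hS
  have hF := isThirdOrder_knRHS e ha
  have h1 := h.covariant_pd_pd hF
  rw [pd_two_knRHS e ha, ← hS] at h1
  have hu := u_mul_uInv ha
  set C := coordSeries a (.u 1) ^ 2 • S with hC
  have h3 : (3 : MvPowerSeries Coord ℂ) * MvPowerSeries.C (1 / 3) = 1 := by
    rw [← map_ofNat MvPowerSeries.C, ← map_mul, ← map_one MvPowerSeries.C]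
    norm_num
  have h2 : totalDx a (p + 5) S + ⁅A, S⁆ = (-2 * coordSeries a (.u 2) * uInv a) • S := by
    have h4 := congrArg (fun X => (MvPowerSeries.C (1 / 3) : MvPowerSeries Coord ℂ) • X) h1
    simp only [smul_smul] at h4
    rw [mul_comm, h3, one_smul] at h4
    rw [h4]
    congr 1
    linear_combination (-2 * coordSeries a (.u 2) * uInv a) * h3
  have hcc : totalDx a (p + 5) C + ⁅A, C⁆ = 0 := by
    rw [hC, totalDx_smul, lie_smul, pow_two, totalDx_mul, totalDx_coordSeries_u a (by omega)]
    have : ⁅A, S⁆ = (-2 * coordSeries a (.u 2) * uInv a) • S - totalDx a (p + 5) S := by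
      rw [← h2]; abel
    rw [this]
    have h5 : (2 * coordSeries a (.u 1) * coordSeries a (.u 2) + coordSeries a (.u 1) ^ 2 *
        (-2 * coordSeries a (.u 2) * uInv a)) • S = 0 := by
      rw [show (2 * coordSeries a (.u 1) * coordSeries a (.u 2) + coordSeries a (.u 1) ^ 2 *
        (-2 * coordSeries a (.u 2) * uInv a)) = 0 by
          linear_combination (-2 * coordSeries a (.u 1) * coordSeries a (.u 2)) * hu, zero_smul]
    linear_combination (norm := module) h5
  have hfin : ∀ k, p + 5 ≤ k → pd (.u k) C = 0 := by
    intro k hk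
    have : pd (.u k) S = 0 := by
      rw [hS, pd_comm, pd_comm (.u k), h.pd_eq_zero k (by omega), pd_zero, pd_zero]
    rw [hC, pd_smul, this, pow_two, pd_mul, pd_u_coordSeries, if_neg (by omega)]
    simp
  have hSC : S = uInv a ^ 2 • C := by
    rw [hC, smul_smul, show uInv a ^ 2 * coordSeries a (.u 1) ^ 2 = 1 by
      rw [← mul_pow, mul_comm, hu, one_pow], one_smul]
  rw [hSC]
  refine Vals.smul _ fun m => mem_center_of_lieSpan hg ?_
  rintro _ ⟨q, rfl⟩
  exact h.lie_coeff_eq_zero hfin hcc q m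

/-- Coefficients of `A` of degree at least 2 in `u_{p+2}` are controlled by the second derivative;
those of degree 1 are zero by the normal form. -/
theorem IsNormalZCR.pd_mem_center (h : IsNormalZCR a 3 (knRHS e a) (p + 2) A B)
    (ha : a ∈ knProlongation) (hg : LieSubalgebra.lieSpan ℂ L (Set.range A) = ⊤) :
    Vals (LieAlgebra.center ℂ L).toSubmodule (pd (.u (p + 2)) A) := by
  intro m
  by_cases hm : m (.u (p + 2)) = 0
  · by_cases hm' : ∃ k, p + 2 < k ∧ m (.u k) ≠ 0
    · obtain ⟨k, hk, hmk⟩ := hm'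
      have : pd (.u (p + 2)) A m = 0 :=
        coeff_eq_zero_of_pd (s := .u k) (by rw [pd_comm, h.pd_eq_zero k hk, pd_zero]) hmk
      rw [this]
      exact zero_mem _
    · push Not at hm'
      rw [h.coeff_pd_succ (p + 1)]
      · exact zero_mem _
      · intro k hk
        rcases Nat.lt_or_ge (p + 2) k with h1 | h1
        · exact hm' k h1
        · obtain rfl : k = p + 2 := by omega
          exact hm
  · exact (h.pd_pd_mem_center ha hg).coeff_mem hm

/-- The kernel of `φ_{p+2}` is central. -/
theorem ker_map_le_center (ha : a ∈ knProlongation) (p : ℕ) :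
    (KNFd.map e a (p + 1)).ker ≤ LieAlgebra.center ℂ (KNFd e a (p + 2)) := by
  set F := knRHS e a
  set Z := LieAlgebra.center ℂ (KNFd e a (p + 2)) with hZ
  let π : KNFd e a (p + 2) →ₗ⁅ℂ⁆ KNFd e a (p + 2) ⧸ Z :=
    { (LieSubmodule.Quotient.mk' Z : _ →ₗ[ℂ] KNFd e a (p + 2) ⧸ Z) with
      map_lie' := fun {x y} => LieSubmodule.Quotient.mk_bracket (I := Z) x y }
  have hπ : ∀ y, π y = 0 ↔ y ∈ Z := fun y => LieSubmodule.Quotient.mk_eq_zero (N := Z)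
  have h := Fd.isNormalZCR a 3 F (p + 2)
  have hA := h.pd_mem_center ha (Fd.lieSpan_A a 3 F (p + 2))
  set A := Fd.A a 3 F (p + 2)
  set B := Fd.B a 3 F (p + 2)
  have hB := h.pd_B_top (isThirdOrder_knRHS e ha)
  have hA' : pd (.u (p + 2)) (mapSeries π A) = 0 := by
    rw [pd_mapSeries]
    exact funext fun m => (hπ _).mpr (hA m)
  have hB' : pd (.u (p + 1 + 3)) (mapSeries π B) = 0 := by
    rw [pd_mapSeries, show p + 1 + 3 = p + 2 + 2 by omega, hB]
    exact funext fun m => (hπ _).mpr (hA m)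
  have hz : ∀ f : MvPowerSeries Coord (KNFd e a (p + 2)), f = 0 → mapSeries π f = 0 := by
    intro f hf
    funext m
    rw [mapSeries, hf]
    exact map_zero π
  -- Modulo the center `A` loses `u_{p+2}`, and `B` loses `u_{p+4}` because `∂B/∂u_{p+4} =
  -- ∂A/∂u_{p+2}`; the order drops by one.
  have h' : IsNormalZCR a 3 F (p + 1) (mapSeries π A) (mapSeries π B) :=
    { pd_eq_zero := by
        intro k hk
        rcases Nat.lt_or_ge (p + 2) k with h1 | h1
        · rw [pd_mapSeries, hz _ (h.pd_eq_zero k h1)]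
        · obtain rfl : k = p + 2 := by omega
          exact hA'
      coeff_zero := fun m hm => by rw [mapSeries, h.coeff_zero m hm, map_zero]
      coeff_normal := by
        intro m hm ⟨r, h1, h2, h3, h4⟩
        rw [mapSeries, h.coeff_normal m (fun k hk => hm k (by omega)) ⟨r, h1, by omega, h3, ?_⟩,
          map_zero]
        intro q hq hq'
        rcases Nat.lt_or_ge (p + 1) q with h5 | h5
        · exact hm q h5
        · exact h4 q hq h5
      pd_B := by
        intro k hk
        rcases Nat.lt_or_ge (p + 1 + 3) k with h1 | h1
        · rw [pd_mapSeries, hz _ (h.pd_B k (by omega))]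
        · obtain rfl : k = p + 1 + 3 := by omega
          exact hB'
      zcr := by
        have h1 := zeroCurvature_succ a 3 F (p + 1) _ _ hA' hB'
        refine h1.symm.trans (funext fun m => ?_)
        refine (zeroCurvature_mapSeries π a 3 F (p + 2) A B m).symm.trans ?_
        have := congrFun h.zcr m
        exact (congrArg π this).trans (map_zero π)
      coeff_B := fun m hx hm => by rw [mapSeries, h.coeff_B m hx hm, map_zero] }
  obtain ⟨ψ, hψ⟩ := h'.exists_lift
  -- The projection modulo the center factors through the map whose kernel is in question.
  have hcomp : ψ.comp (KNFd.map e a (p + 1)) = π := by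
    apply Fd.hom_ext
    intro m
    rw [LieHom.comp_apply]
    exact (congrArg ψ (Fd.map_A m)).trans (hψ m)
  intro y hy
  rw [LieHom.mem_ker] at hy
  rw [← hπ, ← hcomp, LieHom.comp_apply, hy, map_zero]

theorem subsingleton_KNFd_zero (ha : a ∈ knProlongation) : Subsingleton (KNFd e a 0) := by
  have h := Fd.isNormalZCR a 3 (knRHS e a) 0
  have hF := isThirdOrder_knRHS e ha
  have hsp := Fd.lieSpan_A a 3 (knRHS e a) 0
  set A := Fd.A a 3 (knRHS e a) 0
  set B := Fd.B a 3 (knRHS e a) 0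
  have E1 := h.pd_B_top hF
  have E2 := h.pd_zcr (k := 1) (by omega) (by omega)
  have h2 : pd (.u 2) (dxPow a 3 (knRHS e a) 0) = pd (.u 2) (knRHS e a) := rfl
  rw [Finset.sum_range_one, h2, E1] at E2
  have hA : ∀ k s, 0 < k → pd (.u k) (pd s A) = 0 := fun k s hk => by
    rw [pd_comm, h.pd_eq_zero k hk, pd_zero]
  -- All terms drop out except `(∂²F/∂u₂²) ∂₀A = -3u₁⁻¹ ∂₀A`.
  have X := congrArg (pd (.u 2)) E2
  rw [pd_zero, pd_add, pd_sub, pd_add, pd_u_succ_totalDx a (by omega), pd_lie, pd_smul,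
    pd_comm (.u 2) (.u 1), E1, hA _ _ (by omega), hA _ _ (by omega), h.pd_eq_zero 2 (by omega),
    zero_lie, lie_zero, totalDx_zero, pd_two_knRHS e ha, pd_mul, pd_mul, pd_uInv ha,
    pd_u_coordSeries, pd_u_coordSeries, ← map_ofNat MvPowerSeries.C, ← map_neg, pd_C] at X
  simp only [if_true, if_false, OfNat.ofNat_ne_one, mul_one, smul_zero, add_zero, zero_mul,
    zero_add, neg_zero, mul_zero, zero_sub, neg_eq_zero] at X
  have h3 : MvPowerSeries.C (-1 / 3 : ℂ) * MvPowerSeries.C (-3) = (1 : MvPowerSeries Coord ℂ) := by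
    rw [← map_mul, ← map_one MvPowerSeries.C]
    norm_num
  have hA0 : pd (.u 0) A = 0 := by
    have := congrArg (fun X => (MvPowerSeries.C (-1 / 3 : ℂ) * coordSeries a (.u 1)) • X) X
    simp only [smul_smul, smul_zero] at this
    rwa [show MvPowerSeries.C (-1 / 3 : ℂ) * coordSeries a (.u 1) *
      (MvPowerSeries.C (-3) * uInv a) = 1 by
        linear_combination coordSeries a (.u 1) * uInv a * h3 + u_mul_uInv ha, one_smul] at this
  have hA00 : ∀ m, A m = 0 := by
    intro m
    by_cases hm : ∃ k, m (.u k) ≠ 0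
    · obtain ⟨k, hk⟩ := hm
      rcases Nat.eq_zero_or_pos k with rfl | hk0
      · exact coeff_eq_zero_of_pd hA0 hk
      · exact coeff_eq_zero_of_pd (h.pd_eq_zero k hk0) hk
    · push Not at hm
      exact h.coeff_zero m hm
  have hbot : LieSubalgebra.lieSpan ℂ (KNFd e a 0) (Set.range A) ≤ ⊥ := by
    rw [LieSubalgebra.lieSpan_le]
    rintro _ ⟨m, rfl⟩
    exact hA00 m
  rw [hsp] at hbot
  refine ⟨fun x y => ?_⟩
  have hx : x ∈ (⊥ : LieSubalgebra ℂ (KNFd e a 0)) := hbot (LieSubalgebra.mem_top x)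
  have hy : y ∈ (⊥ : LieSubalgebra ℂ (KNFd e a 0)) := hbot (LieSubalgebra.mem_top y)
  rw [LieSubalgebra.mem_bot] at hx hy
  rw [hx, hy]

end KricheverNovikov
end
end ZCR

namespace ZCR

open Finset TensorProduct

noncomputable section

/-! ### Zero-curvature representations of order one of the Krichever–Novikov equation -/

section Scalars

variable (a : Coord → ℂ)

/-- The constant `a₁⁻²`. -/
def invSq : MvPowerSeries Coord ℂ := MvPowerSeries.C ((a (.u 1))⁻¹ ^ 2)

/-- The power series `u₁⁻¹ + a₁⁻² u₁`. -/
def wSeries : MvPowerSeries Coord ℂ := uInv a + invSq a * coordSeries a (.u 1)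

variable {a}

theorem pd_invSq (s : Coord) : pd s (invSq a) = 0 := pd_C s _

theorem totalDx_invSq (n : ℕ) : totalDx a n (invSq a) = 0 := totalDx_C a n _

theorem pd_uInv_of_ne (ha : a ∈ knProlongation) {s : Coord} (hs : s ≠ .u 1) :
    pd s (uInv a) = 0 := by
  rw [pd_uInv ha, pd_coordSeries_of_ne a hs, neg_zero, zero_mul]

theorem pd_one_uInv (ha : a ∈ knProlongation) : pd (.u 1) (uInv a) = -uInv a ^ 2 := by
  rw [pd_uInv ha, pd_coordSeries_self, neg_one_mul]

theorem pd_wSeries_of_ne (ha : a ∈ knProlongation) {s : Coord} (hs : s ≠ .u 1) :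
    pd s (wSeries a) = 0 := by
  rw [wSeries, pd_add, pd_mul, pd_invSq, pd_uInv_of_ne ha hs, pd_coordSeries_of_ne a hs, zero_mul,
    mul_zero, add_zero, add_zero]

theorem pd_one_wSeries (ha : a ∈ knProlongation) :
    pd (.u 1) (wSeries a) = invSq a - uInv a ^ 2 := by
  rw [wSeries, pd_add, pd_mul, pd_invSq, pd_one_uInv ha, pd_coordSeries_self]
  ring

theorem totalDx_wSeries (ha : a ∈ knProlongation) {n : ℕ} (hn : 1 < n) :
    totalDx a n (wSeries a) = coordSeries a (.u 2) * (invSq a - uInv a ^ 2) := by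
  rw [wSeries, totalDx_add, totalDx_uInv ha hn, totalDx_mul, totalDx_invSq,
    totalDx_coordSeries_u a hn]
  ring

theorem totalDx_pow (n : ℕ) (f : MvPowerSeries Coord ℂ) (k : ℕ) :
    totalDx a n (f ^ (k + 1)) = (k + 1 : ℕ) * f ^ k * totalDx a n f := by
  induction k with
  | zero => simp
  | succ k ih =>
    rw [pow_succ, totalDx_mul, ih]
    push_cast
    ring

theorem pd_pow (s : Coord) (f : MvPowerSeries Coord ℂ) (k : ℕ) :
    pd s (f ^ (k + 1)) = (k + 1 : ℕ) * f ^ k * pd s f := by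
  induction k with
  | zero => simp
  | succ k ih =>
    rw [pow_succ, pd_mul, ih]
    push_cast
    ring

theorem C_half : 2 * MvPowerSeries.C (1 / 2 : ℂ) = (1 : MvPowerSeries Coord ℂ) := by
  rw [← map_ofNat MvPowerSeries.C, ← map_mul, ← map_one MvPowerSeries.C]
  norm_num

theorem C_third : 3 * MvPowerSeries.C (1 / 3 : ℂ) = (1 : MvPowerSeries Coord ℂ) := by
  rw [← map_ofNat MvPowerSeries.C, ← map_mul, ← map_one MvPowerSeries.C]
  norm_num

theorem eq_zero_of_smul_eq_zero {M : Type*} [AddCommGroup M] [Module ℂ M]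
    {f g : MvPowerSeries Coord ℂ} (h : g * f = 1) {x : MvPowerSeries Coord M} (hx : f • x = 0) :
    x = 0 := by
  rw [← one_smul (MvPowerSeries Coord ℂ) x, ← h, mul_smul, hx, smul_zero]

theorem totalDx_ofNat (n k : ℕ) [k.AtLeastTwo] :
    totalDx a n (OfNat.ofNat k : MvPowerSeries Coord ℂ) = 0 := by
  rw [← map_ofNat MvPowerSeries.C, totalDx_C]

theorem pd_ofNat (s : Coord) (k : ℕ) [k.AtLeastTwo] :
    pd s (OfNat.ofNat k : MvPowerSeries Coord ℂ) = 0 := by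
  rw [← map_ofNat MvPowerSeries.C, pd_C]

end Scalars

section OrderOne

variable {e : Fin 3 → ℂ} {a : Coord → ℂ} {L : Type*} [LieRing L] [LieAlgebra ℂ L]
  {A B : MvPowerSeries Coord L}

theorem IsNormalZCR.pd_two_B (h : IsNormalZCR a 3 (knRHS e a) 1 A B) (ha : a ∈ knProlongation) :
    pd (.u 2) B = pd (.u 0) A - (3 * coordSeries a (.u 2) * uInv a) • pd (.u 1) A -
      (totalDx a 4 (pd (.u 1) A) + ⁅A, pd (.u 1) A⁆) := by
  have h2 := h.pd_B_second (p := 0) (isThirdOrder_knRHS e ha)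
  rw [pd_two_knRHS e ha] at h2
  simp only [zero_add] at h2
  linear_combination (norm := module) h2

theorem IsNormalZCR.pd_one_B (h : IsNormalZCR a 3 (knRHS e a) 1 A B) (ha : a ∈ knProlongation) :
    pd (.u 1) B = (pd (.u 1) (knRHS e a) - 3 * coordSeries a (.u 3) * uInv a +
        3 * coordSeries a (.u 2) ^ 2 * uInv a ^ 2) • pd (.u 1) A -
      (3 * coordSeries a (.u 2) * uInv a) • pd (.u 0) A -
      (totalDx a 4 (pd (.u 2) B) + ⁅A, pd (.u 2) B⁆) := by
  have hF := isThirdOrder_knRHS e ha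
  have h3 := h.pd_B_third_one hF
  have hD : totalDx a 3 (pd (.u 2) (knRHS e a)) =
      -3 * coordSeries a (.u 3) * uInv a + 3 * coordSeries a (.u 2) ^ 2 * uInv a ^ 2 := by
    rw [pd_two_knRHS e ha, totalDx_mul, totalDx_mul, totalDx_uInv ha (by omega),
      totalDx_coordSeries_u a (by omega), totalDx_neg, totalDx_ofNat]
    ring
  rw [hD, pd_two_knRHS e ha] at h3
  linear_combination (norm := module) h3

/-- The compatibility condition `∂₁∂₂B = ∂₂∂₁B`. -/
theorem IsNormalZCR.order_one_compat (h : IsNormalZCR a 3 (knRHS e a) 1 A B)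
    (ha : a ∈ knProlongation) :
    totalDx a 4 (pd (.u 1) (pd (.u 1) A)) + ⁅A, pd (.u 1) (pd (.u 1) A)⁆ +
      uInv a • (totalDx a 4 (pd (.u 1) A) + ⁅A, pd (.u 1) A⁆) +
      (2 * coordSeries a (.u 2) * uInv a) • pd (.u 1) (pd (.u 1) A) - uInv a • pd (.u 0) A = 0 := by
  have hA : ∀ s, pd (.u 2) (pd s A) = 0 := fun s => by
    rw [pd_comm, h.pd_eq_zero 2 (by omega), pd_zero]
  have hA2 := h.pd_eq_zero 2 (by omega)
  have E2 := h.pd_two_B ha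
  have E1 := h.pd_one_B ha
  -- The mixed derivative of `B` by `u₁` and `u₂` is computed from the formula for `∂₂B` and from
  -- that for `∂₁B`; the latter also needs `∂₂²B`. The difference is three times the claim.
  have B12 := congrArg (pd (.u 1)) E2
  have B22 := congrArg (pd (.u 2)) E2
  have B21 := congrArg (pd (.u 2)) E1
  rw [pd_sub, pd_sub, pd_add, pd_smul, pd_mul, pd_mul, pd_ofNat, pd_one_uInv ha, pd_lie,
    pd_coordSeries_of_ne a (by simp), pd_u_succ_totalDx a (j := 0) (by omega), lie_self,
    pd_comm (.u 1) (.u 0)] at B12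
  rw [pd_sub, pd_sub, pd_add, pd_smul, pd_mul, pd_mul, pd_ofNat, pd_uInv_of_ne ha (by simp),
    pd_lie, pd_coordSeries_self, pd_u_succ_totalDx a (j := 1) (by omega), hA, hA, hA2,
    totalDx_zero, zero_lie, lie_zero] at B22
  have B22' : pd (.u 2) (pd (.u 2) B) =
      -pd (.u 1) (pd (.u 1) A) - (3 * uInv a) • pd (.u 1) A := by
    rw [B22]; module
  have hF : pd (.u 2) (pd (.u 1) (knRHS e a)) = 3 * coordSeries a (.u 2) * uInv a ^ 2 := by
    rw [pd_comm, pd_two_knRHS e ha, pd_mul, pd_mul, pd_one_uInv ha,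
      pd_coordSeries_of_ne a (show Coord.u 1 ≠ .u 2 by simp), pd_neg, pd_ofNat]
    ring
  have p3 : pd (.u 2) (3 : MvPowerSeries Coord ℂ) = 0 := pd_ofNat _ 3
  have t3 : totalDx a 4 (3 : MvPowerSeries Coord ℂ) = 0 := totalDx_ofNat 4 3
  simp only [zero_add, pow_two, pd_sub, pd_add, pd_smul, pd_lie, pd_mul, p3, t3, hA, hA2, hF, B22',
    pd_u_succ_totalDx a (j := 1) (show 1 < 4 by omega), pd_coordSeries_self,
    pd_coordSeries_of_ne a (show Coord.u 2 ≠ .u 3 by simp), totalDx_sub, totalDx_neg,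
    totalDx_smul, totalDx_mul, totalDx_uInv ha (show 1 < 4 by omega), lie_sub,
    lie_neg, lie_smul, zero_lie, pd_comm (.u 2) (.u 1) B, B12,
    pd_uInv_of_ne ha (show Coord.u 2 ≠ .u 1 by simp)] at B21
  refine eq_zero_of_smul_eq_zero (f := 3) ((mul_comm _ _).trans C_third) ?_
  linear_combination (norm := module) (-1 : MvPowerSeries Coord ℂ) • B21
end OrderOne
end
end ZCR

namespace ZCR

open Finset TensorProduct

noncomputable section

/-! ### Coefficients of products with a variable or a constant -/

section Vanishing

variable {M : Type*} [AddCommGroup M] [Module ℂ M]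

theorem coeff_X_mul_smul (s : Coord) (g : MvPowerSeries Coord ℂ) (f : MvPowerSeries Coord M)
    {m : Mon} (hm : m s = 0) : ((MvPowerSeries.X s * g) • f) m = 0 := by
  rw [mul_smul]
  refine Finset.sum_eq_zero fun q hq => ?_
  have h1 : q.1 ≠ Finsupp.single s 1 := by
    intro h
    rw [HasAntidiagonal.mem_antidiagonal] at hq
    rw [← hq, h, Finsupp.add_apply, Finsupp.single_eq_same] at hm
    omega
  rw [← MvPowerSeries.coeff_apply (MvPowerSeries.X s : MvPowerSeries Coord ℂ),
    MvPowerSeries.coeff_X, if_neg h1, zero_smul]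

theorem C_smul (c : ℂ) (f : MvPowerSeries Coord M) (m : Mon) :
    ((MvPowerSeries.C c : MvPowerSeries Coord ℂ) • f) m = c • f m := by
  refine (Finset.sum_eq_single ((0, m) : Mon × Mon) ?_ ?_).trans ?_
  · rintro ⟨q, r⟩ hqr hne
    rw [HasAntidiagonal.mem_antidiagonal] at hqr
    have hq : q ≠ 0 := by
      rintro rfl
      exact hne (by rw [← hqr, zero_add])
    rw [← MvPowerSeries.coeff_apply (MvPowerSeries.C c : MvPowerSeries Coord ℂ),
      MvPowerSeries.coeff_C, if_neg hq, zero_smul]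
  · intro h
    simp at h
  · rw [← MvPowerSeries.coeff_apply (MvPowerSeries.C c : MvPowerSeries Coord ℂ),
      MvPowerSeries.coeff_C, if_pos rfl]

end Vanishing

/-! ### Series that are horizontal in x -/

section Horizontal

variable {L : Type*} [LieRing L] [LieAlgebra ℂ L]

/-- The series `Y` depends on `x`, `t`, `u₀` only and satisfies `∂ₓY + [γ,Y] = 0`. -/
structure IsHorizontal (γ Y : MvPowerSeries Coord L) : Prop where
  pd_u : ∀ k, pd (.u (k + 1)) Y = 0
  pd_x : pd .x Y = -⁅γ, Y⁆

variable {γ Y Z : MvPowerSeries Coord L}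

theorem IsHorizontal.pd_zero (hγ : ∀ k, pd (.u k) γ = 0) (h : IsHorizontal γ Y) :
    IsHorizontal γ (pd (.u 0) Y) where
  pd_u k := by rw [pd_comm, h.pd_u, ZCR.pd_zero]
  pd_x := by rw [pd_comm, h.pd_x, pd_neg, pd_lie, hγ, zero_lie, zero_add]

theorem IsHorizontal.lie (hY : IsHorizontal γ Y) (hZ : IsHorizontal γ Z) :
    IsHorizontal γ ⁅Y, Z⁆ where
  pd_u k := by rw [pd_lie, hY.pd_u, hZ.pd_u, zero_lie, lie_zero, add_zero]
  pd_x := by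
    rw [pd_lie, hY.pd_x, hZ.pd_x, leibniz_lie, neg_lie, lie_neg]
    abel

theorem totalDx_of_pd_u (a : Coord → ℂ) {n : ℕ} (hn : 0 < n) (h : ∀ k, pd (.u (k + 1)) Y = 0) :
    totalDx a n Y = pd .x Y + coordSeries a (.u 1) • pd (.u 0) Y := by
  obtain ⟨n, rfl⟩ : ∃ j, n = j + 1 := ⟨n - 1, by omega⟩
  simp [totalDx, Finset.sum_range_succ', h, mulSeries_eq_smul']

theorem IsHorizontal.totalDx (h : IsHorizontal γ Y) (a : Coord → ℂ) {n : ℕ} (hn : 0 < n) :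
    totalDx a n Y = coordSeries a (.u 1) • pd (.u 0) Y - ⁅γ, Y⁆ := by
  rw [totalDx_of_pd_u a hn h.pd_u, h.pd_x]
  abel

end Horizontal

/-! ### Order one: the shape of A -/

section OrderOne

variable {a : Coord → ℂ} {L : Type*} [LieRing L] [LieAlgebra ℂ L]

/-- The series `α = ½ u₁³ ∂₁²A`. -/
def alphaSeries (a : Coord → ℂ) (A : MvPowerSeries Coord L) : MvPowerSeries Coord L :=
  (MvPowerSeries.C (1 / 2) * coordSeries a (.u 1) ^ 3) • pd (.u 1) (pd (.u 1) A)

/-- The series `γ = A - (u₁⁻¹ + a₁⁻² u₁) α`. -/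
def gammaSeries (a : Coord → ℂ) (A : MvPowerSeries Coord L) : MvPowerSeries Coord L :=
  A - wSeries a • alphaSeries a A

theorem C_inv_mul_uInv (ha : a ∈ knProlongation) :
    uInv a = MvPowerSeries.C (a (.u 1))⁻¹ * (1 - uInv a * MvPowerSeries.X (.u 1)) := by
  have h := u_mul_uInv ha
  have h1 : MvPowerSeries.C (a (.u 1))⁻¹ * MvPowerSeries.C (a (.u 1)) =
      (1 : MvPowerSeries Coord ℂ) := by
    rw [← map_mul, inv_mul_cancel₀ ha, map_one]
  rw [coordSeries] at h
  linear_combination MvPowerSeries.C (a (.u 1))⁻¹ * h - uInv a * h1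

/-- At `u₁ = a₁` both summands of `wSeries` equal `a₁⁻¹`. -/
theorem wSeries_eq (ha : a ∈ knProlongation) : ∃ g, wSeries a =
    MvPowerSeries.C (2 * (a (.u 1))⁻¹) + MvPowerSeries.X (.u 1) * g := by
  refine ⟨invSq a - MvPowerSeries.C (a (.u 1))⁻¹ * uInv a, ?_⟩
  have h1 : MvPowerSeries.C (a (.u 1))⁻¹ * MvPowerSeries.C (a (.u 1)) =
      (1 : MvPowerSeries Coord ℂ) := by
    rw [← map_mul, inv_mul_cancel₀ ha, map_one]
  rw [wSeries, invSq, coordSeries, map_pow, map_mul, map_ofNat]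
  linear_combination C_inv_mul_uInv ha + MvPowerSeries.C (a (.u 1))⁻¹ * h1

/-- The term `a₁⁻²u₁` in `wSeries` is there so that its derivative vanishes at `u₁ = a₁`, as the
normal form demands. -/
theorem uInv_sq_sub_invSq_eq (ha : a ∈ knProlongation) : ∃ g, uInv a ^ 2 - invSq a =
    MvPowerSeries.X (.u 1) * g := by
  refine ⟨-MvPowerSeries.C (a (.u 1))⁻¹ * uInv a * (uInv a + MvPowerSeries.C (a (.u 1))⁻¹), ?_⟩
  rw [invSq, map_pow]
  linear_combination (uInv a + MvPowerSeries.C (a (.u 1))⁻¹) * C_inv_mul_uInv ha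

variable {e : Fin 3 → ℂ} {A B : MvPowerSeries Coord L}

theorem pd_pd_eq_alphaSeries (ha : a ∈ knProlongation) (A : MvPowerSeries Coord L) :
    pd (.u 1) (pd (.u 1) A) = (2 * uInv a ^ 3) • alphaSeries a A := by
  have hu := u_mul_uInv ha
  have h2 := C_half
  rw [alphaSeries, smul_smul, show 2 * uInv a ^ 3 *
    (MvPowerSeries.C (1 / 2) * coordSeries a (.u 1) ^ 3) = 1 by grind, one_smul]

/-- The derivative of the compatibility condition by `u₂` is `∂₁³A = -3u₁⁻¹ ∂₁²A`, which says that
`u₁³ ∂₁²A` is free of `u₁`. -/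
theorem IsNormalZCR.pd_u_alphaSeries (h : IsNormalZCR a 3 (knRHS e a) 1 A B)
    (ha : a ∈ knProlongation) (k : ℕ) : pd (.u (k + 1)) (alphaSeries a A) = 0 := by
  have hA : ∀ k s, pd (.u (k + 2)) (pd s A) = 0 := fun k s => by
    rw [pd_comm, h.pd_eq_zero (k + 2) (by omega), pd_zero]
  have hA' : ∀ k s s', pd (.u (k + 2)) (pd s (pd s' A)) = 0 := fun k s s' => by
    rw [pd_comm, hA, pd_zero]
  rcases k with _ | k
  swap
  · rw [alphaSeries, pd_smul, hA', pd_mul, pd_pow, pd_C, pd_coordSeries_of_ne a (by simp)]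
    simp
  have hu := u_mul_uInv ha
  have X := congrArg (pd (.u 2)) (h.order_one_compat ha)
  rw [pd_sub, pd_add, pd_add, pd_add, pd_smul, pd_smul, pd_smul, pd_add, pd_lie, pd_lie, pd_mul,
    pd_mul, pd_ofNat, pd_uInv_of_ne ha (by simp), pd_coordSeries_self,
    pd_u_succ_totalDx a (j := 1) (by omega), pd_u_succ_totalDx a (j := 1) (by omega),
    hA', hA, hA, h.pd_eq_zero 2 (by omega), totalDx_zero, pd_zero] at X
  simp only [zero_lie, lie_zero, smul_zero, zero_add, zero_smul, add_zero, sub_zero, mul_one,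
    zero_mul, mul_zero] at X
  rw [zero_add, alphaSeries, pd_smul, pd_mul, pd_pow, pd_C, pd_coordSeries_self]
  have e1 : ((0 : MvPowerSeries Coord ℂ) * coordSeries a (.u 1) ^ 3 + MvPowerSeries.C (1 / 2) *
      (((2 + 1 : ℕ) : MvPowerSeries Coord ℂ) * coordSeries a (.u 1) ^ 2 * 1)) =
      (MvPowerSeries.C (1 / 2) * coordSeries a (.u 1) ^ 3) * (3 * uInv a) := by
    push_cast
    grind
  rw [e1]
  linear_combination (norm := module)
    (MvPowerSeries.C (1 / 2 : ℂ) * coordSeries a (.u 1) ^ 3) • X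

/-- Integrate `∂₁²A = 2u₁⁻³ α`. The constant of integration `a₁⁻² α` is fixed by the normal form,
through the vanishing of `∂₁A` at `u₁ = a₁`. -/
theorem IsNormalZCR.pd_one_A (h : IsNormalZCR a 3 (knRHS e a) 1 A B)
    (ha : a ∈ knProlongation) :
    pd (.u 1) A = (invSq a - uInv a ^ 2) • alphaSeries a A := by
  have hα := h.pd_u_alphaSeries ha
  set β := pd (.u 1) A + (uInv a ^ 2 - invSq a) • alphaSeries a A with hβ
  have hβu : ∀ k, pd (.u (k + 1)) β = 0 := by
    intro k
    rw [hβ, pd_add, pd_smul, pd_sub, pd_invSq, pd_pow, hα]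
    rcases k with _ | k
    · rw [zero_add, pd_pd_eq_alphaSeries ha, pd_one_uInv ha]
      push_cast
      module
    · rw [pd_comm, h.pd_eq_zero (k + 1 + 1) (by omega), pd_zero, pd_uInv_of_ne ha (by simp)]
      simp
  have : β = 0 := by
    funext m
    by_cases hm : ∃ k, m (.u (k + 1)) ≠ 0
    · obtain ⟨k, hk⟩ := hm
      exact coeff_eq_zero_of_pd (hβu k) hk
    · push Not at hm
      obtain ⟨g, hg⟩ := uInv_sq_sub_invSq_eq ha
      have h1 : pd (.u 1) A m = 0 := h.coeff_pd_succ 0 fun k hk => by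
        obtain ⟨k, rfl⟩ : ∃ j, k = j + 1 := ⟨k - 1, by omega⟩
        exact hm k
      rw [hβ, series_add_apply, hg, coeff_X_mul_smul _ _ _ (hm 0), h1, add_zero]
      rfl
  rw [hβ] at this
  linear_combination (norm := module) this

/-- Substituting `A = wα + γ`, the compatibility condition becomes `(1 + a₁⁻²u₁²) X = u₁² ∂₀γ`,
where `X = ∂ₓα + [γ,α]` and `∂₀γ` are free of `u₁`. Comparing powers of `u₁` kills both. -/
theorem IsNormalZCR.pd_zero_gammaSeries_and (h : IsNormalZCR a 3 (knRHS e a) 1 A B)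
    (ha : a ∈ knProlongation) :
    pd (.u 0) (gammaSeries a A) = 0 ∧
    pd .x (alphaSeries a A) + ⁅gammaSeries a A, alphaSeries a A⁆ = 0 := by
  have hα := h.pd_u_alphaSeries ha
  have hA1 := h.pd_one_A ha
  have hK := h.order_one_compat ha
  set α := alphaSeries a A with hα'
  set γ := gammaSeries a A with hγ
  have hA : A = wSeries a • α + γ := by rw [hγ, gammaSeries]; abel
  have hγ1 : pd (.u 1) γ = 0 := by
    rw [hγ, gammaSeries, pd_sub, pd_smul, pd_one_wSeries ha, hA1, ← hα', hα 0]
    module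
  have hA0 : pd (.u 0) A = wSeries a • pd (.u 0) α + pd (.u 0) γ := by
    conv_lhs => rw [hA]
    rw [pd_add, pd_smul, pd_wSeries_of_ne ha (by simp), zero_smul, zero_add]
  have hAα : ⁅A, α⁆ = ⁅γ, α⁆ := by
    conv_lhs => rw [hA]
    rw [add_lie, smul_lie, lie_self, smul_zero, zero_add]
  have hu := u_mul_uInv ha
  set X := pd .x α + ⁅γ, α⁆ with hX
  have hD : totalDx a 4 α = X - ⁅γ, α⁆ + coordSeries a (.u 1) • pd (.u 0) α := by
    rw [totalDx_of_pd_u a (by omega) hα, hX]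
    abel
  have t2 : totalDx a 4 (2 : MvPowerSeries Coord ℂ) = 0 := totalDx_ofNat 4 2
  rw [pd_pd_eq_alphaSeries ha, hA1, hA0, lie_smul, lie_smul, ← hα', hAα, totalDx_smul, totalDx_smul,
    hD, totalDx_sub, totalDx_mul, totalDx_pow, totalDx_pow, totalDx_invSq, t2,
    totalDx_uInv ha (by omega)] at hK
  have key : (1 + invSq a * coordSeries a (.u 1) ^ 2) • X =
      (coordSeries a (.u 1) ^ 2) • pd (.u 0) γ := by
    have hK' := congrArg (fun Y => (coordSeries a (.u 1) ^ 3 : MvPowerSeries Coord ℂ) • Y) hK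
    simp only [smul_zero] at hK'
    rw [← sub_eq_zero, ← hK', wSeries]
    generalize coordSeries a (.u 1) = u at *
    generalize coordSeries a (.u 2) = u2 at *
    generalize uInv a = r at *
    generalize invSq a = b at *
    match_scalars <;> grind
  have hX1 : pd (.u 1) X = 0 := by
    rw [hX, pd_add, pd_lie, pd_comm, hα 0, hγ1, pd_zero, zero_lie, lie_zero, add_zero, add_zero]
  -- The derivative by `u₁` extracts the quadratic part, `a₁⁻² X = ∂₀γ`; then `key` leaves `X = 0`.
  have key1 := congrArg (pd (.u 1)) key
  rw [pd_smul, pd_smul, pd_add, pd_mul, pd_one, pd_invSq, pd_pow, hX1, pd_comm, hγ1, pd_zero,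
    pd_coordSeries_self] at key1
  push_cast at key1
  have hb : invSq a • X = pd (.u 0) γ := by
    have := congrArg (fun Y => (MvPowerSeries.C (1 / 2) * uInv a : MvPowerSeries Coord ℂ) • Y) key1
    have h2 := C_half
    simp only [smul_zero, add_zero, smul_smul] at this
    convert this using 1
    · congr 1
      grind
    · rw [show MvPowerSeries.C (1 / 2) * uInv a *
        (2 * coordSeries a (.u 1) ^ 1 * 1) = 1 by grind, one_smul]
  have hX0 : X = 0 := by
    rw [← hb] at key
    linear_combination (norm := module) key
  refine ⟨?_, hX0⟩
  rw [← hb, hX0, smul_zero]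

theorem IsNormalZCR.pd_u_gammaSeries (h : IsNormalZCR a 3 (knRHS e a) 1 A B)
    (ha : a ∈ knProlongation) (k : ℕ) : pd (.u k) (gammaSeries a A) = 0 := by
  rcases k with _ | _ | k
  · exact (h.pd_zero_gammaSeries_and ha).1
  · rw [gammaSeries, pd_sub, pd_smul, zero_add, h.pd_one_A ha, pd_one_wSeries ha,
      h.pd_u_alphaSeries ha 0]
    module
  · rw [gammaSeries, pd_sub, pd_smul, h.pd_u_alphaSeries ha, h.pd_eq_zero _ (by omega),
      pd_wSeries_of_ne ha (by simp)]
    module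

theorem IsNormalZCR.isHorizontal_alphaSeries (h : IsNormalZCR a 3 (knRHS e a) 1 A B)
    (ha : a ∈ knProlongation) : IsHorizontal (gammaSeries a A) (alphaSeries a A) where
  pd_u := h.pd_u_alphaSeries ha
  pd_x := eq_neg_of_add_eq_zero_left (h.pd_zero_gammaSeries_and ha).2

theorem wSeries_smul_apply (ha : a ∈ knProlongation) (f : MvPowerSeries Coord L) {m : Mon}
    (hm : m (.u 1) = 0) : (wSeries a • f) m = (2 * (a (.u 1))⁻¹) • f m := by
  obtain ⟨g, hg⟩ := wSeries_eq ha
  rw [hg, add_smul, series_add_apply, coeff_X_mul_smul _ _ _ hm, C_smul, add_zero]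

theorem IsNormalZCR.gammaSeries_apply (h : IsNormalZCR a 3 (knRHS e a) 1 A B)
    (ha : a ∈ knProlongation) {m : Mon} (hm : ∀ k, m (.u k) = 0) :
    gammaSeries a A m = -(2 * (a (.u 1))⁻¹) • alphaSeries a A m := by
  rw [gammaSeries, series_sub_apply, h.coeff_zero m hm, wSeries_smul_apply ha _ (hm 1), zero_sub,
    neg_smul]

end OrderOne
end
end ZCR

namespace ZCR

open Finset TensorProduct

noncomputable section

/-! ### Order one: the zero-curvature equation as a polynomial in u₁ -/

section Normal

variable {e : Fin 3 → ℂ} {a : Coord → ℂ} {L : Type*} [LieRing L] [LieAlgebra ℂ L]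
  {α γ G : MvPowerSeries Coord L}

/-- The part of `B` that is determined by `α`. -/
def bSeries (e : Fin 3 → ℂ) (a : Coord → ℂ) (α : MvPowerSeries Coord L) : MvPowerSeries Coord L :=
  ((invSq a - uInv a ^ 2) * coordSeries a (.u 3)) • α +
    (2 * uInv a * coordSeries a (.u 2)) • pd (.u 0) α +
    (MvPowerSeries.C (1 / 2) * (uInv a ^ 3 - 3 * invSq a * uInv a) * coordSeries a (.u 2) ^ 2) • α -
    (2 * coordSeries a (.u 1)) • pd (.u 0) (pd (.u 0) α) +
    (2 * (uInv a - invSq a * coordSeries a (.u 1))) • ⁅α, pd (.u 0) α⁆ +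
    (cubic e a * (invSq a * uInv a - MvPowerSeries.C (1 / 3) * uInv a ^ 3)) • α

theorem totalDx_cubic (n : ℕ) (hn : 0 < n) :
    totalDx a n (cubic e a) = coordSeries a (.u 1) * pd (.u 0) (cubic e a) := by
  obtain ⟨n, rfl⟩ : ∃ j, n = j + 1 := ⟨n - 1, by omega⟩
  simp [totalDx, Finset.sum_range_succ', pd_cubic_of_ne, mulSeries_eq_mul]

theorem totalDx_knRHS (ha : a ∈ knProlongation) : totalDx a 4 (knRHS e a) =
    coordSeries a (.u 4 ) - MvPowerSeries.C (3 / 2) * (2 * coordSeries a (.u 2) *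
      coordSeries a (.u 3) * uInv a - coordSeries a (.u 2) ^ 3 * uInv a ^ 2) +
      pd (.u 0) (cubic e a) - cubic e a * coordSeries a (.u 2) * uInv a ^ 2 := by
  have hu := u_mul_uInv ha
  rw [knRHS_eq, totalDx_add, totalDx_sub, totalDx_mul, totalDx_mul, totalDx_mul, totalDx_pow,
    totalDx_C, totalDx_cubic 4 (by omega), totalDx_uInv ha (by omega),
    totalDx_coordSeries_u a (by omega), totalDx_coordSeries_u a (by omega)]
  push_cast
  linear_combination pd (.u 0) (cubic e a) * hu

/-- `bSeries` is chosen so that all dependence on `u₂, u₃, …` cancels. After multiplication by `u₁²`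
a polynomial in `u₁` remains, whose coefficients contain only `α`, `γ`, `G`, their derivatives and
the cubic. -/
theorem zeroCurvature_normal (ha : a ∈ knProlongation) (hα : IsHorizontal γ α)
    (hγ : ∀ k, pd (.u k) γ = 0) (hG : ∀ k, pd (.u (k + 1)) G = 0) :
    (coordSeries a (.u 1) ^ 2 : MvPowerSeries Coord ℂ) •
      (totalDx a 4 (bSeries e a α + G) - totalDt a 3 (knRHS e a) 2 (wSeries a • α + γ) +
        ⁅wSeries a • α + γ, bSeries e a α + G⁆) =
    (coordSeries a (.u 1) ^ 4 : MvPowerSeries Coord ℂ) • ((-2 : MvPowerSeries Coord ℂ) •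
      (pd (.u 0) (pd (.u 0) (pd (.u 0) α)) + (2 * invSq a) • ⁅α, pd (.u 0) (pd (.u 0) α)⁆ +
        (invSq a ^ 2) • ⁅α, ⁅α, pd (.u 0) α⁆⁆)) +
    (coordSeries a (.u 1) ^ 3 : MvPowerSeries Coord ℂ) •
      (pd (.u 0) G + invSq a • (⁅α, G⁆ - pd .t α)) +
    (coordSeries a (.u 1) ^ 2 : MvPowerSeries Coord ℂ) • (pd .x G + ⁅γ, G⁆ - pd .t γ) +
    coordSeries a (.u 1) • (⁅α, G⁆ - pd .t α) +
    ((2 : MvPowerSeries Coord ℂ) • ⁅α, ⁅α, pd (.u 0) α⁆⁆ -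
      (MvPowerSeries.C (4 / 3) * cubic e a) • pd (.u 0) α +
      (MvPowerSeries.C (2 / 3) * pd (.u 0) (cubic e a)) • α) := by
  have hu := u_mul_uInv ha
  have h0 := hα.pd_zero hγ
  have h00 := h0.pd_zero hγ
  have hb := hα.lie h0
  have t2 : totalDx a 4 (2 : MvPowerSeries Coord ℂ) = 0 := totalDx_ofNat 4 2
  have t3 : totalDx a 4 (3 : MvPowerSeries Coord ℂ) = 0 := totalDx_ofNat 4 3
  have tu := totalDx_uInv ha (n := 4) (by omega)
  have tw := totalDx_wSeries ha (n := 4) (by omega)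
  have hb0 : pd (.u 0) ⁅α, pd (.u 0) α⁆ = ⁅α, pd (.u 0) (pd (.u 0) α)⁆ := by
    rw [pd_lie, lie_self, zero_add]
  have hDt : totalDt a 3 (knRHS e a) 2 (wSeries a • α + γ) = wSeries a • pd .t α + pd .t γ +
      (knRHS e a * wSeries a) • pd (.u 0) α +
      (totalDx a 4 (knRHS e a) * (invSq a - uInv a ^ 2)) • α := by
    rw [totalDt, Finset.sum_range_succ, Finset.sum_range_one, mulSeries_eq_smul',
      mulSeries_eq_smul', pd_add, pd_add, pd_add, pd_smul, pd_smul, pd_smul, hγ, hγ, hα.pd_u 0,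
      pd_wSeries_of_ne ha (by simp), pd_wSeries_of_ne ha (by simp), pd_one_wSeries ha]
    simp only [dxPow]
    module
  rw [hDt, totalDx_knRHS ha, knRHS_eq]
  simp only [bSeries, totalDx_add, totalDx_sub, totalDx_smul, totalDx_mul, t2, t3, totalDx_C,
    totalDx_pow, totalDx_invSq, tu, totalDx_cubic 4 (show 0 < 4 by omega),
    totalDx_coordSeries_u a (show 1 < 4 by omega), totalDx_coordSeries_u a (show 2 < 4 by omega),
    totalDx_coordSeries_u a (show 3 < 4 by omega), hα.totalDx a (show 0 < 4 by omega),
    h0.totalDx a (show 0 < 4 by omega), h00.totalDx a (show 0 < 4 by omega),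
    hb.totalDx a (show 0 < 4 by omega), hb0, totalDx_of_pd_u a (show 0 < 4 by omega) hG,
    add_lie, lie_add, lie_sub, smul_lie, lie_smul, lie_self, smul_zero, wSeries]
  have c2 := C_half
  have c3 := C_third
  have c32 : MvPowerSeries.C (3 / 2 : ℂ) = (3 * MvPowerSeries.C (1 / 2) :
      MvPowerSeries Coord ℂ) := by
    rw [← map_ofNat MvPowerSeries.C, ← map_mul]
    norm_num
  have c43 : MvPowerSeries.C (4 / 3 : ℂ) = (4 * MvPowerSeries.C (1 / 3) :
      MvPowerSeries Coord ℂ) := by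
    rw [← map_ofNat MvPowerSeries.C, ← map_mul]
    norm_num
  have c23 : MvPowerSeries.C (2 / 3 : ℂ) = (2 * MvPowerSeries.C (1 / 3) :
      MvPowerSeries Coord ℂ) := by
    rw [← map_ofNat MvPowerSeries.C, ← map_mul]
    norm_num
  rw [c32, c43, c23]
  clear c32 c43 c23 hDt tu tw t2 t3 h0 h00 hb hb0
  simp only [Nat.reduceAdd]
  generalize coordSeries a (.u 1) = u1 at *
  generalize coordSeries a (.u 2) = u2 at *
  generalize coordSeries a (.u 3) = u3 at *
  generalize coordSeries a (.u 4) = u4 at *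
  generalize uInv a = r at *
  generalize invSq a = b at *
  generalize pd (.u 0) (cubic e a) = P' at *
  generalize cubic e a = P at *
  generalize (MvPowerSeries.C (1 / 2 : ℂ) : MvPowerSeries Coord ℂ) = q2 at *
  generalize (MvPowerSeries.C (1 / 3 : ℂ) : MvPowerSeries Coord ℂ) = q3 at *
  match_scalars <;> grind
end Normal
end
end ZCR

namespace ZCR

open Finset TensorProduct

noncomputable section

/-! ### Order one: the reduced equations -/

section Normal

variable {e : Fin 3 → ℂ} {a : Coord → ℂ} {L : Type*} [LieRing L] [LieAlgebra ℂ L]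

/-- Four derivatives by `u₁` give a triangular system, solved from the top coefficient downwards. -/
theorem eq_zero_of_sum_pow {X₀ X₁ X₂ X₃ X₄ : MvPowerSeries Coord L}
    (h : (coordSeries a (.u 1) ^ 4 : MvPowerSeries Coord ℂ) • X₄ +
      (coordSeries a (.u 1) ^ 3 : MvPowerSeries Coord ℂ) • X₃ +
      (coordSeries a (.u 1) ^ 2 : MvPowerSeries Coord ℂ) • X₂ +
      coordSeries a (.u 1) • X₁ + X₀ = 0)
    (h0 : pd (.u 1) X₀ = 0) (h1 : pd (.u 1) X₁ = 0) (h2 : pd (.u 1) X₂ = 0)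
    (h3 : pd (.u 1) X₃ = 0) (h4 : pd (.u 1) X₄ = 0) :
    X₀ = 0 ∧ X₁ = 0 ∧ X₂ = 0 ∧ X₃ = 0 ∧ X₄ = 0 := by
  set u := coordSeries a (.u 1)
  have hu : pd (.u 1) u = 1 := pd_coordSeries_self a _
  have n2 : pd (.u 1) (2 : MvPowerSeries Coord ℂ) = 0 := pd_ofNat _ 2
  have n3 : pd (.u 1) (3 : MvPowerSeries Coord ℂ) = 0 := pd_ofNat _ 3
  have n4 : pd (.u 1) (4 : MvPowerSeries Coord ℂ) = 0 := pd_ofNat _ 4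
  have d1 := congrArg (pd (.u 1)) h
  simp only [pd_add, pd_smul, pd_pow, hu, h0, h1, h2, h3, h4, pd_zero, Nat.reduceAdd,
    Nat.cast_ofNat, smul_zero, add_zero, mul_one, one_smul, pow_one] at d1
  have d2 := congrArg (pd (.u 1)) d1
  simp only [pd_add, pd_smul, pd_pow, pd_mul, n2, n3, n4, hu, h1, h2, h3, h4, pd_zero,
    Nat.reduceAdd, Nat.cast_ofNat, smul_zero, add_zero, mul_one, pow_one, zero_mul, zero_add] at d2
  have d3 := congrArg (pd (.u 1)) d2
  simp only [pd_add, pd_smul, pd_pow, pd_mul, n2, n3, n4, hu, h2, h3, h4, pd_zero,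
    Nat.reduceAdd, Nat.cast_ofNat, smul_zero, add_zero, mul_one, pow_one, zero_mul, zero_smul,
    zero_add] at d3
  have d4 := congrArg (pd (.u 1)) d3
  simp only [pd_add, pd_smul, pd_mul, n2, n3, n4, hu, h3, h4, pd_zero,
    smul_zero, add_zero, mul_one, mul_zero, zero_smul, zero_mul, zero_add] at d4
  have c2 : MvPowerSeries.C (1 / 2 : ℂ) * (2 : MvPowerSeries Coord ℂ) = 1 := by
    rw [mul_comm, C_half]
  have c6 : (MvPowerSeries.C (1 / 6 : ℂ)) * (3 * 2 : MvPowerSeries Coord ℂ) = 1 := by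
    rw [← map_ofNat MvPowerSeries.C 3, ← map_ofNat MvPowerSeries.C 2, ← map_mul, ← map_mul,
      ← map_one MvPowerSeries.C]
    norm_num
  have c24 : (MvPowerSeries.C (1 / 24 : ℂ)) * (4 * (3 * 2) : MvPowerSeries Coord ℂ) = 1 := by
    rw [← map_ofNat MvPowerSeries.C 3, ← map_ofNat MvPowerSeries.C 2,
      ← map_ofNat MvPowerSeries.C 4, ← map_mul, ← map_mul, ← map_mul, ← map_one MvPowerSeries.C]
    norm_num
  have e4 : X₄ = 0 := eq_zero_of_smul_eq_zero c24 d4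
  rw [e4, smul_zero, zero_add] at d3
  have e3 : X₃ = 0 := eq_zero_of_smul_eq_zero c6 d3
  rw [e4, e3, smul_zero, smul_zero, zero_add, zero_add] at d2
  have e2 : X₂ = 0 := eq_zero_of_smul_eq_zero c2 d2
  rw [e4, e3, e2, smul_zero, smul_zero, smul_zero, zero_add, zero_add, zero_add] at d1
  rw [e4, e3, e2, d1, smul_zero, smul_zero, smul_zero, smul_zero, zero_add, zero_add, zero_add,
    zero_add] at h
  exact ⟨h, d1, e2, e3, e4⟩

variable {A B : MvPowerSeries Coord L}

/-- The derivatives of `B` by `u₃`, `u₂`, `u₁` are determined by `A`, hence by `α` and `γ`;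
`bSeries` is their common primitive. -/
theorem IsNormalZCR.pd_u_sub_bSeries (h : IsNormalZCR a 3 (knRHS e a) 1 A B)
    (ha : a ∈ knProlongation) (k : ℕ) :
    pd (.u (k + 1)) (B - bSeries e a (alphaSeries a A)) = 0 := by
  have hA1 := h.pd_one_A ha
  have hα := h.isHorizontal_alphaSeries ha
  have hγ := h.pd_u_gammaSeries ha
  have B2 := h.pd_two_B ha
  have B1 := h.pd_one_B ha
  have hu := u_mul_uInv ha
  set α := alphaSeries a A with hα'
  set γ := gammaSeries a A with hγ'
  have hA : A = wSeries a • α + γ := by rw [hγ', gammaSeries]; abel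
  have h0 := hα.pd_zero hγ
  have h00 := h0.pd_zero hγ
  have hb := hα.lie h0
  have hA0 : pd (.u 0) A = wSeries a • pd (.u 0) α := by
    conv_lhs => rw [hA]
    rw [pd_add, pd_smul, pd_wSeries_of_ne ha (by simp), zero_smul, zero_add, hγ, add_zero]
  have hAα : ⁅A, α⁆ = ⁅γ, α⁆ := by
    conv_lhs => rw [hA]
    rw [add_lie, smul_lie, lie_self, smul_zero, zero_add]
  have hAα0 : ⁅A, pd (.u 0) α⁆ = wSeries a • ⁅α, pd (.u 0) α⁆ + ⁅γ, pd (.u 0) α⁆ := by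
    conv_lhs => rw [hA]
    rw [add_lie, smul_lie]
  have t2 : totalDx a 4 (2 : MvPowerSeries Coord ℂ) = 0 := totalDx_ofNat 4 2
  have t3 : totalDx a 4 (3 : MvPowerSeries Coord ℂ) = 0 := totalDx_ofNat 4 3
  have p2 : ∀ s, pd s (2 : MvPowerSeries Coord ℂ) = 0 := fun s => pd_ofNat _ 2
  have p3 : ∀ s, pd s (3 : MvPowerSeries Coord ℂ) = 0 := fun s => pd_ofNat _ 3
  have B2' : pd (.u 2) B = (2 * uInv a) • pd (.u 0) α +
      (coordSeries a (.u 2) * (uInv a ^ 3 - 3 * invSq a * uInv a)) • α := by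
    rw [B2, hA1, hA0, totalDx_smul, totalDx_sub, totalDx_pow, totalDx_invSq,
      totalDx_uInv ha (by omega), hα.totalDx a (by omega), lie_smul, hAα, wSeries]
    generalize coordSeries a (.u 1) = u1 at *
    generalize coordSeries a (.u 2) = u2 at *
    generalize uInv a = r at *
    generalize invSq a = b at *
    simp only [Nat.reduceAdd]
    clear * - hu
    match_scalars <;> grind
  have B1' : pd (.u 1) B = ((2 * uInv a ^ 3) * coordSeries a (.u 3)) • α -
      (2 * uInv a ^ 2 * coordSeries a (.u 2)) • pd (.u 0) α +
      (MvPowerSeries.C (3 / 2) * (invSq a * uInv a ^ 2 - uInv a ^ 4) * coordSeries a (.u 2) ^ 2) • α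
      - (2 : MvPowerSeries Coord ℂ) • pd (.u 0) (pd (.u 0) α) -
      (2 * (uInv a ^ 2 + invSq a)) • ⁅α, pd (.u 0) α⁆ +
      (cubic e a * (uInv a ^ 4 - invSq a * uInv a ^ 2)) • α := by
    rw [B1, B2', hA1, hA0, pd_one_knRHS e ha]
    simp only [lie_add, lie_smul, hAα, hAα0, totalDx_add, totalDx_smul, totalDx_mul, totalDx_sub,
      totalDx_pow, totalDx_invSq, totalDx_uInv ha (show 1 < 4 by omega), t2, t3,
      totalDx_coordSeries_u a (show 2 < 4 by omega),
      hα.totalDx a (show 0 < 4 by omega), h0.totalDx a (show 0 < 4 by omega), wSeries]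
    have c32 := C_three_half
    generalize coordSeries a (.u 1) = u1 at *
    generalize coordSeries a (.u 2) = u2 at *
    generalize coordSeries a (.u 3) = u3 at *
    generalize uInv a = r at *
    generalize invSq a = b at *
    generalize (MvPowerSeries.C (3 / 2 : ℂ) : MvPowerSeries Coord ℂ) = q32 at *
    simp only [Nat.reduceAdd]
    clear * - hu c32
    match_scalars <;> grind
  have hP : pd (.u (k + 1)) (cubic e a) = 0 := pd_cubic_of_ne e a (by simp)
  rw [pd_sub, sub_eq_zero]
  rcases k with _ | _ | _ | k
  · have c32 : MvPowerSeries.C (3 / 2 : ℂ) = (3 * MvPowerSeries.C (1 / 2) :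
        MvPowerSeries Coord ℂ) := by
      rw [← map_ofNat MvPowerSeries.C, ← map_mul]
      norm_num
    have c3 := C_third
    rw [zero_add, B1']
    simp only [bSeries, pd_add, pd_sub, pd_smul, pd_mul, pd_pow, pd_C, pd_invSq, pd_one_uInv ha,
      pd_u_coordSeries, p2, p3, hα.pd_u 0, h0.pd_u 0, h00.pd_u 0, hb.pd_u 0, hP, c32]
    simp only [show (1 : ℕ) ≠ 3 by omega, show (1 : ℕ) ≠ 2 by omega, if_true, if_false]
    generalize coordSeries a (.u 1) = u1 at *
    generalize coordSeries a (.u 2) = u2 at *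
    generalize coordSeries a (.u 3) = u3 at *
    generalize uInv a = r at *
    generalize invSq a = b at *
    generalize cubic e a = P at *
    generalize (MvPowerSeries.C (1 / 2 : ℂ) : MvPowerSeries Coord ℂ) = q2 at *
    generalize (MvPowerSeries.C (1 / 3 : ℂ) : MvPowerSeries Coord ℂ) = q3 at *
    simp only [Nat.reduceAdd]
    clear * - hu c3
    match_scalars <;> grind
  · have c2 := C_half
    rw [show 0 + 1 + 1 = 2 by rfl] at hP ⊢
    rw [B2']
    simp only [bSeries, pd_add, pd_sub, pd_smul, pd_mul, pd_pow, pd_C, pd_invSq,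
      pd_uInv_of_ne ha (show Coord.u 2 ≠ .u 1 by simp),
      pd_u_coordSeries, p2, p3, hα.pd_u 1, h0.pd_u 1, h00.pd_u 1, hb.pd_u 1, hP]
    simp only [show (2 : ℕ) ≠ 3 by omega, show (2 : ℕ) ≠ 1 by omega, if_true, if_false]
    generalize (MvPowerSeries.C (1 / 2 : ℂ) : MvPowerSeries Coord ℂ) = q2 at *
    simp only [Nat.reduceAdd]
    clear * - hu c2
    match_scalars <;> grind
  · rw [show 0 + 1 + 1 + 1 = 1 + 2 by rfl, h.pd_B_top (isThirdOrder_knRHS e ha), hA1]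
    rw [show 0 + 1 + 1 + 1 = 3 by rfl] at hP
    simp only [bSeries, pd_add, pd_sub, pd_smul, pd_mul, pd_pow, pd_C, pd_invSq,
      pd_uInv_of_ne ha (show Coord.u 3 ≠ .u 1 by simp), Nat.reduceAdd,
      pd_u_coordSeries, p2, p3, hα.pd_u 2, h0.pd_u 2, h00.pd_u 2, hb.pd_u 2, hP]
    simp only [show (3 : ℕ) ≠ 2 by omega, show (3 : ℕ) ≠ 1 by omega, if_true, if_false]
    module
  · rw [h.pd_B _ (by omega)]
    simp only [bSeries, pd_add, pd_sub, pd_smul, pd_mul, pd_pow, pd_C, pd_invSq,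
      pd_uInv_of_ne ha (show Coord.u (k + 1 + 1 + 1 + 1) ≠ .u 1 by simp),
      pd_u_coordSeries, p2, p3, hα.pd_u, h0.pd_u, h00.pd_u, hb.pd_u, hP]
    simp only [show k + 1 + 1 + 1 + 1 ≠ 3 by omega, show k + 1 + 1 + 1 + 1 ≠ 2 by omega,
      show k + 1 + 1 + 1 + 1 ≠ 1 by omega, if_false]
    module
/-- The equations for the series `α`, `γ`, `G` that make `A = wα + γ` and `B = bSeries α + G` a
zero-curvature representation. -/
structure IsReducedZCR (e : Fin 3 → ℂ) (a : Coord → ℂ) (α γ G : MvPowerSeries Coord L) : Prop where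
  horizontal : IsHorizontal γ α
  pd_u_γ : ∀ k, pd (.u k) γ = 0
  pd_u_G : ∀ k, pd (.u (k + 1)) G = 0
  lie_lie : (2 : MvPowerSeries Coord ℂ) • ⁅α, ⁅α, pd (.u 0) α⁆⁆ -
      (MvPowerSeries.C (4 / 3) * cubic e a) • pd (.u 0) α +
      (MvPowerSeries.C (2 / 3) * pd (.u 0) (cubic e a)) • α = 0
  pd_t : ⁅α, G⁆ - pd .t α = 0
  pd_x_G : pd .x G + ⁅γ, G⁆ - pd .t γ = 0
  pd_zero_G : pd (.u 0) G = 0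
  pd_three : pd (.u 0) (pd (.u 0) (pd (.u 0) α)) + (2 * invSq a) • ⁅α, pd (.u 0) (pd (.u 0) α)⁆ +
      (invSq a ^ 2) • ⁅α, ⁅α, pd (.u 0) α⁆⁆ = 0

theorem IsReducedZCR.zcr {α γ G : MvPowerSeries Coord L} (h : IsReducedZCR e a α γ G)
    (ha : a ∈ knProlongation) :
    totalDx a 4 (bSeries e a α + G) - totalDt a 3 (knRHS e a) 2 (wSeries a • α + γ) +
      ⁅wSeries a • α + γ, bSeries e a α + G⁆ = 0 := by
  have h1 := zeroCurvature_normal (e := e) ha h.horizontal h.pd_u_γ h.pd_u_G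
  rw [h.lie_lie, h.pd_t, h.pd_x_G, h.pd_zero_G, h.pd_three] at h1
  simp only [smul_zero, add_zero] at h1
  exact eq_zero_of_smul_eq_zero (g := uInv a ^ 2)
    (by rw [← mul_pow, mul_comm, u_mul_uInv ha, one_pow]) h1

theorem IsNormalZCR.isReducedZCR (h : IsNormalZCR a 3 (knRHS e a) 1 A B)
    (ha : a ∈ knProlongation) : IsReducedZCR e a (alphaSeries a A) (gammaSeries a A)
      (B - bSeries e a (alphaSeries a A)) := by
  have hα := h.isHorizontal_alphaSeries ha
  have hγ := h.pd_u_gammaSeries ha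
  have hG := h.pd_u_sub_bSeries ha
  have hA : wSeries a • alphaSeries a A + gammaSeries a A = A := by rw [gammaSeries]; abel
  have h1 := zeroCurvature_normal (e := e) ha hα hγ hG
  rw [hA, add_sub_cancel] at h1
  have h2 : totalDx a 4 B - totalDt a 3 (knRHS e a) 2 A + ⁅A, B⁆ = 0 := h.zcr
  rw [h2, smul_zero] at h1
  set α := alphaSeries a A
  set γ := gammaSeries a A
  set G := B - bSeries e a α
  have h0 := hα.pd_zero hγ
  have h00 := h0.pd_zero hγ
  have h000 := h00.pd_zero hγ
  have hP : pd (.u 1) (cubic e a) = 0 := pd_cubic_of_ne e a (by simp)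
  have q : pd (.u 1) ⁅α, ⁅α, pd (.u 0) α⁆⁆ = 0 := (hα.lie (hα.lie h0)).pd_u 0
  have q2 : pd (.u 1) ⁅α, pd (.u 0) (pd (.u 0) α)⁆ = 0 := (hα.lie h00).pd_u 0
  have q3 : pd (.u 1) (pd (.u 0) α) = 0 := h0.pd_u 0
  have q4 : pd (.u 1) (pd (.u 0) (pd (.u 0) (pd (.u 0) α))) = 0 := h000.pd_u 0
  have q5 : pd (.u 1) α = 0 := hα.pd_u 0
  have q6 : pd (.u 1) G = 0 := hG 0
  have q7 : ∀ s, pd (.u 1) (pd s γ) = 0 := fun s => by rw [pd_comm, hγ, pd_zero]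
  have q8 : ∀ s, pd (.u 1) (pd s G) = 0 := fun s => by rw [pd_comm, q6, pd_zero]
  have q9 : ∀ s, pd (.u 1) (pd s α) = 0 := fun s => by rw [pd_comm, q5, pd_zero]
  have n2 : pd (.u 1) (2 : MvPowerSeries Coord ℂ) = 0 := pd_ofNat _ 2
  obtain ⟨e0, e1, e2, e3, e4⟩ := eq_zero_of_sum_pow h1.symm
    (by simp only [pd_add, pd_sub, pd_smul, pd_mul, pd_C, hP, pd_comm (.u 1) (.u 0) (cubic e a),
          ZCR.pd_zero, q, q3, q5, n2]; simp)
    (by simp only [pd_sub, pd_lie, q5, q6, q9]; simp)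
    (by simp only [pd_add, pd_sub, pd_lie, hγ 1, q6, q7, q8]; simp)
    (by simp only [pd_add, pd_sub, pd_lie, pd_smul, pd_invSq, q5, q6, q8, q9]; simp)
    (by simp only [pd_add, pd_smul, pd_mul, pd_pow, pd_invSq, pd_neg, q, q2, q4, n2]; simp)
  refine ⟨hα, hγ, hG, e0, e1, e2, ?_, ?_⟩
  -- The linear coefficient `[α,G] - ∂_t α` recurs in the cubic one, where only `∂₀G` remains.
  · rwa [e1, smul_zero, add_zero] at e3
  · refine eq_zero_of_smul_eq_zero (g := -MvPowerSeries.C (1 / 2)) ?_ e4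
    rw [neg_mul_neg, mul_comm, C_half]

end Normal
end
end ZCR

namespace ZCR

open Finset TensorProduct

noncomputable section

/-! ### Three generators of the order-one algebra -/

section Generation

variable {L : Type*} [LieRing L] [LieAlgebra ℂ L] {S : LieSubalgebra ℂ L}
  {f g : MvPowerSeries Coord L} {m : Mon}

theorem lie_apply_mem (hf : ∀ q ≤ m, f q ∈ S) (hg : ∀ q ≤ m, g q ∈ S) : ⁅f, g⁆ m ∈ S := by
  refine sum_mem fun q hq => ?_
  rw [HasAntidiagonal.mem_antidiagonal] at hq
  exact S.lie_mem (hf _ (hq ▸ le_self_add)) (hg _ (hq ▸ le_add_self))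

theorem smul_apply_mem (c : MvPowerSeries Coord ℂ) (hg : ∀ q ≤ m, g q ∈ S) : (c • g) m ∈ S := by
  refine sum_mem fun q hq => ?_
  rw [HasAntidiagonal.mem_antidiagonal] at hq
  exact S.smul_mem _ (hg _ (hq ▸ le_add_self))

theorem pd_apply_mem {s : Coord} (h : f (m + Finsupp.single s 1) ∈ S) : pd s f m ∈ S :=
  S.toSubmodule.smul_of_tower_mem _ h

theorem apply_mem_of_pd {s : Coord} (hm : m s ≠ 0) (h : pd s f (m - Finsupp.single s 1) ∈ S) :
    f m ∈ S := by
  have hle : Finsupp.single s 1 ≤ m := by rw [Finsupp.single_le_iff]; omega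
  rw [coeff_pd, tsub_add_cancel_of_le hle, ← Nat.cast_smul_eq_nsmul ℂ] at h
  exact (S.toSubmodule.smul_mem_iff (Nat.cast_ne_zero.mpr (Nat.succ_ne_zero _))).mp h

variable {e : Fin 3 → ℂ} {a : Coord → ℂ} {α γ G : MvPowerSeries Coord L}

/-- On `x = x_a`, `t = t_a` the equation `pd_three` expresses `∂₀³α` by lower derivatives, so three
initial values generate the coefficients. -/
theorem IsReducedZCR.alpha_mem_of_x_t_eq_zero (h : IsReducedZCR e a α γ G)
    (h0 : α 0 ∈ S) (h1 : pd (.u 0) α 0 ∈ S) (h2 : pd (.u 0) (pd (.u 0) α) 0 ∈ S) (n : ℕ) :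
    ∀ m : Mon, m .x = 0 → m .t = 0 → m (.u 0) = n → α m ∈ S := by
  induction n using Nat.strong_induction_on with
  | _ n ih =>
  intro m hx ht hn
  by_cases hm : ∃ k, m (.u (k + 1)) ≠ 0
  · obtain ⟨k, hk⟩ := hm
    rw [coeff_eq_zero_of_pd (h.horizontal.pd_u k) hk]
    exact zero_mem S
  push Not at hm
  have hm0 : ∀ j, (m - Finsupp.single (.u 0) j : Mon) (.u 0) = n - j := fun j => by simp [hn]
  have hz : n ≤ 2 → (m - Finsupp.single (.u 0) n : Mon) = 0 := by
    intro _
    ext c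
    cases c with
    | x => simp [hx]
    | t => simp [ht]
    | u k =>
      rcases k with _ | k
      · simp [hn]
      · simp [hm k]
  have hsub : ∀ i j, (m - Finsupp.single (.u 0) i - Finsupp.single (.u 0) j : Mon) =
      m - Finsupp.single (.u 0) (i + j) := fun i j => by rw [tsub_tsub, ← Finsupp.single_add]
  rcases Nat.lt_or_ge n 3 with h3 | h3
  · interval_cases n
    · have := hz (by omega)
      rw [Finsupp.single_zero, tsub_zero] at this
      rwa [this]
    · exact apply_mem_of_pd (s := .u 0) (by omega) (by rwa [hz (by omega)])
    · refine apply_mem_of_pd (s := .u 0) (by omega) (apply_mem_of_pd (s := .u 0) ?_ ?_)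
      · rw [hm0]; omega
      · rwa [hsub, hz (by omega)]
  refine apply_mem_of_pd (s := .u 0) (by omega) (apply_mem_of_pd (s := .u 0) (by rw [hm0]; omega)
    (apply_mem_of_pd (s := .u 0) (by rw [hsub, hm0]; omega) ?_))
  rw [hsub, hsub]
  have hα : ∀ j ≤ 2, ∀ q ≤ (m - Finsupp.single (.u 0) (1 + 1 + 1) : Mon),
      α (q + Finsupp.single (.u 0) j) ∈ S := by
    intro j hj q hq
    have hqx := hq .x
    have hqt := hq .t
    have hqu := hq (.u 0)
    rw [hm0] at hqu
    simp only [Finsupp.tsub_apply, hx, ht, zero_tsub] at hqx hqt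
    refine ih (q (.u 0) + j) (by omega) _ ?_ ?_ ?_
    · simp; omega
    · simp; omega
    · simp
  have hα0 : ∀ q ≤ (m - Finsupp.single (.u 0) (1 + 1 + 1) : Mon), α q ∈ S := fun q hq => by
    simpa using hα 0 (by omega) q hq
  have hα1 : ∀ q ≤ (m - Finsupp.single (.u 0) (1 + 1 + 1) : Mon), pd (.u 0) α q ∈ S :=
    fun q hq => pd_apply_mem (hα 1 (by omega) q hq)
  have hα2 : ∀ q ≤ (m - Finsupp.single (.u 0) (1 + 1 + 1) : Mon),
      pd (.u 0) (pd (.u 0) α) q ∈ S := fun q hq => pd_apply_mem (pd_apply_mem (by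
    rw [add_assoc, ← Finsupp.single_add]
    exact hα 2 (by omega) q hq))
  have key : pd (.u 0) (pd (.u 0) (pd (.u 0) α)) = -((2 * invSq a) •
      ⁅α, pd (.u 0) (pd (.u 0) α)⁆ + (invSq a ^ 2) • ⁅α, ⁅α, pd (.u 0) α⁆⁆) := by
    linear_combination (norm := module) h.pd_three
  rw [key]
  refine neg_mem (add_mem (smul_apply_mem _ fun q hq => ?_) (smul_apply_mem _ fun q hq => ?_))
  · exact lie_apply_mem (fun r hr => hα0 r (hr.trans hq)) fun r hr => hα2 r (hr.trans hq)
  · exact lie_apply_mem (fun r hr => hα0 r (hr.trans hq)) fun r hr =>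
      lie_apply_mem (fun s hs => hα0 s (hs.trans (hr.trans hq))) fun s hs =>
        hα1 s (hs.trans (hr.trans hq))

variable {A B : MvPowerSeries Coord L}

/-- Since `A` vanishes at `u = a`, there `γ` is a constant multiple of `α`. So `∂_t α = [α,G]` gives
`∂_t γ = [γ,G]`, and the equation for `∂ₓG` collapses. -/
theorem IsNormalZCR.pd_x_sub_bSeries (h : IsNormalZCR a 3 (knRHS e a) 1 A B)
    (ha : a ∈ knProlongation) : pd .x (B - bSeries e a (alphaSeries a A)) = 0 := by
  have hr := h.isReducedZCR ha
  set G := B - bSeries e a (alphaSeries a A)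
  funext m
  by_cases hm : ∃ k, m (.u k) ≠ 0
  · obtain ⟨k, hk⟩ := hm
    refine coeff_eq_zero_of_pd (s := .u k) ?_ hk
    rcases k with _ | k
    · rw [pd_comm, hr.pd_zero_G, pd_zero]
    · rw [pd_comm, hr.pd_u_G, pd_zero]
  push Not at hm
  have hmt : ∀ k, (m + Finsupp.single .t 1 : Mon) (.u k) = 0 := fun k => by simp [hm k]
  have h1 : pd .t (gammaSeries a A) m = ⁅gammaSeries a A, G⁆ m := by
    have h2 : pd .t (alphaSeries a A) m = ⁅alphaSeries a A, G⁆ m := by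
      rw [sub_eq_zero.mp hr.pd_t]
    rw [coeff_pd] at h2
    rw [coeff_pd, h.gammaSeries_apply ha hmt, smul_comm, h2, coeff_lie, coeff_lie,
      Finset.smul_sum]
    refine Finset.sum_congr rfl fun q hq => ?_
    rw [HasAntidiagonal.mem_antidiagonal] at hq
    rw [h.gammaSeries_apply ha (m := q.1), smul_lie]
    intro k
    have := hm k
    rw [← hq, Finsupp.add_apply] at this
    omega
  have h3 := congrFun hr.pd_x_G m
  have h4 : pd .x G m + ⁅gammaSeries a A, G⁆ m - pd .t (gammaSeries a A) m = 0 := h3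
  rwa [h1, add_sub_cancel_right] at h4

/-- Propagate from `u₀` to `x` by `∂ₓα = -[γ,α]`, and then to `t` by `∂_t α = [α,G]`. Both `γ` and
`G` are expressed by `α` through the normalization of `A` and `B`. -/
theorem IsNormalZCR.vals_of_mem (h : IsNormalZCR a 3 (knRHS e a) 1 A B) (ha : a ∈ knProlongation)
    (h0 : alphaSeries a A 0 ∈ S) (h1 : pd (.u 0) (alphaSeries a A) 0 ∈ S)
    (h2 : pd (.u 0) (pd (.u 0) (alphaSeries a A)) 0 ∈ S) : Vals S.toSubmodule A := by
  have hr := h.isReducedZCR ha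
  have hGx := h.pd_x_sub_bSeries ha
  have hγα : ∀ q : Mon, (∀ r ≤ q, alphaSeries a A r ∈ S) → ∀ r ≤ q, gammaSeries a A r ∈ S := by
    intro q hq r hrq
    by_cases hm : ∃ k, r (.u k) ≠ 0
    · obtain ⟨k, hk⟩ := hm
      rw [coeff_eq_zero_of_pd (hr.pd_u_γ k) hk]
      exact zero_mem S
    · push Not at hm
      rw [h.gammaSeries_apply ha hm]
      exact S.smul_mem _ (hq r hrq)
  have hB : ∀ m : Mon, B m = bSeries e a (alphaSeries a A) m +
      (B - bSeries e a (alphaSeries a A)) m := fun m => by rw [series_sub_apply]; abel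
  have hA : A = wSeries a • alphaSeries a A + gammaSeries a A := by rw [gammaSeries]; abel
  set α := alphaSeries a A
  set γ := gammaSeries a A
  set G := B - bSeries e a α
  have base := hr.alpha_mem_of_x_t_eq_zero h0 h1 h2
  have stepx : ∀ (n : ℕ) (m : Mon), m .t = 0 → m .x = n → α m ∈ S := by
    intro n
    induction n using Nat.strong_induction_on with
    | _ n ih =>
    intro m ht hx
    rcases Nat.eq_zero_or_pos n with hn | hn
    · exact base _ m (hx.trans hn) ht rfl
    refine apply_mem_of_pd (s := .x) (by omega) ?_
    rw [hr.horizontal.pd_x]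
    have hq : ∀ q ≤ (m - Finsupp.single .x 1 : Mon), α q ∈ S := by
      intro q hq
      have hqx := hq .x
      have hqt := hq .t
      simp only [Finsupp.tsub_apply, hx, ht, zero_tsub, Finsupp.single_eq_same] at hqx hqt
      exact ih (q .x) (by omega) q (by omega) rfl
    exact neg_mem (lie_apply_mem (hγα _ hq) hq)
  have stept : ∀ (n : ℕ) (m : Mon), m .t = n → α m ∈ S := by
    intro n
    induction n using Nat.strong_induction_on with
    | _ n ih =>
    intro m ht
    rcases Nat.eq_zero_or_pos n with hn | hn
    · exact stepx _ m (ht.trans hn) rfl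
    refine apply_mem_of_pd (s := .t) (by omega) ?_
    rw [← sub_eq_zero.mp hr.pd_t]
    have hq : ∀ q ≤ (m - Finsupp.single .t 1 : Mon), ∀ r : Mon, r .t = 0 → α (q + r) ∈ S := by
      intro q hq r hrt
      have hqt := hq .t
      simp only [Finsupp.tsub_apply, ht, Finsupp.single_eq_same] at hqt
      exact ih ((q + r : Mon) .t) (by rw [Finsupp.add_apply]; omega) _ rfl
    have hα0 : ∀ q ≤ (m - Finsupp.single .t 1 : Mon), α q ∈ S := fun q hq' => by
      simpa using hq q hq' 0 rfl
    have hα1 : ∀ q ≤ (m - Finsupp.single .t 1 : Mon), pd (.u 0) α q ∈ S :=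
      fun q hq' => pd_apply_mem (hq q hq' _ (by simp))
    have hα2 : ∀ q ≤ (m - Finsupp.single .t 1 : Mon), pd (.u 0) (pd (.u 0) α) q ∈ S :=
      fun q hq' => pd_apply_mem (pd_apply_mem (by
        rw [add_assoc]
        exact hq q hq' _ (by simp)))
    refine lie_apply_mem hα0 fun q hq' => ?_
    by_cases hm : ∃ k, q (.u k) ≠ 0
    · obtain ⟨k, hk⟩ := hm
      have : pd (.u k) G = 0 := by
        rcases k with _ | k
        · exact hr.pd_zero_G
        · exact hr.pd_u_G k
      rw [coeff_eq_zero_of_pd this hk]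
      exact zero_mem S
    push Not at hm
    -- `G` depends on `t` only. Its coefficients there are those of `-bSeries`, because `B` has no
    -- terms in `t` alone.
    by_cases hx : q .x = 0
    · have h4 := hB q
      rw [h.coeff_B q hx hm] at h4
      rw [eq_neg_of_add_eq_zero_right h4.symm]
      have k0 : ∀ c : MvPowerSeries Coord ℂ, (c • α) q ∈ S := fun c =>
        smul_apply_mem c fun r hr => hα0 r (hr.trans hq')
      have k1 : ∀ c : MvPowerSeries Coord ℂ, (c • pd (.u 0) α) q ∈ S := fun c =>
        smul_apply_mem c fun r hr => hα1 r (hr.trans hq')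
      have k2 : ∀ c : MvPowerSeries Coord ℂ, (c • pd (.u 0) (pd (.u 0) α)) q ∈ S := fun c =>
        smul_apply_mem c fun r hr => hα2 r (hr.trans hq')
      have k3 : ∀ c : MvPowerSeries Coord ℂ, (c • ⁅α, pd (.u 0) α⁆) q ∈ S := fun c =>
        smul_apply_mem c fun r hr => lie_apply_mem
          (fun s hs => hα0 s (hs.trans (hr.trans hq'))) fun s hs => hα1 s (hs.trans (hr.trans hq'))
      exact neg_mem (add_mem (add_mem (sub_mem (add_mem (add_mem (k0 _) (k1 _)) (k0 _)) (k2 _))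
        (k3 _)) (k0 _))
    · rw [coeff_eq_zero_of_pd hGx hx]
      exact zero_mem S
  have hα : ∀ m, α m ∈ S := fun m => stept _ m rfl
  intro m
  rw [hA]
  exact add_mem (smul_apply_mem _ fun q _ => hα q) (hγα m (fun r _ => hα r) m le_rfl)

end Generation
end
end ZCR

namespace ZCR

open Finset TensorProduct

noncomputable section

/-! ### Quadratic solutions and the elliptic relations -/

section Quadratic

variable {L : Type*} [LieRing L] [LieAlgebra ℂ L]

/-- Finite differences of the values at `0, ±1, ±2`. -/
theorem coeff_eq_zero_of_forall_eval {c₀ c₁ c₂ c₃ c₄ : L}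
    (h : ∀ z : ℂ, c₀ + z • c₁ + z ^ 2 • c₂ + z ^ 3 • c₃ + z ^ 4 • c₄ = 0) : c₃ = 0 ∧ c₄ = 0 := by
  have h0 := h 0
  have h1 := h 1
  have h2 := h (-1)
  have h3 := h 2
  have h4 := h (-2)
  constructor
  · linear_combination (norm := module) (1 / 12 : ℂ) • (h3 - h4) - (1 / 6 : ℂ) • (h1 - h2)
  · linear_combination (norm := module) (1 / 24 : ℂ) • (h3 + h4) - (1 / 6 : ℂ) • (h1 + h2) +
      (1 / 4 : ℂ) • h0

/-- The quadratic polynomial `(z - e₁)² - (e₁ - e₂)(e₁ - e₃)`. -/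
def quad {R : Type*} [CommRing R] (e₁ e₂ e₃ z : R) : R := (z - e₁) ^ 2 - (e₁ - e₂) * (e₁ - e₃)

/-- The Wronskian of two of the quadratics is `-2` times a difference of roots times the third one.
-/
theorem lie_quad {R V : Type*} [CommRing R] [LieRing V] [LieAlgebra R V] (e₁ e₂ e₃ z : R)
    (p₁ p₂ p₃ : V) :
    ⁅quad e₁ e₂ e₃ z • p₁ + quad e₂ e₃ e₁ z • p₂ + quad e₃ e₁ e₂ z • p₃,
      (2 * (z - e₁)) • p₁ + (2 * (z - e₂)) • p₂ + (2 * (z - e₃)) • p₃⁆ =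
    quad e₁ e₂ e₃ z • (-2 * (e₂ - e₃)) • ⁅p₂, p₃⁆ + quad e₂ e₃ e₁ z • (-2 * (e₃ - e₁)) • ⁅p₃, p₁⁆ +
      quad e₃ e₁ e₂ z • (-2 * (e₁ - e₂)) • ⁅p₁, p₂⁆ := by
  simp only [lie_add, add_lie, smul_lie, lie_smul, lie_self]
  rw [← lie_skew p₁ p₂, ← lie_skew p₃ p₁, ← lie_skew p₂ p₃]
  simp only [quad]
  module

/-- The relations between the coefficients of a solution `α` of the differential equation
`[α,[α,α']] = ⅔Pα' - ⅓P'α` that is quadratic in `z`. -/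
theorem relations_of_quad {e₁ e₂ e₃ : ℂ} (h₁₂ : e₁ ≠ e₂) (h₂₃ : e₂ ≠ e₃) (h₃₁ : e₃ ≠ e₁)
    {p₁ p₂ p₃ : L}
    (h : ∀ z : ℂ, ⁅quad e₁ e₂ e₃ z • p₁ + quad e₂ e₃ e₁ z • p₂ + quad e₃ e₁ e₂ z • p₃,
      ⁅quad e₁ e₂ e₃ z • p₁ + quad e₂ e₃ e₁ z • p₂ + quad e₃ e₁ e₂ z • p₃,
      (2 * (z - e₁)) • p₁ + (2 * (z - e₂)) • p₂ + (2 * (z - e₃)) • p₃⁆⁆ =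
      (2 / 3 * ((z - e₁) * (z - e₂) * (z - e₃))) •
        ((2 * (z - e₁)) • p₁ + (2 * (z - e₂)) • p₂ + (2 * (z - e₃)) • p₃) -
      (1 / 3 * ((z - e₁) * (z - e₂) + (z - e₂) * (z - e₃) + (z - e₃) * (z - e₁))) •
        (quad e₁ e₂ e₃ z • p₁ + quad e₂ e₃ e₁ z • p₂ + quad e₃ e₁ e₂ z • p₃)) :
    (⁅p₁, ⁅p₂, p₃⁆⁆ = 0 ∧ ⁅p₂, ⁅p₃, p₁⁆⁆ = 0 ∧ ⁅p₃, ⁅p₁, p₂⁆⁆ = 0) ∧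
    (-2 * (e₁ - e₂)) • ⁅p₂, ⁅p₁, p₂⁆⁆ + (-2 * (e₃ - e₁)) • ⁅p₃, ⁅p₃, p₁⁆⁆ = (1 / 3 : ℂ) • p₁ ∧
    (-2 * (e₂ - e₃)) • ⁅p₃, ⁅p₂, p₃⁆⁆ + (-2 * (e₁ - e₂)) • ⁅p₁, ⁅p₁, p₂⁆⁆ = (1 / 3 : ℂ) • p₂ ∧
    (-2 * (e₃ - e₁)) • ⁅p₁, ⁅p₃, p₁⁆⁆ + (-2 * (e₂ - e₃)) • ⁅p₂, ⁅p₂, p₃⁆⁆ = (1 / 3 : ℂ) • p₃ := by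
  have jac := lie_jacobi p₁ p₂ p₃
  set t₁ := ⁅p₁, ⁅p₂, p₃⁆⁆ with ht₁
  set t₂ := ⁅p₂, ⁅p₃, p₁⁆⁆ with ht₂
  set t₃ := ⁅p₃, ⁅p₁, p₂⁆⁆ with ht₃
  set V₁ := (-2 * (e₁ - e₂)) • ⁅p₂, ⁅p₁, p₂⁆⁆ + (-2 * (e₃ - e₁)) • ⁅p₃, ⁅p₃, p₁⁆⁆ -
    (1 / 3 : ℂ) • p₁ with hV₁
  set V₂ := (-2 * (e₂ - e₃)) • ⁅p₃, ⁅p₂, p₃⁆⁆ + (-2 * (e₁ - e₂)) • ⁅p₁, ⁅p₁, p₂⁆⁆ -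
    (1 / 3 : ℂ) • p₂ with hV₂
  set V₃ := (-2 * (e₃ - e₁)) • ⁅p₁, ⁅p₃, p₁⁆⁆ + (-2 * (e₂ - e₃)) • ⁅p₂, ⁅p₂, p₃⁆⁆ -
    (1 / 3 : ℂ) • p₃ with hV₃
  -- The identity `Q_j Q_k = 4P(z - e_i) - P' Q_i` for the three quadratics turns the right-hand
  -- side into products of two quadratics, so that everything is expressed by the `t_i` and the
  -- defects `V_i`.
  have key : ∀ z : ℂ, (quad e₁ e₂ e₃ z ^ 2 * (-2 * (e₂ - e₃))) • t₁ +
      (quad e₂ e₃ e₁ z ^ 2 * (-2 * (e₃ - e₁))) • t₂ +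
      (quad e₃ e₁ e₂ z ^ 2 * (-2 * (e₁ - e₂))) • t₃ +
      (quad e₂ e₃ e₁ z * quad e₃ e₁ e₂ z) • V₁ + (quad e₃ e₁ e₂ z * quad e₁ e₂ e₃ z) • V₂ +
      (quad e₁ e₂ e₃ z * quad e₂ e₃ e₁ z) • V₃ = 0 := by
    intro z
    have hz := h z
    rw [lie_quad] at hz
    simp only [lie_add, add_lie, smul_lie, lie_smul] at hz
    rw [← ht₁, ← ht₂, ← ht₃] at hz
    have e1 : ∀ e₁ e₂ e₃ z : ℂ, quad e₂ e₃ e₁ z * quad e₃ e₁ e₂ z =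
        3 * (2 / 3 * ((z - e₁) * (z - e₂) * (z - e₃)) * (2 * (z - e₁)) -
        1 / 3 * ((z - e₁) * (z - e₂) + (z - e₂) * (z - e₃) + (z - e₃) * (z - e₁)) *
        quad e₁ e₂ e₃ z) := by
      intro e₁ e₂ e₃ z
      simp only [quad]
      ring
    rw [hV₁, hV₂, hV₃]
    simp only [smul_sub, smul_smul]
    rw [show quad e₂ e₃ e₁ z * quad e₃ e₁ e₂ z * (1 / 3) = _ from
        congrArg (· * (1 / 3 : ℂ)) (e1 e₁ e₂ e₃ z),
      show quad e₃ e₁ e₂ z * quad e₁ e₂ e₃ z * (1 / 3) = _ from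
        congrArg (· * (1 / 3 : ℂ)) (e1 e₂ e₃ e₁ z),
      show quad e₁ e₂ e₃ z * quad e₂ e₃ e₁ z * (1 / 3) = _ from
        congrArg (· * (1 / 3 : ℂ)) (e1 e₃ e₁ e₂ z)]
    linear_combination (norm := module) hz
  have hd₁ : (e₁ - e₂) * (e₁ - e₃) ≠ 0 := mul_ne_zero (sub_ne_zero.mpr h₁₂)
    (sub_ne_zero.mpr h₃₁.symm)
  have hd₂ : (e₂ - e₃) * (e₂ - e₁) ≠ 0 := mul_ne_zero (sub_ne_zero.mpr h₂₃)
    (sub_ne_zero.mpr h₁₂.symm)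
  have hd₃ : (e₃ - e₁) * (e₃ - e₂) ≠ 0 := mul_ne_zero (sub_ne_zero.mpr h₃₁)
    (sub_ne_zero.mpr h₂₃.symm)
  set T := (-2 * (e₂ - e₃)) • t₁ + (-2 * (e₃ - e₁)) • t₂ + (-2 * (e₁ - e₂)) • t₃ with hT
  -- At `z = e₁` the quadratics take the values `-d, d, d` with `d = (e₁ - e₂)(e₁ - e₃)`; the other
  -- two roots are analogous.
  have k1 : T + V₁ - V₂ - V₃ = 0 := by
    refine (smul_eq_zero.mp (?_ : ((e₁ - e₂) * (e₁ - e₃)) ^ 2 • (T + V₁ - V₂ - V₃) = 0)).resolve_left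
      (pow_ne_zero 2 hd₁)
    rw [← key e₁, hT]
    simp only [quad]
    module
  have k2 : T - V₁ + V₂ - V₃ = 0 := by
    refine (smul_eq_zero.mp (?_ : ((e₂ - e₃) * (e₂ - e₁)) ^ 2 • (T - V₁ + V₂ - V₃) = 0)).resolve_left
      (pow_ne_zero 2 hd₂)
    rw [← key e₂, hT]
    simp only [quad]
    module
  have k3 : T - V₁ - V₂ + V₃ = 0 := by
    refine (smul_eq_zero.mp (?_ : ((e₃ - e₁) * (e₃ - e₂)) ^ 2 • (T - V₁ - V₂ + V₃) = 0)).resolve_left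
      (pow_ne_zero 2 hd₃)
    rw [← key e₃, hT]
    simp only [quad]
    module
  set s₁ := e₁ ^ 2 - (e₁ - e₂) * (e₁ - e₃) with hs₁
  set s₂ := e₂ ^ 2 - (e₂ - e₃) * (e₂ - e₁) with hs₂
  set s₃ := e₃ ^ 2 - (e₃ - e₁) * (e₃ - e₂) with hs₃
  -- The leading coefficient together with the values at the roots gives `V_i = 0` and `T = 0`; the
  -- cubic coefficient is kept for the `t_i`.
  obtain ⟨c3, c4⟩ := coeff_eq_zero_of_forall_eval
    (c₀ := (s₁ ^ 2 * (-2 * (e₂ - e₃))) • t₁ + (s₂ ^ 2 * (-2 * (e₃ - e₁))) • t₂ +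
      (s₃ ^ 2 * (-2 * (e₁ - e₂))) • t₃ + (s₂ * s₃) • V₁ + (s₃ * s₁) • V₂ + (s₁ * s₂) • V₃)
    (c₁ := (-4 * e₁ * s₁ * (-2 * (e₂ - e₃))) • t₁ + (-4 * e₂ * s₂ * (-2 * (e₃ - e₁))) • t₂ +
      (-4 * e₃ * s₃ * (-2 * (e₁ - e₂))) • t₃ + (-2 * (e₂ * s₃ + e₃ * s₂)) • V₁ +
      (-2 * (e₃ * s₁ + e₁ * s₃)) • V₂ + (-2 * (e₁ * s₂ + e₂ * s₁)) • V₃)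
    (c₂ := ((4 * e₁ ^ 2 + 2 * s₁) * (-2 * (e₂ - e₃))) • t₁ +
      ((4 * e₂ ^ 2 + 2 * s₂) * (-2 * (e₃ - e₁))) • t₂ +
      ((4 * e₃ ^ 2 + 2 * s₃) * (-2 * (e₁ - e₂))) • t₃ + (4 * e₂ * e₃ + s₂ + s₃) • V₁ +
      (4 * e₃ * e₁ + s₃ + s₁) • V₂ + (4 * e₁ * e₂ + s₁ + s₂) • V₃)
    (c₃ := (-4 * e₁ * (-2 * (e₂ - e₃))) • t₁ + (-4 * e₂ * (-2 * (e₃ - e₁))) • t₂ +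
      (-4 * e₃ * (-2 * (e₁ - e₂))) • t₃ + (-2 * (e₂ + e₃)) • V₁ + (-2 * (e₃ + e₁)) • V₂ +
      (-2 * (e₁ + e₂)) • V₃)
    (c₄ := T + V₁ + V₂ + V₃) (fun z => by
      rw [← key z, hT]
      simp only [quad, hs₁, hs₂, hs₃]
      module)
  have v₁ : V₁ = 0 := by
    linear_combination (norm := module) (1 / 4 : ℂ) • (k1 + c4 - k2 - k3)
  have v₂ : V₂ = 0 := by
    linear_combination (norm := module) (1 / 4 : ℂ) • (k2 + c4 - k1 - k3)
  have v₃ : V₃ = 0 := by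
    linear_combination (norm := module) (1 / 4 : ℂ) • (k3 + c4 - k1 - k2)
  have R1 : T = 0 := by
    linear_combination (norm := module) c4 - v₁ - v₂ - v₃
  have hw : (e₂ - e₃) * (e₃ - e₁) * (e₁ - e₂) ≠ 0 := mul_ne_zero (mul_ne_zero
    (sub_ne_zero.mpr h₂₃) (sub_ne_zero.mpr h₃₁)) (sub_ne_zero.mpr h₁₂)
  rw [v₁, v₂, v₃] at c3
  -- Jacobi, `T = 0` and the cubic coefficient are three linear equations for the `t_i`, with
  -- determinant proportional to the product of the differences of the `e_i`.
  have hR : ∀ t : L, (-3 * ((e₂ - e₃) * (e₃ - e₁) * (e₁ - e₂))) • t = 0 → t = 0 := fun t ht =>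
    (smul_eq_zero.mp ht).resolve_left (mul_ne_zero (by norm_num) hw)
  rw [hT] at R1
  refine ⟨⟨hR _ ?_, hR _ ?_, hR _ ?_⟩, sub_eq_zero.mp v₁, sub_eq_zero.mp v₂, sub_eq_zero.mp v₃⟩
  · linear_combination (norm := module) (-((e₂ - e₃) * (e₃ - e₁) * (e₁ - e₂))) • jac +
      (-(1 / 2) * (e₂ * (e₃ - e₁) - e₃ * (e₁ - e₂))) • R1 + (1 / 8 * (e₁ - e₂ - (e₃ - e₁))) • c3
  · linear_combination (norm := module) (-((e₂ - e₃) * (e₃ - e₁) * (e₁ - e₂))) • jac +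
      (-(1 / 2) * (e₃ * (e₁ - e₂) - e₁ * (e₂ - e₃))) • R1 + (1 / 8 * (e₂ - e₃ - (e₁ - e₂))) • c3
  · linear_combination (norm := module) (-((e₂ - e₃) * (e₃ - e₁) * (e₁ - e₂))) • jac +
      (-(1 / 2) * (e₁ * (e₂ - e₃) - e₂ * (e₃ - e₁))) • R1 + (1 / 8 * (e₃ - e₁ - (e₂ - e₃))) • c3

/-- The derivative `∂₀P(e_i)` of the cubic polynomial `P`. -/
def discr (e : Fin 3 → ℂ) (i : Fin 3) : ℂ := (e i - e (i + 1)) * (e i - e (i + 2))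

theorem discr_ne_zero {e : Fin 3 → ℂ} (h₀₁ : e 0 ≠ e 1) (h₁₂ : e 1 ≠ e 2) (h₂₀ : e 2 ≠ e 0)
    (i : Fin 3) : discr e i ≠ 0 := by
  refine mul_ne_zero (sub_ne_zero.mpr ?_) (sub_ne_zero.mpr ?_)
  · fin_cases i
    · exact h₀₁
    · exact h₁₂
    · exact h₂₀
  · fin_cases i
    · exact h₂₀.symm
    · exact h₀₁.symm
    · exact h₁₂.symm

/-- The coefficients of the quadratic polynomial `h₀ + (z - c) h₁ + ½ (z - c)² h₂` with respect to
the polynomials `κ_i ((z - e_i)² - d_i)`. -/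
def quadCoeff (e κ : Fin 3 → ℂ) (c : ℂ) (h₀ h₁ h₂ : L) (i : Fin 3) : L :=
  (κ i * (4 * discr e i))⁻¹ • ((2 * (c - e i)) • h₁ - ((c - e i) ^ 2 - discr e i) • h₂ -
    (2 : ℂ) • h₀)

theorem quadCoeff_sum {e κ : Fin 3 → ℂ} (h₀₁ : e 0 ≠ e 1) (h₁₂ : e 1 ≠ e 2) (h₂₀ : e 2 ≠ e 0)
    (hκ : ∀ i, κ i ≠ 0) (c : ℂ) (h₀ h₁ h₂ : L) (z : ℂ) :
    quad (e 0) (e 1) (e 2) z • κ 0 • quadCoeff e κ c h₀ h₁ h₂ 0 +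
      quad (e 1) (e 2) (e 0) z • κ 1 • quadCoeff e κ c h₀ h₁ h₂ 1 +
      quad (e 2) (e 0) (e 1) z • κ 2 • quadCoeff e κ c h₀ h₁ h₂ 2 =
    h₀ + (z - c) • h₁ + ((z - c) ^ 2 / 2) • h₂ := by
  have a0 := hκ 0
  have a1 := hκ 1
  have a2 := hκ 2
  have b0 : e 0 - e 1 ≠ 0 := sub_ne_zero.mpr h₀₁
  have b1 : e 1 - e 2 ≠ 0 := sub_ne_zero.mpr h₁₂
  have b2 : e 2 - e 0 ≠ 0 := sub_ne_zero.mpr h₂₀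
  have b3 : e 1 - e 0 ≠ 0 := sub_ne_zero.mpr h₀₁.symm
  have b4 : e 2 - e 1 ≠ 0 := sub_ne_zero.mpr h₁₂.symm
  have b5 : e 0 - e 2 ≠ 0 := sub_ne_zero.mpr h₂₀.symm
  simp only [quadCoeff, discr, quad, show (0 : Fin 3) + 1 = 1 from rfl,
    show (0 : Fin 3) + 2 = 2 from rfl, show (1 : Fin 3) + 1 = 2 from rfl,
    show (1 : Fin 3) + 2 = 0 from rfl, show (2 : Fin 3) + 1 = 0 from rfl,
    show (2 : Fin 3) + 2 = 1 from rfl]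
  match_scalars
  · field_simp
    grind
  · field_simp
    grind
  · field_simp
    grind

/-- The derivative of `quadCoeff_sum`: a symmetric difference quotient is exact on quadratic
polynomials. -/
theorem quadCoeff_sum' {e κ : Fin 3 → ℂ} (h₀₁ : e 0 ≠ e 1) (h₁₂ : e 1 ≠ e 2) (h₂₀ : e 2 ≠ e 0)
    (hκ : ∀ i, κ i ≠ 0) (c : ℂ) (h₀ h₁ h₂ : L) (z : ℂ) :
    (2 * (z - e 0)) • κ 0 • quadCoeff e κ c h₀ h₁ h₂ 0 +
      (2 * (z - e 1)) • κ 1 • quadCoeff e κ c h₀ h₁ h₂ 1 +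
      (2 * (z - e 2)) • κ 2 • quadCoeff e κ c h₀ h₁ h₂ 2 = h₁ + (z - c) • h₂ := by
  have a0 := quadCoeff_sum h₀₁ h₁₂ h₂₀ hκ c h₀ h₁ h₂ (z + 1)
  have a1 := quadCoeff_sum h₀₁ h₁₂ h₂₀ hκ c h₀ h₁ h₂ (z - 1)
  simp only [quad] at a0 a1
  linear_combination (norm := module) (1 / 2 : ℂ) • (a0 - a1)

/-- The scalars that normalize the coefficients. -/
def IsNormalizing (e κ : Fin 3 → ℂ) : Prop := ∀ i, κ i ^ 2 * (6 * discr e i) = -1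

theorem IsNormalizing.ne_zero {e κ : Fin 3 → ℂ} (h : IsNormalizing e κ) (i : Fin 3) : κ i ≠ 0 := by
  intro hi
  have := h i
  rw [hi] at this
  norm_num at this

theorem exists_isNormalizing {e : Fin 3 → ℂ} (h₀₁ : e 0 ≠ e 1) (h₁₂ : e 1 ≠ e 2)
    (h₂₀ : e 2 ≠ e 0) : ∃ κ, IsNormalizing e κ := by
  have h : ∀ i, ∃ k : ℂ, k ^ 2 * (6 * discr e i) = -1 := by
    intro i
    have hd : 6 * discr e i ≠ 0 := mul_ne_zero (by norm_num) (discr_ne_zero h₀₁ h₁₂ h₂₀ i)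
    obtain ⟨k, hk⟩ := IsAlgClosed.exists_pow_nat_eq (-1 / (6 * discr e i)) (n := 2) (by norm_num)
    exact ⟨k, by rw [hk, div_mul_cancel₀ _ hd]⟩
  choose κ hκ using h
  exact ⟨κ, hκ⟩

/-- The factors with `κ_i² · 6d_i = -1` rescale both double brackets to the same coefficient, which
yields the relations with right-hand side `(e_i - e_{i+1}) p_{i+2}`. -/
theorem ellipticTriple_of_quad {e κ : Fin 3 → ℂ} (h₀₁ : e 0 ≠ e 1) (h₁₂ : e 1 ≠ e 2)
    (h₂₀ : e 2 ≠ e 0) (hκ : IsNormalizing e κ) {c : ℂ} {h₀ h₁ h₂ : L}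
    (h : ∀ z : ℂ, ⁅h₀ + (z - c) • h₁ + ((z - c) ^ 2 / 2) • h₂,
      ⁅h₀ + (z - c) • h₁ + ((z - c) ^ 2 / 2) • h₂, h₁ + (z - c) • h₂⁆⁆ =
      (2 / 3 * ((z - e 0) * (z - e 1) * (z - e 2))) • (h₁ + (z - c) • h₂) -
      (1 / 3 * ((z - e 0) * (z - e 1) + (z - e 1) * (z - e 2) + (z - e 2) * (z - e 0))) •
        (h₀ + (z - c) • h₁ + ((z - c) ^ 2 / 2) • h₂)) :
    EllipticTriple e (quadCoeff e κ c h₀ h₁ h₂) := by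
  have hκ0 := hκ.ne_zero
  obtain ⟨⟨t0, t1, t2⟩, v0, v1, v2⟩ := relations_of_quad h₀₁ h₁₂ h₂₀
    (p₁ := κ 0 • quadCoeff e κ c h₀ h₁ h₂ 0) (p₂ := κ 1 • quadCoeff e κ c h₀ h₁ h₂ 1)
    (p₃ := κ 2 • quadCoeff e κ c h₀ h₁ h₂ 2) (fun z => by
      rw [quadCoeff_sum h₀₁ h₁₂ h₂₀ hκ0, quadCoeff_sum' h₀₁ h₁₂ h₂₀ hκ0]
      exact h z)
  set p := quadCoeff e κ c h₀ h₁ h₂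
  have n0 : κ 0 ^ 2 * (6 * ((e 0 - e 1) * (e 0 - e 2))) = -1 := hκ 0
  have n1 : κ 1 ^ 2 * (6 * ((e 1 - e 2) * (e 1 - e 0))) = -1 := hκ 1
  have n2 : κ 2 ^ 2 * (6 * ((e 2 - e 0) * (e 2 - e 1))) = -1 := hκ 2
  simp only [smul_lie, lie_smul, smul_smul] at t0 t1 t2 v0 v1 v2
  have a0 := hκ0 0
  have a1 := hκ0 1
  have a2 := hκ0 2
  have aux : ∀ (x y z k₁ k₂ k₃ : ℂ) (p₁ p₂ p₃ : L), k₃ ≠ 0 →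
      k₁ ^ 2 * (6 * ((x - y) * (x - z))) = -1 → k₂ ^ 2 * (6 * ((y - z) * (y - x))) = -1 →
      (-2 * (z - x) * (k₁ * k₃ * k₁)) • ⁅p₁, ⁅p₃, p₁⁆⁆ +
        (-2 * (y - z) * (k₃ * k₂ * k₂)) • ⁅p₂, ⁅p₂, p₃⁆⁆ = (1 / 3 * k₃) • p₃ →
      ⁅p₁, ⁅p₁, p₃⁆⁆ - ⁅p₂, ⁅p₂, p₃⁆⁆ = (x - y) • p₃ := by
    intro x y z k₁ k₂ k₃ p₁ p₂ p₃ hk e1 e2 hv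
    rw [← lie_skew p₃ p₁, lie_neg] at hv
    have h3 := congrArg ((3 * (x - y)) • ·) hv
    simp only [smul_add, smul_neg, smul_smul] at h3
    rw [show 3 * (x - y) * (-2 * (z - x) * (k₁ * k₃ * k₁)) = -k₃ by linear_combination k₃ * e1,
      show 3 * (x - y) * (-2 * (y - z) * (k₃ * k₂ * k₂)) = -k₃ by linear_combination k₃ * e2] at h3
    refine sub_eq_zero.mp ((smul_eq_zero.mp (?_ : k₃ • (_ : L) = 0)).resolve_left hk)
    linear_combination (norm := module) h3
  refine ⟨fun i => ?_, fun i => ?_⟩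
  · fin_cases i
    · exact (smul_eq_zero.mp t0).resolve_left (by simp [a0, a1, a2])
    · exact (smul_eq_zero.mp t1).resolve_left (by simp [a0, a1, a2])
    · exact (smul_eq_zero.mp t2).resolve_left (by simp [a0, a1, a2])
  · fin_cases i
    · exact aux (e 0) (e 1) (e 2) (κ 0) (κ 1) (κ 2) (p 0) (p 1) (p 2) a2 n0 n1
        (by linear_combination (norm := module) v2)
    · exact aux (e 1) (e 2) (e 0) (κ 1) (κ 2) (κ 0) (p 1) (p 2) (p 0) a0 n1 n2
        (by linear_combination (norm := module) v0)
    · exact aux (e 2) (e 0) (e 1) (κ 2) (κ 0) (κ 1) (p 2) (p 0) (p 1) a1 n2 n0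
        (by linear_combination (norm := module) v1)

end Quadratic
end
end ZCR

namespace ZCR

open Finset TensorProduct

noncomputable section

/-! ### The covariant derivative ∇ and values at the base point -/

section BasePoint

variable {e : Fin 3 → ℂ} {a : Coord → ℂ} {L : Type*} [LieRing L] [LieAlgebra ℂ L]
  {α γ G : MvPowerSeries Coord L}

theorem lie_apply_zero (f g : MvPowerSeries Coord L) : ⁅f, g⁆ (0 : Mon) = ⁅f 0, g 0⁆ := by
  rw [coeff_lie, HasAntidiagonal.antidiagonal_zero, Finset.sum_singleton]

theorem smul_apply_zero (c : MvPowerSeries Coord ℂ) (f : MvPowerSeries Coord L) :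
    (c • f) (0 : Mon) = MvPowerSeries.constantCoeff c • f 0 := by
  rw [coeff_smul, HasAntidiagonal.antidiagonal_zero, Finset.sum_singleton]
  rfl

theorem constantCoeff_coordSeries (s : Coord) :
    MvPowerSeries.constantCoeff (coordSeries a s) = a s := by
  rw [coordSeries, map_add, MvPowerSeries.constantCoeff_C, MvPowerSeries.constantCoeff_X, add_zero]

theorem pd_zero_cubic : pd (.u 0) (cubic e a) =
    (coordSeries a (.u 0) - MvPowerSeries.C (e 0)) * (coordSeries a (.u 0) - MvPowerSeries.C (e 1)) +
    (coordSeries a (.u 0) - MvPowerSeries.C (e 1)) * (coordSeries a (.u 0) - MvPowerSeries.C (e 2)) +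
    (coordSeries a (.u 0) - MvPowerSeries.C (e 2)) *
      (coordSeries a (.u 0) - MvPowerSeries.C (e 0)) := by
  simp only [cubic, pd_mul, pd_sub, pd_C, pd_coordSeries_self]
  ring

theorem pd_zero_pd_zero_cubic : pd (.u 0) (pd (.u 0) (cubic e a)) =
    2 * ((coordSeries a (.u 0) - MvPowerSeries.C (e 0)) +
      (coordSeries a (.u 0) - MvPowerSeries.C (e 1)) +
      (coordSeries a (.u 0) - MvPowerSeries.C (e 2))) := by
  simp only [pd_zero_cubic, pd_add, pd_mul, pd_sub, pd_C, pd_coordSeries_self]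
  ring

theorem pd_zero_pd_zero_pd_zero_cubic : pd (.u 0) (pd (.u 0) (pd (.u 0) (cubic e a))) = 6 := by
  have p2 : pd (.u 0) (2 : MvPowerSeries Coord ℂ) = 0 := pd_ofNat _ 2
  simp only [pd_zero_pd_zero_cubic, pd_add, pd_mul, pd_sub, pd_C, pd_coordSeries_self, p2]
  ring

/-- The covariant derivative `∂₀ + a₁⁻² ad α`. -/
def nabla (a : Coord → ℂ) (α Y : MvPowerSeries Coord L) : MvPowerSeries Coord L :=
  pd (.u 0) Y + invSq a • ⁅α, Y⁆

theorem nabla_lie (Y Z : MvPowerSeries Coord L) :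
    nabla a α ⁅Y, Z⁆ = ⁅nabla a α Y, Z⁆ + ⁅Y, nabla a α Z⁆ := by
  rw [nabla, nabla, nabla, pd_lie, leibniz_lie, add_lie, lie_add, smul_lie, lie_smul]
  module

theorem nabla_smul (c : MvPowerSeries Coord ℂ) (Y : MvPowerSeries Coord L) :
    nabla a α (c • Y) = pd (.u 0) c • Y + c • nabla a α Y := by
  rw [nabla, nabla, pd_smul, lie_smul]
  module

theorem nabla_add (Y Z : MvPowerSeries Coord L) :
    nabla a α (Y + Z) = nabla a α Y + nabla a α Z := by
  rw [nabla, nabla, nabla, pd_add, lie_add]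
  module

theorem nabla_sub (Y Z : MvPowerSeries Coord L) :
    nabla a α (Y - Z) = nabla a α Y - nabla a α Z := by
  rw [nabla, nabla, nabla, pd_sub, lie_sub]
  module

theorem nabla_self : nabla a α α = pd (.u 0) α := by
  rw [nabla, lie_self, smul_zero, add_zero]

/-- The value at the base point of the `k`-th covariant derivative of `α`. -/
def jet (a : Coord → ℂ) (α : MvPowerSeries Coord L) (k : ℕ) : L := ((nabla a α)^[k] α) 0

theorem nabla_nabla_nabla (α : MvPowerSeries Coord L) : nabla a α (nabla a α (nabla a α α)) =
    pd (.u 0) (pd (.u 0) (pd (.u 0) α)) + (2 * invSq a) • ⁅α, pd (.u 0) (pd (.u 0) α)⁆ +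
      (invSq a ^ 2) • ⁅α, ⁅α, pd (.u 0) α⁆⁆ := by
  rw [nabla_self, nabla, nabla, pd_add, pd_smul, pd_lie, pd_invSq, lie_add, lie_smul, lie_self]
  module

theorem IsReducedZCR.nabla_three (h : IsReducedZCR e a α γ G) :
    nabla a α (nabla a α (nabla a α α)) = 0 :=
  (nabla_nabla_nabla α).trans h.pd_three

/-- Since `∇` is a derivation of brackets and `∇³α = 0`, repeated differentiation of `3[α,[α,∇α]] =
2P∇α - P'α` proceeds as if `α` were a quadratic polynomial in `u₀`. The values at the base point are
the Taylor coefficients of a polynomial identity in `z`. -/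
theorem IsReducedZCR.quad_relation (h : IsReducedZCR e a α γ G) (z : ℂ) :
    ⁅jet a α 0 + (z - a (.u 0)) • jet a α 1 + ((z - a (.u 0)) ^ 2 / 2) • jet a α 2,
      ⁅jet a α 0 + (z - a (.u 0)) • jet a α 1 + ((z - a (.u 0)) ^ 2 / 2) • jet a α 2,
        jet a α 1 + (z - a (.u 0)) • jet a α 2⁆⁆ =
      (2 / 3 * ((z - e 0) * (z - e 1) * (z - e 2))) •
        (jet a α 1 + (z - a (.u 0)) • jet a α 2) -
      (1 / 3 * ((z - e 0) * (z - e 1) + (z - e 1) * (z - e 2) + (z - e 2) * (z - e 0))) •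
        (jet a α 0 + (z - a (.u 0)) • jet a α 1 + ((z - a (.u 0)) ^ 2 / 2) • jet a α 2) := by
  set Y₁ := nabla a α α with hY₁
  set Y₂ := nabla a α Y₁ with hY₂
  have hY₃ : nabla a α Y₂ = 0 := h.nabla_three
  set P := cubic e a with hP
  set P₁ := pd (.u 0) P with hP₁
  set P₂ := pd (.u 0) P₁ with hP₂
  have p3 : ∀ s, pd s (3 : MvPowerSeries Coord ℂ) = 0 := fun s => pd_ofNat _ 3
  have p2 : ∀ s, pd s (2 : MvPowerSeries Coord ℂ) = 0 := fun s => pd_ofNat _ 2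
  have p6 : ∀ s, pd s (6 : MvPowerSeries Coord ℂ) = 0 := fun s => pd_ofNat _ 6
  have hP₃ : pd (.u 0) P₂ = 6 := pd_zero_pd_zero_pd_zero_cubic
  have r0 : (3 : MvPowerSeries Coord ℂ) • ⁅α, ⁅α, Y₁⁆⁆ = (2 * P) • Y₁ - P₁ • α := by
    have h1 := h.lie_lie
    rw [← nabla_self (a := a), ← hY₁, ← hP₁] at h1
    have c2 := C_half
    have c43 : MvPowerSeries.C (1 / 2 : ℂ) * 3 * MvPowerSeries.C (4 / 3 : ℂ) =
        (2 : MvPowerSeries Coord ℂ) := by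
      rw [← map_ofNat MvPowerSeries.C 3, ← map_ofNat MvPowerSeries.C 2, ← map_mul, ← map_mul]
      norm_num
    have c23 : MvPowerSeries.C (1 / 2 : ℂ) * 3 * MvPowerSeries.C (2 / 3 : ℂ) =
        (1 : MvPowerSeries Coord ℂ) := by
      rw [← map_ofNat MvPowerSeries.C 3, ← map_one MvPowerSeries.C, ← map_mul, ← map_mul]
      norm_num
    have h2 := congrArg (fun X =>
      (MvPowerSeries.C (1 / 2 : ℂ) * 3 : MvPowerSeries Coord ℂ) • X) h1
    simp only [smul_add, smul_sub, smul_smul, smul_zero] at h2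
    rw [← mul_assoc, ← mul_assoc, c43, c23, one_mul, show MvPowerSeries.C (1 / 2) * 3 * 2 =
      (3 : MvPowerSeries Coord ℂ) by linear_combination 3 * c2] at h2
    linear_combination (norm := module) h2
  have r1 := congrArg (nabla a α) r0
  simp only [nabla_smul, nabla_lie, nabla_sub, p3, p2, pd_mul, lie_self, zero_add, zero_smul,
    zero_mul, ← hY₁, ← hY₂, ← hP₁, ← hP₂] at r1
  have r2 := congrArg (nabla a α) r1
  simp only [nabla_smul, nabla_lie, nabla_sub, nabla_add, p3, p2, pd_mul, ← hY₁, ← hY₂, ← hP₁,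
    ← hP₂, hY₃, hP₃, lie_self, lie_zero, zero_smul,
    zero_add, add_zero, smul_zero, zero_mul] at r2
  have r3 := congrArg (nabla a α) r2
  simp only [nabla_smul, nabla_lie, nabla_sub, nabla_add, p3, p2, p6, pd_mul, ← hY₁, ← hY₂,
    ← hP₂, hY₃, hP₃, lie_self, lie_zero, zero_lie, zero_smul,
    zero_add, add_zero, smul_zero, zero_mul] at r3
  have r4 := congrArg (nabla a α) r3
  simp only [nabla_smul, nabla_lie, nabla_sub, nabla_add, p3, p2, p6, pd_mul, ← hY₁, ← hY₂,
    hY₃, hP₃, lie_self, lie_zero, zero_lie, zero_smul,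
    zero_add, add_zero, smul_zero, zero_mul] at r4
  have j0 : jet a α 0 = α 0 := rfl
  have j1 : jet a α 1 = Y₁ 0 := rfl
  have j2 : jet a α 2 = Y₂ 0 := rfl
  have ev : ∀ {f g : MvPowerSeries Coord L}, f = g → f 0 = g 0 := fun h => by rw [h]
  have q0 := ev r0
  have q1 := ev r1
  have q2 := ev r2
  have q3 := ev r3
  have q4 := ev r4
  have n2 : MvPowerSeries.constantCoeff (2 : MvPowerSeries Coord ℂ) = 2 := map_ofNat _ 2
  have n3 : MvPowerSeries.constantCoeff (3 : MvPowerSeries Coord ℂ) = 3 := map_ofNat _ 3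
  have n6 : MvPowerSeries.constantCoeff (6 : MvPowerSeries Coord ℂ) = 6 := map_ofNat _ 6
  have cP : MvPowerSeries.constantCoeff P =
      (a (.u 0) - e 0) * (a (.u 0) - e 1) * (a (.u 0) - e 2) := by
    simp [hP, cubic, constantCoeff_coordSeries]
  have cP₁ : MvPowerSeries.constantCoeff P₁ = (a (.u 0) - e 0) * (a (.u 0) - e 1) +
      (a (.u 0) - e 1) * (a (.u 0) - e 2) + (a (.u 0) - e 2) * (a (.u 0) - e 0) := by
    simp [hP₁, hP, pd_zero_cubic, constantCoeff_coordSeries]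
  have cP₂ : MvPowerSeries.constantCoeff P₂ =
      2 * ((a (.u 0) - e 0) + (a (.u 0) - e 1) + (a (.u 0) - e 2)) := by
    simp [hP₂, hP₁, hP, pd_zero_pd_zero_cubic, constantCoeff_coordSeries, n2]
  simp only [series_add_apply, series_sub_apply, smul_apply_zero, lie_apply_zero, map_mul,
    n2, n3, n6, map_zero, ← j0, ← j1, ← j2, cP, cP₁, cP₂] at q0 q1 q2 q3 q4
  have k10 : ⁅jet a α 1, jet a α 0⁆ = -⁅jet a α 0, jet a α 1⁆ := (lie_skew _ _).symm
  have k20 : ⁅jet a α 2, jet a α 0⁆ = -⁅jet a α 0, jet a α 2⁆ := (lie_skew _ _).symm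
  have k21 : ⁅jet a α 2, jet a α 1⁆ = -⁅jet a α 1, jet a α 2⁆ := (lie_skew _ _).symm
  obtain ⟨s, rfl⟩ : ∃ s, z = a (.u 0) + s := ⟨z - a (.u 0), by ring⟩
  simp only [lie_add, add_lie, smul_lie, lie_smul, lie_self, k21, lie_neg,
    smul_zero, add_zero, add_sub_cancel_left]
  -- The weights are `s^k / (3 · k!)`. Four derivatives suffice, since `[h,h']` is quadratic for
  -- quadratic `h` and both sides thus have degree at most 4.
  linear_combination (norm := module) (1 / 3 : ℂ) • q0 + (s / 3) • q1 + (s ^ 2 / 6) • q2 +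
    (s ^ 3 / 18) • q3 + (s ^ 4 / 72) • q4

theorem jet_zero : jet a α 0 = α 0 := rfl

theorem jet_one : jet a α 1 = pd (.u 0) α 0 := by
  rw [← nabla_self (a := a)]
  rfl

theorem jet_two : jet a α 2 = pd (.u 0) (pd (.u 0) α) 0 + ((a (.u 1))⁻¹ ^ 2) •
    ⁅jet a α 0, jet a α 1⁆ := by
  have h : jet a α 2 = nabla a α (nabla a α α) 0 := rfl
  rw [h, nabla_self, nabla, series_add_apply, invSq, C_smul, lie_apply_zero, jet_zero, jet_one]

theorem pd_pd_apply_zero_mem {S : LieSubalgebra ℂ L} (h₀ : jet a α 0 ∈ S) (h₁ : pd (.u 0) α 0 ∈ S)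
    (h₂ : jet a α 2 ∈ S) : pd (.u 0) (pd (.u 0) α) 0 ∈ S := by
  have h := S.sub_mem h₂ (S.smul_mem ((a (.u 1))⁻¹ ^ 2) (S.lie_mem h₀ h₁))
  rwa [jet_two, jet_one, add_sub_cancel_right] at h

theorem mem_of_quadCoeff_mem {κ : Fin 3 → ℂ} (h₀₁ : e 0 ≠ e 1) (h₁₂ : e 1 ≠ e 2)
    (h₂₀ : e 2 ≠ e 0) (hκ : ∀ i, κ i ≠ 0) (c : ℂ) (h₀ h₁ h₂ : L) {S : LieSubalgebra ℂ L}
    (hS : ∀ i, quadCoeff e κ c h₀ h₁ h₂ i ∈ S) : h₀ ∈ S ∧ h₁ ∈ S ∧ h₂ ∈ S := by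
  have a0 := quadCoeff_sum h₀₁ h₁₂ h₂₀ hκ c h₀ h₁ h₂ c
  have a1 := quadCoeff_sum' h₀₁ h₁₂ h₂₀ hκ c h₀ h₁ h₂ c
  have a2 := quadCoeff_sum' h₀₁ h₁₂ h₂₀ hκ c h₀ h₁ h₂ (c + 1)
  simp only [sub_self, zero_smul, add_zero, ne_eq, OfNat.ofNat_ne_zero, not_false_eq_true,
    zero_pow, zero_div, add_sub_cancel_left, one_smul] at a0 a1 a2
  have m : ∀ x y z : ℂ, x • κ 0 • quadCoeff e κ c h₀ h₁ h₂ 0 +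
      y • κ 1 • quadCoeff e κ c h₀ h₁ h₂ 1 + z • κ 2 • quadCoeff e κ c h₀ h₁ h₂ 2 ∈ S :=
    fun x y z => S.add_mem (S.add_mem (S.smul_mem _ (S.smul_mem _ (hS 0)))
      (S.smul_mem _ (S.smul_mem _ (hS 1)))) (S.smul_mem _ (S.smul_mem _ (hS 2)))
  have b1 : h₁ ∈ S := a1 ▸ m _ _ _
  refine ⟨a0 ▸ m _ _ _, b1, ?_⟩
  have b2 : h₁ + h₂ ∈ S := a2 ▸ m _ _ _
  simpa using S.sub_mem b2 b1

theorem KNFd.lieSpan_quadCoeff {κ : Fin 3 → ℂ} (ha : a ∈ knProlongation) (h₀₁ : e 0 ≠ e 1)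
    (h₁₂ : e 1 ≠ e 2) (h₂₀ : e 2 ≠ e 0) (hκ : ∀ i, κ i ≠ 0) :
    LieSubalgebra.lieSpan ℂ (KNFd e a 1) (Set.range (quadCoeff e κ (a (.u 0))
      (jet a (alphaSeries a (Fd.A a 3 (knRHS e a) 1)) 0)
      (jet a (alphaSeries a (Fd.A a 3 (knRHS e a) 1)) 1)
      (jet a (alphaSeries a (Fd.A a 3 (knRHS e a) 1)) 2))) = ⊤ := by
  set S := LieSubalgebra.lieSpan ℂ (KNFd e a 1) (Set.range (quadCoeff e κ (a (.u 0))
      (jet a (alphaSeries a (Fd.A a 3 (knRHS e a) 1)) 0)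
      (jet a (alphaSeries a (Fd.A a 3 (knRHS e a) 1)) 1)
      (jet a (alphaSeries a (Fd.A a 3 (knRHS e a) 1)) 2))) with hS
  obtain ⟨m0, m1, m2⟩ := mem_of_quadCoeff_mem (S := S) h₀₁ h₁₂ h₂₀ hκ _ _ _ _
    fun i => LieSubalgebra.subset_lieSpan (Set.mem_range_self i)
  rw [jet_one] at m1
  have hV : Vals S.toSubmodule (Fd.A a 3 (knRHS e a) 1) :=
    (Fd.isNormalZCR a 3 (knRHS e a) 1).vals_of_mem ha m0 m1
      (pd_pd_apply_zero_mem m0 m1 m2)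
  rw [eq_top_iff, ← Fd.lieSpan_A, LieSubalgebra.lieSpan_le]
  rintro _ ⟨m, rfl⟩
  exact hV m

theorem KNFd.ellipticTriple {κ : Fin 3 → ℂ} (ha : a ∈ knProlongation) (h₀₁ : e 0 ≠ e 1)
    (h₁₂ : e 1 ≠ e 2) (h₂₀ : e 2 ≠ e 0) (hκ : IsNormalizing e κ) :
    EllipticTriple e (quadCoeff e κ (a (.u 0))
      (jet a (alphaSeries a (Fd.A a 3 (knRHS e a) 1)) 0)
      (jet a (alphaSeries a (Fd.A a 3 (knRHS e a) 1)) 1)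
      (jet a (alphaSeries a (Fd.A a 3 (knRHS e a) 1)) 2)) :=
  ellipticTriple_of_quad h₀₁ h₁₂ h₂₀ hκ
    ((Fd.isNormalZCR a 3 (knRHS e a) 1).isReducedZCR ha).quad_relation

end BasePoint
end
end ZCR

namespace ZCR

open Finset TensorProduct

noncomputable section

/-! ### Covariant Taylor series -/

section Taylor

variable {L : Type*} [LieRing L] [LieAlgebra ℂ L]

/-- The covariant derivative `∂_s + ad η`. -/
def covDeriv (s : Coord) (η Y : MvPowerSeries Coord L) : MvPowerSeries Coord L := pd s Y + ⁅η, Y⁆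

/-- The series `∑ sⁿ/n! (∂_s + ad η)ⁿ Y |_{s = 0}`. -/
def covTaylor (s : Coord) (η Y : MvPowerSeries Coord L) : MvPowerSeries Coord L :=
  fun m => ((m s).factorial : ℂ)⁻¹ • ((covDeriv s η)^[m s] Y) (m.erase s)

variable {s r : Coord} {η Y Z : MvPowerSeries Coord L}

theorem covDeriv_add : covDeriv s η (Y + Z) = covDeriv s η Y + covDeriv s η Z := by
  rw [covDeriv, covDeriv, covDeriv, pd_add, lie_add]
  abel

theorem covDeriv_lie : covDeriv s η ⁅Y, Z⁆ = ⁅covDeriv s η Y, Z⁆ + ⁅Y, covDeriv s η Z⁆ := by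
  rw [covDeriv, covDeriv, covDeriv, pd_lie, leibniz_lie, add_lie, lie_add]
  abel

theorem covDeriv_smul (c : MvPowerSeries Coord ℂ) :
    covDeriv s η (c • Y) = pd s c • Y + c • covDeriv s η Y := by
  rw [covDeriv, covDeriv, pd_smul, lie_smul, smul_add, add_assoc]

theorem covTaylor_apply_of_eq_zero {m : Mon} (hm : m s = 0) : covTaylor s η Y m = Y m := by
  rw [covTaylor, hm, Finsupp.erase_of_notMem_support (by simpa using hm)]
  simp

/-- With the initial condition at `s = 0`, this differential equation characterizes `covTaylor`. It
plays the role of conjugation by a group-valued solution of a linear equation, without any group. -/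
theorem pd_covTaylor : pd s (covTaylor s η Y) = covTaylor s η (covDeriv s η Y) := by
  funext m
  have h1 : (m + Finsupp.single s 1 : Mon) s = m s + 1 := by simp
  have h2 : (m + Finsupp.single s 1 : Mon).erase s = m.erase s := by
    ext c
    by_cases hc : c = s
    · simp [hc]
    · simp [hc]
  rw [coeff_pd, covTaylor, covTaylor, h1, h2, ← Nat.cast_smul_eq_nsmul ℂ, smul_smul,
    Nat.factorial_succ, Nat.cast_mul, mul_inv, mul_inv_cancel_left₀ (Nat.cast_ne_zero.mpr (Nat.succ_ne_zero _)),
    Function.iterate_succ_apply]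

/-- Uniqueness for a family closed under `∂_s`. The family is needed because the defect of
multiplicativity at `(Y, Z)` has as derivative the defects at two other pairs. -/
theorem eq_zero_of_pd_eq {ι : Type*} {Φ : ι → MvPowerSeries Coord L} (s : Coord)
    (h0 : ∀ i, ∀ m : Mon, m s = 0 → Φ i m = 0)
    (h : ∀ i, ∃ j k, pd s (Φ i) = Φ j + Φ k) (i : ι) : Φ i = 0 := by
  have : ∀ n i, ∀ m : Mon, m s = n → Φ i m = 0 := by
    intro n
    induction n with
    | zero => exact h0
    | succ n ih =>
      intro i m hm
      obtain ⟨j, k, hjk⟩ := h i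
      have hle : Finsupp.single s 1 ≤ m := by rw [Finsupp.single_le_iff]; omega
      have h1 := congrFun hjk (m - Finsupp.single s 1)
      have h2 : (m - Finsupp.single s 1 : Mon) s = n := by simp [hm]
      rw [coeff_pd, tsub_add_cancel_of_le hle, ← Nat.cast_smul_eq_nsmul ℂ, series_add_apply,
        ih j _ h2, ih k _ h2, add_zero] at h1
      exact (smul_eq_zero.mp h1).resolve_left (Nat.cast_ne_zero.mpr (Nat.succ_ne_zero _))
  exact funext fun m => this _ i m rfl

theorem covTaylor_add : covTaylor s η (Y + Z) = covTaylor s η Y + covTaylor s η Z := by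
  have h : ∀ n, (covDeriv s η)^[n] (Y + Z) = (covDeriv s η)^[n] Y + (covDeriv s η)^[n] Z := by
    intro n
    induction n with
    | zero => rfl
    | succ n ih => rw [Function.iterate_succ_apply', ih, covDeriv_add,
        Function.iterate_succ_apply', Function.iterate_succ_apply']
  funext m
  rw [series_add_apply, covTaylor, covTaylor, covTaylor, h, series_add_apply, smul_add]

theorem lie_congr_of_eq_zero {Y' Z' : MvPowerSeries Coord L}
    (hY : ∀ m : Mon, m s = 0 → Y m = Y' m) (hZ : ∀ m : Mon, m s = 0 → Z m = Z' m) {m : Mon}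
    (hm : m s = 0) : ⁅Y, Z⁆ m = ⁅Y', Z'⁆ m := by
  refine Finset.sum_congr rfl fun q hq => ?_
  rw [HasAntidiagonal.mem_antidiagonal] at hq
  rw [← hq, Finsupp.add_apply] at hm
  rw [hY _ (by omega), hZ _ (by omega)]

theorem smul_congr_of_eq_zero (c : MvPowerSeries Coord ℂ) {Y' : MvPowerSeries Coord L}
    (hY : ∀ m : Mon, m s = 0 → Y m = Y' m) {m : Mon} (hm : m s = 0) :
    (c • Y) m = (c • Y') m := by
  refine Finset.sum_congr rfl fun q hq => ?_
  rw [HasAntidiagonal.mem_antidiagonal] at hq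
  rw [← hq, Finsupp.add_apply] at hm
  rw [hY _ (by omega)]

theorem covTaylor_lie : covTaylor s η ⁅Y, Z⁆ = ⁅covTaylor s η Y, covTaylor s η Z⁆ := by
  rw [← sub_eq_zero]
  refine eq_zero_of_pd_eq (ι := MvPowerSeries Coord L × MvPowerSeries Coord L)
    (Φ := fun i => covTaylor s η ⁅i.1, i.2⁆ - ⁅covTaylor s η i.1, covTaylor s η i.2⁆) s ?_ ?_ (Y, Z)
  · intro i m hm
    rw [series_sub_apply, covTaylor_apply_of_eq_zero hm, sub_eq_zero]
    exact lie_congr_of_eq_zero (fun q hq => (covTaylor_apply_of_eq_zero hq).symm)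
      (fun q hq => (covTaylor_apply_of_eq_zero hq).symm) hm
  · intro i
    refine ⟨(covDeriv s η i.1, i.2), (i.1, covDeriv s η i.2), ?_⟩
    dsimp only
    rw [pd_sub, pd_covTaylor, covDeriv_lie, covTaylor_add, pd_lie, pd_covTaylor, pd_covTaylor]
    abel

theorem covTaylor_smul (c : MvPowerSeries Coord ℂ) :
    covTaylor s η (c • Y) = c • covTaylor s η Y := by
  rw [← sub_eq_zero]
  refine eq_zero_of_pd_eq (ι := MvPowerSeries Coord ℂ × MvPowerSeries Coord L)
    (Φ := fun i => covTaylor s η (i.1 • i.2) - i.1 • covTaylor s η i.2) s ?_ ?_ (c, Y)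
  · intro i m hm
    rw [series_sub_apply, covTaylor_apply_of_eq_zero hm, sub_eq_zero]
    exact smul_congr_of_eq_zero _ (fun q hq => (covTaylor_apply_of_eq_zero hq).symm) hm
  · intro i
    refine ⟨(pd s i.1, i.2), (i.1, covDeriv s η i.2), ?_⟩
    dsimp only
    rw [pd_sub, pd_covTaylor, covDeriv_smul, covTaylor_add, pd_smul, pd_covTaylor]
    abel

theorem covTaylor_zero : covTaylor s η (0 : MvPowerSeries Coord L) = 0 := by
  have h := covTaylor_smul (s := s) (η := η) (Y := 0) 0
  rwa [zero_smul, zero_smul] at h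

theorem covTaylor_sub : covTaylor s η (Y - Z) = covTaylor s η Y - covTaylor s η Z := by
  rw [eq_sub_iff_add_eq, ← covTaylor_add, sub_add_cancel]

theorem covTaylor_neg : covTaylor s η (-Y) = -covTaylor s η Y := by
  rw [← zero_sub, covTaylor_sub, covTaylor_zero, zero_sub]

theorem pd_covDeriv (h : pd r η = 0) : pd r (covDeriv s η Y) = covDeriv s η (pd r Y) := by
  rw [covDeriv, covDeriv, pd_add, pd_comm, pd_lie, h, zero_lie, zero_add]

theorem pd_covTaylor_of_ne (hr : r ≠ s) (h : pd r η = 0) :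
    pd r (covTaylor s η Y) = covTaylor s η (pd r Y) := by
  have hi : ∀ n, pd r ((covDeriv s η)^[n] Y) = (covDeriv s η)^[n] (pd r Y) := by
    intro n
    induction n with
    | zero => rfl
    | succ n ih => rw [Function.iterate_succ_apply', pd_covDeriv h, ih,
        Function.iterate_succ_apply']
  funext m
  have h1 : (m + Finsupp.single r 1 : Mon) s = m s := by simp [Finsupp.single_eq_of_ne hr.symm]
  have h2 : (m + Finsupp.single r 1 : Mon).erase s = m.erase s + Finsupp.single r 1 := by
    rw [Finsupp.erase_add, Finsupp.erase_single_ne hr.symm]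
  have h3 : m.erase s r = m r := Finsupp.erase_ne hr
  rw [coeff_pd, covTaylor, covTaylor, h1, h2, ← hi, coeff_pd, h3, smul_comm]

/-- A covariantly constant series is its own covariant Taylor series. -/
theorem covTaylor_eq_self (h : covDeriv s η Y = 0) (h' : pd s Y = 0) : covTaylor s η Y = Y := by
  funext m
  by_cases hm : m s = 0
  · exact covTaylor_apply_of_eq_zero hm
  · rw [coeff_eq_zero_of_pd h' hm]
    refine coeff_eq_zero_of_pd (s := s) ?_ hm
    rw [pd_covTaylor, h, covTaylor_zero]

/-- The series whose coefficients at the monomials without `u_k` vanish. -/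
def VanishesOnBase (Y : MvPowerSeries Coord L) : Prop := ∀ m : Mon, (∀ k, m (.u k) = 0) → Y m = 0

theorem VanishesOnBase.covDeriv (hs : ∀ k, s ≠ .u k) (h : VanishesOnBase Y) :
    VanishesOnBase (covDeriv s η Y) := by
  intro m hm
  rw [ZCR.covDeriv, series_add_apply, coeff_pd, h, smul_zero, zero_add]
  · refine lie_eq_sum_of_coeff fun q r hqr => ?_
    rw [h, lie_zero]
    intro k
    have := hm k
    rw [← hqr, Finsupp.add_apply] at this
    omega
  · intro k
    rw [Finsupp.add_apply, hm, Finsupp.single_eq_of_ne (hs k).symm, add_zero]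

theorem VanishesOnBase.covTaylor (hs : ∀ k, s ≠ .u k) (h : VanishesOnBase Y) :
    VanishesOnBase (covTaylor s η Y) := by
  intro m hm
  have hi : ∀ n, VanishesOnBase ((ZCR.covDeriv s η)^[n] Y) := by
    intro n
    induction n with
    | zero => exact h
    | succ n ih => rw [Function.iterate_succ_apply']; exact ih.covDeriv hs
  rw [ZCR.covTaylor, hi, smul_zero]
  intro k
  rw [Finsupp.erase_ne (hs k).symm, hm]

end Taylor
end
end ZCR

namespace ZCR

open Finset TensorProduct

noncomputable section

/-! ### The zero-curvature representation with values in the elliptic algebra -/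

section ConstSeries

variable {L : Type*} [LieRing L]

open Classical in
/-- The constant series. -/
def constSeries (y : L) : MvPowerSeries Coord L := fun m => if m = 0 then y else 0

theorem constSeries_zero_apply (y : L) : constSeries y 0 = y := if_pos rfl

theorem constSeries_of_ne (y : L) {m : Mon} (hm : m ≠ 0) : constSeries y m = 0 := if_neg hm

theorem constSeries_add (x y : L) : constSeries (x + y) = constSeries x + constSeries y := by
  funext m
  by_cases hm : m = 0
  · rw [hm]; simp only [series_add_apply, constSeries_zero_apply]
  · simp only [series_add_apply, constSeries_of_ne _ hm, add_zero]

theorem constSeries_zero : constSeries (0 : L) = 0 := by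
  funext m
  by_cases hm : m = 0
  · rw [hm]; exact constSeries_zero_apply _
  · exact constSeries_of_ne _ hm

variable [LieAlgebra ℂ L]

theorem pd_constSeries (s : Coord) (y : L) : pd s (constSeries y) = 0 :=
  pd_eq_zero_of_coeff fun m hm => constSeries_of_ne y (by rintro rfl; exact hm rfl)

theorem constSeries_smul (c : ℂ) (y : L) :
    constSeries (c • y) = (MvPowerSeries.C c : MvPowerSeries Coord ℂ) • constSeries y := by
  funext m
  rw [C_smul]
  by_cases hm : m = 0
  · rw [hm]; simp only [constSeries_zero_apply]
  · simp only [constSeries_of_ne _ hm, smul_zero]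

theorem constSeries_lie (x y : L) : constSeries ⁅x, y⁆ = ⁅constSeries x, constSeries y⁆ := by
  funext m
  by_cases hm : m = 0
  · rw [hm, lie_apply_zero]; simp only [constSeries_zero_apply]
  · rw [constSeries_of_ne _ hm]
    symm
    refine lie_eq_sum_of_coeff fun q r hqr => ?_
    by_cases hq : q = 0
    · rw [hq, zero_add] at hqr
      rw [hqr, constSeries_of_ne y hm, lie_zero]
    · rw [constSeries_of_ne x hq, zero_lie]

theorem eq_constSeries {Y : MvPowerSeries Coord L} (h : ∀ s, pd s Y = 0) :
    Y = constSeries (Y 0) := by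
  funext m
  by_cases hm : m = 0
  · rw [hm, constSeries_zero_apply]
  · rw [constSeries_of_ne _ hm]
    obtain ⟨s, hs⟩ : ∃ s, m s ≠ 0 := by
      by_contra! hcon
      exact hm (Finsupp.ext hcon)
    exact coeff_eq_zero_of_pd (h s) hs

end ConstSeries

/-! ### The quadratic series attached to an elliptic triple -/

section Quadratic

/-- The converse of `relations_of_quad`. It is stated over a commutative ring so that `z` may be the
series `u₀`. -/
theorem lie_lie_quad {R V : Type*} [CommRing R] [LieRing V] [LieAlgebra R V] {e₁ e₂ e₃ : R}
    {p₁ p₂ p₃ : V} (t₁ : ⁅p₁, ⁅p₂, p₃⁆⁆ = 0) (t₂ : ⁅p₂, ⁅p₃, p₁⁆⁆ = 0) (t₃ : ⁅p₃, ⁅p₁, p₂⁆⁆ = 0)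
    (v₁ : (-6 * (e₁ - e₂)) • ⁅p₂, ⁅p₁, p₂⁆⁆ + (-6 * (e₃ - e₁)) • ⁅p₃, ⁅p₃, p₁⁆⁆ = p₁)
    (v₂ : (-6 * (e₂ - e₃)) • ⁅p₃, ⁅p₂, p₃⁆⁆ + (-6 * (e₁ - e₂)) • ⁅p₁, ⁅p₁, p₂⁆⁆ = p₂)
    (v₃ : (-6 * (e₃ - e₁)) • ⁅p₁, ⁅p₃, p₁⁆⁆ + (-6 * (e₂ - e₃)) • ⁅p₂, ⁅p₂, p₃⁆⁆ = p₃) (z : R) :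
    (3 : R) • ⁅quad e₁ e₂ e₃ z • p₁ + quad e₂ e₃ e₁ z • p₂ + quad e₃ e₁ e₂ z • p₃,
      ⁅quad e₁ e₂ e₃ z • p₁ + quad e₂ e₃ e₁ z • p₂ + quad e₃ e₁ e₂ z • p₃,
      (2 * (z - e₁)) • p₁ + (2 * (z - e₂)) • p₂ + (2 * (z - e₃)) • p₃⁆⁆ =
      (2 * ((z - e₁) * (z - e₂) * (z - e₃))) •
        ((2 * (z - e₁)) • p₁ + (2 * (z - e₂)) • p₂ + (2 * (z - e₃)) • p₃) -
      ((z - e₁) * (z - e₂) + (z - e₂) * (z - e₃) + (z - e₃) * (z - e₁)) •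
        (quad e₁ e₂ e₃ z • p₁ + quad e₂ e₃ e₁ z • p₂ + quad e₃ e₁ e₂ z • p₃) := by
  have e1 : ∀ e₁ e₂ e₃ z : R, quad e₂ e₃ e₁ z * quad e₃ e₁ e₂ z =
      2 * ((z - e₁) * (z - e₂) * (z - e₃)) * (2 * (z - e₁)) -
      ((z - e₁) * (z - e₂) + (z - e₂) * (z - e₃) + (z - e₃) * (z - e₁)) * quad e₁ e₂ e₃ z := by
    intro e₁ e₂ e₃ z
    simp only [quad]
    ring
  have w₁ := congrArg (fun y => (quad e₂ e₃ e₁ z * quad e₃ e₁ e₂ z) • y) v₁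
  have w₂ := congrArg (fun y => (quad e₃ e₁ e₂ z * quad e₁ e₂ e₃ z) • y) v₂
  have w₃ := congrArg (fun y => (quad e₁ e₂ e₃ z * quad e₂ e₃ e₁ z) • y) v₃
  rw [show (quad e₂ e₃ e₁ z * quad e₃ e₁ e₂ z) • p₁ = _ from congrArg (· • p₁) (e1 e₁ e₂ e₃ z)] at w₁
  rw [show (quad e₃ e₁ e₂ z * quad e₁ e₂ e₃ z) • p₂ = _ from congrArg (· • p₂) (e1 e₂ e₃ e₁ z)] at w₂
  rw [show (quad e₁ e₂ e₃ z * quad e₂ e₃ e₁ z) • p₃ = _ from congrArg (· • p₃) (e1 e₃ e₁ e₂ z)] at w₃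
  rw [lie_quad]
  simp only [lie_add, add_lie, smul_lie, lie_smul, t₁, t₂, t₃, smul_zero, zero_add, add_zero]
  linear_combination (norm := module) w₁ + w₂ + w₃

variable {L : Type*} [LieRing L] [LieAlgebra ℂ L] {e κ : Fin 3 → ℂ} {p : Fin 3 → L}

/-- The series `∑ κ_i ((u₀ - e_i)² - d_i) p_i`. -/
def quadSeries (e κ : Fin 3 → ℂ) (a : Coord → ℂ) (p : Fin 3 → L) : MvPowerSeries Coord L :=
  quad (MvPowerSeries.C (e 0)) (MvPowerSeries.C (e 1)) (MvPowerSeries.C (e 2))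
      (coordSeries a (.u 0)) • constSeries (κ 0 • p 0) +
    quad (MvPowerSeries.C (e 1)) (MvPowerSeries.C (e 2)) (MvPowerSeries.C (e 0))
      (coordSeries a (.u 0)) • constSeries (κ 1 • p 1) +
    quad (MvPowerSeries.C (e 2)) (MvPowerSeries.C (e 0)) (MvPowerSeries.C (e 1))
      (coordSeries a (.u 0)) • constSeries (κ 2 • p 2)

variable {a : Coord → ℂ}

theorem pd_quadSeries_of_ne {s : Coord} (hs : s ≠ .u 0) : pd s (quadSeries e κ a p) = 0 := by
  have h : ∀ c d f : ℂ, pd s (quad (MvPowerSeries.C c) (MvPowerSeries.C d) (MvPowerSeries.C f)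
      (coordSeries a (.u 0))) = 0 := by
    intro c d f
    simp only [quad, pd_sub, pd_mul, pd_pow, pd_C, pd_coordSeries_of_ne a hs]
    ring
  simp only [quadSeries, pd_add, pd_smul, pd_constSeries, h, zero_smul, smul_zero, add_zero]

theorem pd_zero_quadSeries : pd (.u 0) (quadSeries e κ a p) =
    (2 * (coordSeries a (.u 0) - MvPowerSeries.C (e 0))) • constSeries (κ 0 • p 0) +
    (2 * (coordSeries a (.u 0) - MvPowerSeries.C (e 1))) • constSeries (κ 1 • p 1) +
    (2 * (coordSeries a (.u 0) - MvPowerSeries.C (e 2))) • constSeries (κ 2 • p 2) := by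
  have h : ∀ c d f : ℂ, pd (.u 0) (quad (MvPowerSeries.C c) (MvPowerSeries.C d)
      (MvPowerSeries.C f) (coordSeries a (.u 0))) =
      2 * (coordSeries a (.u 0) - MvPowerSeries.C c) := by
    intro c d f
    simp only [quad, pd_sub, pd_mul, pd_pow, pd_C, pd_coordSeries_self]
    push_cast
    ring
  simp only [quadSeries, pd_add, pd_smul, pd_constSeries, h, smul_zero, add_zero]

theorem pd_zero_pd_zero_quadSeries : pd (.u 0) (pd (.u 0) (quadSeries e κ a p)) =
    (2 : MvPowerSeries Coord ℂ) •
      (constSeries (κ 0 • p 0) + constSeries (κ 1 • p 1) + constSeries (κ 2 • p 2)) := by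
  have p2 : pd (.u 0) (2 : MvPowerSeries Coord ℂ) = 0 := pd_ofNat _ 2
  simp only [pd_zero_quadSeries, pd_add, pd_smul, pd_mul, pd_sub, p2, pd_C, pd_constSeries,
    pd_coordSeries_self]
  module

theorem pd_three_quadSeries : pd (.u 0) (pd (.u 0) (pd (.u 0) (quadSeries e κ a p))) = 0 := by
  have p2 : pd (.u 0) (2 : MvPowerSeries Coord ℂ) = 0 := pd_ofNat _ 2
  simp only [pd_zero_pd_zero_quadSeries, pd_add, pd_smul, p2, pd_constSeries]
  module

theorem lie_lie_smul_of_normalizing {x y z k₁ k₂ k₃ : ℂ} {p₁ p₂ p₃ : L} (hxy : x ≠ y)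
    (e1 : k₁ ^ 2 * (6 * ((x - y) * (x - z))) = -1) (e2 : k₂ ^ 2 * (6 * ((y - z) * (y - x))) = -1)
    (h : ⁅p₁, ⁅p₁, p₃⁆⁆ - ⁅p₂, ⁅p₂, p₃⁆⁆ = (x - y) • p₃) :
    (-6 * (z - x)) • ⁅k₁ • p₁, ⁅k₃ • p₃, k₁ • p₁⁆⁆ +
      (-6 * (y - z)) • ⁅k₂ • p₂, ⁅k₂ • p₂, k₃ • p₃⁆⁆ = k₃ • p₃ := by
  have hd := sub_ne_zero.mpr hxy
  simp only [smul_lie, lie_smul, smul_smul]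
  rw [← lie_skew p₃ p₁, lie_neg]
  have h3 := congrArg ((k₃ * (x - y)⁻¹) • ·) h
  simp only [smul_sub, smul_smul] at h3
  rw [inv_mul_cancel_right₀ hd] at h3
  have c1 : -6 * (z - x) * (k₁ * (k₃ * k₁)) = -(k₃ * (x - y)⁻¹) := by
    field_simp
    linear_combination k₃ * e1
  have c2 : -6 * (y - z) * (k₂ * (k₂ * k₃)) = -(k₃ * (x - y)⁻¹) := by
    field_simp
    linear_combination k₃ * e2
  linear_combination (norm := module) h3 - c1 • ⁅p₁, ⁅p₁, p₃⁆⁆ + c2 • ⁅p₂, ⁅p₂, p₃⁆⁆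

theorem EllipticTriple.lie_lie_quadSeries (hp : EllipticTriple e p) (h₀₁ : e 0 ≠ e 1)
    (h₁₂ : e 1 ≠ e 2) (h₂₀ : e 2 ≠ e 0) (hκ : IsNormalizing e κ) :
    (3 : MvPowerSeries Coord ℂ) • ⁅quadSeries e κ a p, ⁅quadSeries e κ a p,
      pd (.u 0) (quadSeries e κ a p)⁆⁆ = (2 * cubic e a) • pd (.u 0) (quadSeries e κ a p) -
      pd (.u 0) (cubic e a) • quadSeries e κ a p := by
  have n0 : κ 0 ^ 2 * (6 * ((e 0 - e 1) * (e 0 - e 2))) = -1 := hκ 0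
  have n1 : κ 1 ^ 2 * (6 * ((e 1 - e 2) * (e 1 - e 0))) = -1 := hκ 1
  have n2 : κ 2 ^ 2 * (6 * ((e 2 - e 0) * (e 2 - e 1))) = -1 := hκ 2
  have t0 : ⁅p 0, ⁅p 1, p 2⁆⁆ = 0 := hp.lie_lie_eq_zero 0
  have t1 : ⁅p 1, ⁅p 2, p 0⁆⁆ = 0 := hp.lie_lie_eq_zero 1
  have t2 : ⁅p 2, ⁅p 0, p 1⁆⁆ = 0 := hp.lie_lie_eq_zero 2
  have r0 : ⁅p 0, ⁅p 0, p 2⁆⁆ - ⁅p 1, ⁅p 1, p 2⁆⁆ = (e 0 - e 1) • p 2 :=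
    hp.lie_lie_sub 0
  have r1 : ⁅p 1, ⁅p 1, p 0⁆⁆ - ⁅p 2, ⁅p 2, p 0⁆⁆ = (e 1 - e 2) • p 0 :=
    hp.lie_lie_sub 1
  have r2 : ⁅p 2, ⁅p 2, p 1⁆⁆ - ⁅p 0, ⁅p 0, p 1⁆⁆ = (e 2 - e 0) • p 1 :=
    hp.lie_lie_sub 2
  have v2 := congrArg constSeries (lie_lie_smul_of_normalizing (k₃ := κ 2) h₀₁
    n0 n1 r0)
  have v0 := congrArg constSeries (lie_lie_smul_of_normalizing (k₃ := κ 0) h₁₂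
    n1 n2 r1)
  have v1 := congrArg constSeries (lie_lie_smul_of_normalizing (k₃ := κ 1) h₂₀
    n2 n0 r2)
  have c6 : (MvPowerSeries.C (-6 : ℂ) : MvPowerSeries Coord ℂ) = -6 := by
    rw [map_neg, map_ofNat]
  rw [constSeries_add, constSeries_smul, constSeries_smul] at v0 v1 v2
  simp only [constSeries_lie, map_mul, map_sub, c6] at v0 v1 v2
  have s : ∀ i j k, ⁅p i, ⁅p j, p k⁆⁆ = 0 → ⁅constSeries (κ i • p i), ⁅constSeries (κ j • p j),
      constSeries (κ k • p k)⁆⁆ = 0 := by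
    intro i j k h
    rw [← constSeries_lie, ← constSeries_lie]
    simp only [smul_lie, lie_smul, h, smul_zero, constSeries_zero]
  rw [pd_zero_quadSeries, pd_zero_cubic, cubic]
  simp only [quadSeries]
  have s0 := s 0 1 2 t0
  have s1 := s 1 2 0 t1
  have s2 := s 2 0 1 t2
  generalize constSeries (κ 0 • p 0) = q0 at *
  generalize constSeries (κ 1 • p 1) = q1 at *
  generalize constSeries (κ 2 • p 2) = q2 at *
  exact lie_lie_quad s0 s1 s2 v0 v1 v2 (coordSeries a (.u 0))

theorem quadSeries_apply_zero : quadSeries e κ a p 0 =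
    quad (e 0) (e 1) (e 2) (a (.u 0)) • κ 0 • p 0 + quad (e 1) (e 2) (e 0) (a (.u 0)) • κ 1 • p 1 +
      quad (e 2) (e 0) (e 1) (a (.u 0)) • κ 2 • p 2 := by
  simp only [quadSeries, quad, series_add_apply, smul_apply_zero, constSeries_zero_apply, map_sub,
    map_pow, map_mul, MvPowerSeries.constantCoeff_C, constantCoeff_coordSeries]

theorem pd_zero_quadSeries_apply_zero : pd (.u 0) (quadSeries e κ a p) 0 =
    (2 * (a (.u 0) - e 0)) • κ 0 • p 0 + (2 * (a (.u 0) - e 1)) • κ 1 • p 1 +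
      (2 * (a (.u 0) - e 2)) • κ 2 • p 2 := by
  have n2 : MvPowerSeries.constantCoeff (2 : MvPowerSeries Coord ℂ) = 2 := map_ofNat _ 2
  simp only [pd_zero_quadSeries, series_add_apply, smul_apply_zero, constSeries_zero_apply, map_sub,
    map_mul, n2, MvPowerSeries.constantCoeff_C, constantCoeff_coordSeries]

theorem pd_zero_pd_zero_quadSeries_apply_zero :
    pd (.u 0) (pd (.u 0) (quadSeries e κ a p)) 0 =
      (2 : ℂ) • (κ 0 • p 0 + κ 1 • p 1 + κ 2 • p 2) := by
  have n2 : MvPowerSeries.constantCoeff (2 : MvPowerSeries Coord ℂ) = 2 := map_ofNat _ 2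
  simp only [pd_zero_pd_zero_quadSeries, series_add_apply, smul_apply_zero, constSeries_zero_apply,
    n2]

theorem quadCoeff_quadSeries (h₀₁ : e 0 ≠ e 1) (h₁₂ : e 1 ≠ e 2) (h₂₀ : e 2 ≠ e 0)
    (hκ : ∀ i, κ i ≠ 0) : quadCoeff e κ (a (.u 0)) (quadSeries e κ a p 0)
      (pd (.u 0) (quadSeries e κ a p) 0) (pd (.u 0) (pd (.u 0) (quadSeries e κ a p)) 0) = p := by
  funext i
  have hd := discr_ne_zero h₀₁ h₁₂ h₂₀ i
  have hi := hκ i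
  rw [quadCoeff, quadSeries_apply_zero, pd_zero_quadSeries_apply_zero,
    pd_zero_pd_zero_quadSeries_apply_zero, inv_smul_eq_iff₀ (mul_ne_zero hi (by simpa using hd))]
  fin_cases i <;>
  · simp only [discr, quad, Fin.zero_eta, Fin.mk_one, Fin.reduceFinMk, Fin.isValue, zero_add,
      Fin.reduceAdd]
    module

end Quadratic

section Tensor

/-- The second relation is the curve equation `v_{i+1}² - v_i² = e_i - e_{i+1}`. -/
theorem ellipticTriple_tmul {e : Fin 3 → ℂ} {α : Module.Basis (Fin 3) ℂ SO3}
    (hα : IsStandardBasis α) : EllipticTriple e fun i => vHat e i ⊗ₜ[ℂ] α i := by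
  have hb : ∀ i : Fin 3, ⁅α (i + 1), α (i + 2)⁆ = α i := by
    obtain ⟨h1, h2, h3⟩ := hα
    intro i
    fin_cases i
    · exact h2
    · exact h3
    · exact h1
  refine ⟨fun i => ?_, fun i => ?_⟩
  · rw [LieAlgebra.ExtendScalars.bracket_tmul, LieAlgebra.ExtendScalars.bracket_tmul, hb, lie_self,
      TensorProduct.tmul_zero]
  · obtain ⟨h1, h2, h3, h4⟩ := fin3_add i
    have b1 : ⁅α i, α (i + 2)⁆ = -α (i + 1) := by
      have := hb (i + 1)
      rw [h1, h2] at this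
      rw [← this, lie_skew]
    have b2 : ⁅α i, α (i + 1)⁆ = α (i + 2) := by
      have := hb (i + 2)
      rwa [h3, h4] at this
    simp only [LieAlgebra.ExtendScalars.bracket_tmul, hb, b1, lie_neg, b2]
    rw [← lie_skew (α (i + 1)), b2, TensorProduct.tmul_neg, TensorProduct.tmul_neg,
      ← sub_eq_zero, sub_neg_eq_add, neg_add_eq_sub, ← TensorProduct.sub_tmul,
      TensorProduct.smul_tmul', ← TensorProduct.sub_tmul]
    have hs : (e i - e (i + 1)) • vHat e (i + 2) =
      algebraMap ℂ (CurveAlg e) (e i - e (i + 1)) * vHat e (i + 2) := curve_smul_def e _ _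
    rw [hs, map_sub]
    have k1 := curveLambda_eq e i
    have k2 := curveLambda_eq e (i + 1)
    rw [show vHat e (i + 1) * (vHat e (i + 1) * vHat e (i + 2)) -
      vHat e i * (vHat e i * vHat e (i + 2)) - (algebraMap ℂ (CurveAlg e) (e i) -
      algebraMap ℂ (CurveAlg e) (e (i + 1))) * vHat e (i + 2) = 0 by
        linear_combination vHat e (i + 2) * (k1 - k2), TensorProduct.zero_tmul]

end Tensor
end
end ZCR

namespace ZCR

open Finset TensorProduct

noncomputable section

/-! ### From the reduced equations back to the normal form -/

section Normal

variable {e : Fin 3 → ℂ} {a : Coord → ℂ} {L : Type*} [LieRing L] [LieAlgebra ℂ L]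
  {α γ G : MvPowerSeries Coord L}

theorem alphaSeries_wSeries_smul (ha : a ∈ knProlongation) (hα : pd (.u 1) α = 0)
    (hγ : pd (.u 1) γ = 0) : alphaSeries a (wSeries a • α + γ) = α := by
  have hu := u_mul_uInv ha
  have h2 := C_half
  have h1 : pd (.u 1) (pd (.u 1) (wSeries a • α + γ)) = (2 * uInv a ^ 3) • α := by
    rw [pd_add, pd_smul, hα, hγ, smul_zero, add_zero, add_zero, pd_smul, hα, pd_one_wSeries ha,
      pd_sub, pd_invSq, pd_pow, pd_one_uInv ha]
    push_cast
    module
  rw [alphaSeries, h1, smul_smul, show MvPowerSeries.C (1 / 2) * coordSeries a (.u 1) ^ 3 *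
    (2 * uInv a ^ 3) = 1 by grind, one_smul]

theorem pd_bSeries_of_four_le (ha : a ∈ knProlongation) (hα : ∀ k, pd (.u (k + 1)) α = 0) {k : ℕ}
    (hk : 4 ≤ k) : pd (.u k) (bSeries e a α) = 0 := by
  obtain ⟨k, rfl⟩ : ∃ j, k = j + 1 := ⟨k - 1, by omega⟩
  have p2 : ∀ s, pd s (2 : MvPowerSeries Coord ℂ) = 0 := fun s => pd_ofNat _ 2
  have p3 : ∀ s, pd s (3 : MvPowerSeries Coord ℂ) = 0 := fun s => pd_ofNat _ 3
  have h0 : pd (.u (k + 1)) (pd (.u 0) α) = 0 := by rw [pd_comm, hα, pd_zero]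
  have h00 : pd (.u (k + 1)) (pd (.u 0) (pd (.u 0) α)) = 0 := by rw [pd_comm, h0, pd_zero]
  simp only [bSeries, pd_add, pd_sub, pd_smul, pd_mul, pd_pow, pd_C, pd_invSq, pd_lie,
    pd_uInv_of_ne ha (show Coord.u (k + 1) ≠ .u 1 by simp; omega),
    pd_u_coordSeries, p2, p3, hα, h0, h00, pd_cubic_of_ne e a (show Coord.u (k + 1) ≠ .u 0 by simp)]
  simp only [show k + 1 ≠ 3 by omega, show k + 1 ≠ 2 by omega, show k + 1 ≠ 1 by omega, if_false,
    zero_lie, lie_zero]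
  module

/-- As `∂₀G = 0`, bracketing with `G` obeys the same rules as `∂_t` on everything built from `α` and
its `u₀`-derivatives. -/
theorem pd_t_bSeries (ha : a ∈ knProlongation) (h : pd .t α = ⁅α, G⁆) (hG : pd (.u 0) G = 0) :
    pd .t (bSeries e a α) = ⁅bSeries e a α, G⁆ := by
  have p2 : ∀ s, pd s (2 : MvPowerSeries Coord ℂ) = 0 := fun s => pd_ofNat _ 2
  have p3 : ∀ s, pd s (3 : MvPowerSeries Coord ℂ) = 0 := fun s => pd_ofNat _ 3
  have h0 : pd .t (pd (.u 0) α) = ⁅pd (.u 0) α, G⁆ := by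
    rw [pd_comm, h, pd_lie, hG, lie_zero, add_zero]
  have h00 : pd .t (pd (.u 0) (pd (.u 0) α)) = ⁅pd (.u 0) (pd (.u 0) α), G⁆ := by
    rw [pd_comm, h0, pd_lie, hG, lie_zero, add_zero]
  have hl : pd .t ⁅α, pd (.u 0) α⁆ = ⁅⁅α, pd (.u 0) α⁆, G⁆ := by
    rw [pd_lie, h, h0, lie_lie, ← lie_skew G (pd (.u 0) α), lie_neg,
      ← lie_skew ⁅α, pd (.u 0) α⁆ G]
    abel
  simp only [bSeries, pd_add, pd_sub, pd_smul, pd_mul, pd_pow, pd_C, pd_invSq,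
    pd_uInv_of_ne ha (show Coord.t ≠ .u 1 by simp), p2, p3, h, h0, h00, hl,
    pd_coordSeries_of_ne a (show Coord.t ≠ .u 3 by simp),
    pd_coordSeries_of_ne a (show Coord.t ≠ .u 2 by simp),
    pd_coordSeries_of_ne a (show Coord.t ≠ .u 1 by simp),
    pd_cubic_of_ne e a (show Coord.t ≠ .u 0 by simp), add_lie, sub_lie, smul_lie]
  module

/-- A solution of the reduced equations with the normalization at the base point gives a
zero-curvature representation in normal form. -/
theorem IsReducedZCR.isNormalZCR (h : IsReducedZCR e a α γ G) (ha : a ∈ knProlongation)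
    (hγ : VanishesOnBase (γ + (MvPowerSeries.C (2 * (a (.u 1))⁻¹) : MvPowerSeries Coord ℂ) • α))
    (hG : ∀ s, pd s G = 0) (hB : (bSeries e a α + G) 0 = 0) :
    IsNormalZCR a 3 (knRHS e a) 1 (wSeries a • α + γ) (bSeries e a α + G) where
  pd_eq_zero k hk := by
    obtain ⟨k, rfl⟩ : ∃ j, k = j + 1 := ⟨k - 1, by omega⟩
    rw [pd_add, pd_smul, h.pd_u_γ, h.horizontal.pd_u, pd_wSeries_of_ne ha (by simp; omega),
      zero_smul, smul_zero, add_zero, add_zero]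
  coeff_zero m hm := by
    have := hγ m hm
    rw [series_add_apply, C_smul] at this
    rw [series_add_apply, wSeries_smul_apply ha _ (hm 1), add_comm, this]
  coeff_normal m hm hn := by
    obtain ⟨r, h1, h2, h3, -⟩ := hn
    obtain rfl : r = 1 := by omega
    have hle : Finsupp.single (Coord.u 1) 1 ≤ m := by rw [Finsupp.single_le_iff]; omega
    have hz : (m - Finsupp.single (Coord.u 1) 1 : Mon) (.u 1) = 0 := by simp [h3]
    have hA : pd (.u 1) (wSeries a • α + γ) = -((uInv a ^ 2 - invSq a) • α) := by
      rw [pd_add, pd_smul, h.pd_u_γ, h.horizontal.pd_u 0, pd_one_wSeries ha]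
      module
    obtain ⟨g, hg⟩ := uInv_sq_sub_invSq_eq ha
    have h4 := congrFun hA (m - Finsupp.single (Coord.u 1) 1)
    rw [coeff_pd, tsub_add_cancel_of_le hle, hz, zero_add, one_smul, hg, series_neg_apply,
      coeff_X_mul_smul _ _ _ hz, neg_zero] at h4
    exact h4
  pd_B k hk := by rw [pd_add, hG, pd_bSeries_of_four_le ha h.horizontal.pd_u (by omega), add_zero]
  zcr := h.zcr ha
  coeff_B := by
    -- This linear equation in `t` propagates the vanishing of `B` from the base point to all terms
    -- in `t` alone.
    have ht : pd .t (bSeries e a α + G) = ⁅bSeries e a α + G, G⁆ := by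
      rw [pd_add, hG, pd_t_bSeries ha (sub_eq_zero.mp h.pd_t).symm h.pd_zero_G, add_lie, lie_self]
    have main : ∀ n, ∀ m : Mon, m .t = n → m .x = 0 → (∀ k, m (.u k) = 0) →
        (bSeries e a α + G) m = 0 := by
      intro n
      induction n with
      | zero =>
        intro m h1 h2 h3
        have : m = 0 := by
          ext c
          cases c with
          | x => exact h2
          | t => exact h1
          | u k => exact h3 k
        rw [this, hB]
      | succ n ih =>
        intro m h1 h2 h3
        have hle : Finsupp.single Coord.t 1 ≤ m := by rw [Finsupp.single_le_iff]; omega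
        have h4 := congrFun ht (m - Finsupp.single Coord.t 1)
        rw [coeff_pd, tsub_add_cancel_of_le hle, ← Nat.cast_smul_eq_nsmul ℂ,
          eq_constSeries hG] at h4
        rw [← eq_constSeries hG, lie_eq_sum_of_coeff] at h4
        · exact (smul_eq_zero.mp h4).resolve_left (Nat.cast_ne_zero.mpr (Nat.succ_ne_zero _))
        · intro q r hqr
          by_cases hr : r = 0
          · rw [hr, add_zero] at hqr
            rw [hqr, ih, zero_lie]
            · simp [h1]
            · simp [h2]
            · intro k
              simp [h3]
          · rw [eq_constSeries hG, constSeries_of_ne _ hr, lie_zero]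
    exact fun m hx hm => main _ m rfl hx hm

end Normal

/-! ### Gauge transformations of the quadratic series -/

section Gauge

variable {e : Fin 3 → ℂ} {a : Coord → ℂ} {L : Type*} [LieRing L] [LieAlgebra ℂ L]
  {s : Coord} {η α γ Y : MvPowerSeries Coord L}

theorem nabla_covTaylor (hs : .u 0 ≠ s) (hη : pd (.u 0) η = 0) :
    nabla a (covTaylor s η α) (covTaylor s η Y) = covTaylor s η (nabla a α Y) := by
  rw [nabla, nabla, pd_covTaylor_of_ne hs hη, covTaylor_add, covTaylor_smul, covTaylor_lie]

/-- The gauge in `u₀` with `η = -a₁⁻² α` turns `∂₀` into `∇`. -/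
theorem nabla_covTaylor_zero (Y : MvPowerSeries Coord L) :
    nabla a (covTaylor (.u 0) (-(invSq a • α)) α) (covTaylor (.u 0) (-(invSq a • α)) Y) =
      covTaylor (.u 0) (-(invSq a • α)) (pd (.u 0) Y) := by
  rw [nabla, pd_covTaylor, covDeriv, covTaylor_add, ← covTaylor_lie, ← covTaylor_smul,
    ← covTaylor_add, ← covTaylor_add]
  congr 1
  rw [neg_lie, smul_lie]
  abel

theorem bSeries_covTaylor (hs : .u 0 ≠ s) (hη : pd (.u 0) η = 0) :
    bSeries e a (covTaylor s η α) = covTaylor s η (bSeries e a α) := by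
  simp only [bSeries, pd_covTaylor_of_ne hs hη, ← covTaylor_lie, ← covTaylor_smul, ← covTaylor_add,
    ← covTaylor_sub]

variable {p : MvPowerSeries Coord L}

/-- A series in `u₀` satisfying the third order equations is the gauge transform of a solution of
the reduced equations. -/
theorem exists_isReducedZCR (hp : ∀ s, s ≠ .u 0 → pd s p = 0)
    (hp3 : pd (.u 0) (pd (.u 0) (pd (.u 0) p)) = 0)
    (hl : (3 : MvPowerSeries Coord ℂ) • ⁅p, ⁅p, pd (.u 0) p⁆⁆ = (2 * cubic e a) • pd (.u 0) p -
      pd (.u 0) (cubic e a) • p) :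
    ∃ α γ G : MvPowerSeries Coord L, IsReducedZCR e a α γ G ∧
      VanishesOnBase (γ + (MvPowerSeries.C (2 * (a (.u 1))⁻¹) : MvPowerSeries Coord ℂ) • α) ∧
      (∀ s, pd s G = 0) ∧ (bSeries e a α + G) 0 = 0 ∧
      ∀ k, jet a α k = ((pd (.u 0))^[k] p) 0 := by
  -- Three successive gauges: `h` in `u₀` makes the third covariant derivative vanish, `X`
  -- introduces the required dependence on `x`, and `T` that on `t`.
  set h := covTaylor (.u 0) (-(invSq a • p)) with hh
  -- This value of `γ` at the base makes `A = wα + γ` vanish there, since `w` equals `2a₁⁻¹` at `u₁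
  -- = a₁`.
  set c := constSeries (-(2 * (a (.u 1))⁻¹) • p 0) with hc
  set X := covTaylor .x (-c) with hX
  -- The constant is forced by `B = 0` at the base point.
  set g := constSeries (-(bSeries e a (X (h p)) 0)) with hg
  set T := covTaylor .t (-g) with hT
  have hcs : ∀ s, pd s (-c) = 0 := fun s => by rw [pd_neg, hc, pd_constSeries, neg_zero]
  have hgs : ∀ s, pd s (-g) = 0 := fun s => by rw [pd_neg, hg, pd_constSeries, neg_zero]
  have hps : ∀ s, s ≠ .u 0 → pd s (-(invSq a • p)) = 0 := fun s hs => by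
    rw [pd_neg, pd_smul, pd_invSq, hp s hs, zero_smul, smul_zero, add_zero, neg_zero]
  have hα1 : ∀ s, s ≠ .u 0 → pd s (h p) = 0 := fun s hs => by
    rw [hh, pd_covTaylor_of_ne hs (hps s hs), hp s hs, covTaylor_zero]
  have hα2 : ∀ s, s ≠ .u 0 → s ≠ .x → pd s (X (h p)) = 0 := fun s hs hx => by
    rw [hX, pd_covTaylor_of_ne hx (hcs s), hα1 s hs, covTaylor_zero]
  have hnab : ∀ Y, nabla a (T (X (h p))) (T (X (h Y))) = T (X (h (pd (.u 0) Y))) := fun Y => by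
    rw [hT, nabla_covTaylor (by simp) (hgs _), hX, nabla_covTaylor (by simp) (hcs _), hh,
      nabla_covTaylor_zero]
  have hXc : X c = c := covTaylor_eq_self (by
    rw [covDeriv, neg_lie, lie_self, neg_zero, add_zero, hc, pd_constSeries]) (pd_constSeries _ _)
  have hTg : T g = g := covTaylor_eq_self (by
    rw [covDeriv, neg_lie, lie_self, neg_zero, add_zero, hg, pd_constSeries]) (pd_constSeries _ _)
  have hTt : ∀ Y, pd .t Y = 0 → pd .t (T Y) = ⁅T Y, g⁆ := fun Y hY => by
    rw [hT, pd_covTaylor, covDeriv, hY, zero_add, neg_lie, covTaylor_neg, covTaylor_lie, ← hT, hTg,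
      lie_skew]
  have hbase : VanishesOnBase (h p - constSeries (p 0)) := by
    intro m hm
    rw [series_sub_apply, sub_eq_zero]
    by_cases h0 : m = 0
    · rw [h0, hh, covTaylor_apply_of_eq_zero (by simp), constSeries_zero_apply]
    · rw [constSeries_of_ne _ h0]
      obtain ⟨s, hs⟩ : ∃ s, m s ≠ 0 := by
        by_contra! hcon
        exact h0 (Finsupp.ext hcon)
      exact coeff_eq_zero_of_pd (hα1 s (by rintro rfl; exact hs (hm 0))) hs
  refine ⟨T (X (h p)), T c, g, ⟨⟨?_, ?_⟩, ?_, ?_, ?_, ?_, ?_, ?_, ?_⟩, ?_, ?_, ?_, ?_⟩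
  · intro k
    rw [hT, pd_covTaylor_of_ne (by simp) (hgs _), hα2 _ (by simp) (by simp), covTaylor_zero]
  · rw [hT, pd_covTaylor_of_ne (by simp) (hgs _), hX, pd_covTaylor, covDeriv, hα1 .x (by simp),
      zero_add, neg_lie, covTaylor_neg, covTaylor_lie, covTaylor_neg, covTaylor_lie, ← hX, hXc]
  · intro k
    rw [hT, pd_covTaylor_of_ne (by simp) (hgs _), hc, pd_constSeries, covTaylor_zero]
  · exact fun k => pd_constSeries _ _
  · have h1 := congrArg (fun Y => (MvPowerSeries.C (2 / 3) : MvPowerSeries Coord ℂ) • T (X (h Y))) hl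
    have h0 : pd (.u 0) (T (X (h p))) = T (X (h (pd (.u 0) p))) := by
      rw [← hnab, nabla_self]
    simp only [hh, hX, hT, covTaylor_smul, covTaylor_lie, covTaylor_sub] at h1
    simp only [← hh, ← hX, ← hT, ← h0] at h1
    have c23 : MvPowerSeries.C (2 / 3 : ℂ) * 3 = (2 : MvPowerSeries Coord ℂ) := by
      rw [← map_ofNat MvPowerSeries.C 3, ← map_ofNat MvPowerSeries.C 2, ← map_mul]
      norm_num
    have c43 : MvPowerSeries.C (4 / 3 : ℂ) =
        (2 * MvPowerSeries.C (2 / 3) : MvPowerSeries Coord ℂ) := by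
      rw [← map_ofNat MvPowerSeries.C 2, ← map_mul]
      norm_num
    generalize T (X (h p)) = α at h1 ⊢
    linear_combination (norm := module) h1 - c23 • ⁅α, ⁅α, pd (.u 0) α⁆⁆ -
      (c43 * cubic e a) • pd (.u 0) α
  · rw [hTt _ (hα2 _ (by simp) (by simp)), sub_self]
  · rw [hTt c (pd_constSeries _ _), add_sub_cancel_right]
    exact pd_constSeries _ _
  · exact pd_constSeries _ _
  · rw [← nabla_nabla_nabla, hnab, hnab, hnab, hp3, hh, covTaylor_zero, hX, covTaylor_zero, hT,
      covTaylor_zero]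
  · rw [← hXc, hT, hX, ← covTaylor_smul, ← covTaylor_smul, ← covTaylor_add, ← covTaylor_add]
    refine VanishesOnBase.covTaylor (by simp) (VanishesOnBase.covTaylor (by simp) fun m hm => ?_)
    have := hbase m hm
    rw [hc, constSeries_smul, map_neg, neg_smul, neg_add_eq_sub, ← smul_sub, C_smul, this,
      smul_zero]
  · exact fun s => pd_constSeries _ _
  · rw [hT, bSeries_covTaylor (by simp) (hgs _), series_add_apply,
      covTaylor_apply_of_eq_zero (by simp), hg, constSeries_zero_apply, add_neg_cancel]
  · intro k
    have : (nabla a (T (X (h p))))^[k] (T (X (h p))) = T (X (h ((pd (.u 0))^[k] p))) := by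
      induction k with
      | zero => rfl
      | succ k ih => rw [Function.iterate_succ_apply', ih, hnab, Function.iterate_succ_apply']
    rw [jet, this, hT, covTaylor_apply_of_eq_zero (by simp), hX,
      covTaylor_apply_of_eq_zero (by simp), hh, covTaylor_apply_of_eq_zero (by simp)]

end Gauge
end
end ZCR

namespace ZCR

open Finset TensorProduct

noncomputable section

/-! ### The isomorphism of 𝔽^1 with the elliptic algebra -/

section OrderOneAlgebra

variable {e κ : Fin 3 → ℂ} {a : Coord → ℂ} {L L' : Type*} [LieRing L] [LieAlgebra ℂ L] [LieRing L']
  [LieAlgebra ℂ L']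

theorem mapSeries_lie (φ : L →ₗ⁅ℂ⁆ L') (f g : MvPowerSeries Coord L) :
    mapSeries φ ⁅f, g⁆ = ⁅mapSeries φ f, mapSeries φ g⁆ := by
  funext m
  simp only [mapSeries, coeff_lie, map_sum, LieHom.map_lie]

theorem mapSeries_alphaSeries (φ : L →ₗ⁅ℂ⁆ L') (A : MvPowerSeries Coord L) :
    mapSeries φ (alphaSeries a A) = alphaSeries a (mapSeries φ A) := by
  rw [alphaSeries, alphaSeries, pd_mapSeries, pd_mapSeries]
  exact (mulSeries_mapSeries φ _ _).symm

theorem mapSeries_nabla (φ : L →ₗ⁅ℂ⁆ L') (α Y : MvPowerSeries Coord L) :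
    mapSeries φ (nabla a α Y) = nabla a (mapSeries φ α) (mapSeries φ Y) := by
  have h : mapSeries φ (invSq a • ⁅α, Y⁆) = invSq a • ⁅mapSeries φ α, mapSeries φ Y⁆ := by
    rw [← mapSeries_lie]
    exact (mulSeries_mapSeries φ _ _).symm
  rw [nabla, nabla, pd_mapSeries, ← h]
  funext m
  exact map_add φ _ _

theorem map_jet (φ : L →ₗ⁅ℂ⁆ L') (α : MvPowerSeries Coord L) (k : ℕ) :
    φ (jet a α k) = jet a (mapSeries φ α) k := by
  have h : mapSeries φ ((nabla a α)^[k] α) = (nabla a (mapSeries φ α))^[k] (mapSeries φ α) := by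
    induction k with
    | zero => rfl
    | succ k ih => rw [Function.iterate_succ_apply', mapSeries_nabla, ih,
        Function.iterate_succ_apply']
  exact congrFun h 0

theorem map_quadCoeff (φ : L →ₗ⁅ℂ⁆ L') (c : ℂ) (h₀ h₁ h₂ : L) (i : Fin 3) :
    φ (quadCoeff e κ c h₀ h₁ h₂ i) = quadCoeff e κ c (φ h₀) (φ h₁) (φ h₂) i := by
  simp only [quadCoeff, map_smul, map_sub]

/-- The gauge transform of `quadSeries` has the same jets at the base point as the quadratic series
has derivatives, so the generators are sent to the given triple. -/
theorem KNFd.exists_hom (ha : a ∈ knProlongation) (h₀₁ : e 0 ≠ e 1) (h₁₂ : e 1 ≠ e 2)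
    (h₂₀ : e 2 ≠ e 0) (hκ : IsNormalizing e κ) {q : Fin 3 → L} (hq : EllipticTriple e q) :
    ∃ ψ : KNFd e a 1 →ₗ⁅ℂ⁆ L, ∀ i, ψ (quadCoeff e κ (a (.u 0))
      (jet a (alphaSeries a (Fd.A a 3 (knRHS e a) 1)) 0)
      (jet a (alphaSeries a (Fd.A a 3 (knRHS e a) 1)) 1)
      (jet a (alphaSeries a (Fd.A a 3 (knRHS e a) 1)) 2) i) = q i := by
  obtain ⟨α, γ, G, hr, hγ, hG, hB, hj⟩ := exists_isReducedZCR (e := e) (a := a)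
    (fun s hs => pd_quadSeries_of_ne hs) pd_three_quadSeries
    (hq.lie_lie_quadSeries (a := a) h₀₁ h₁₂ h₂₀ hκ)
  obtain ⟨ψ, hψ⟩ := (hr.isNormalZCR ha hγ hG hB).exists_lift
  have hψ' : mapSeries ψ (alphaSeries a (Fd.A a 3 (knRHS e a) 1)) = α := by
    rw [mapSeries_alphaSeries, show mapSeries ψ (Fd.A a 3 (knRHS e a) 1) = _ from funext hψ]
    exact alphaSeries_wSeries_smul ha (hr.horizontal.pd_u 0) (hr.pd_u_γ 1)
  refine ⟨ψ, fun i => ?_⟩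
  rw [map_quadCoeff, map_jet, map_jet, map_jet, hψ', hj, hj, hj]
  exact congrFun (quadCoeff_quadSeries h₀₁ h₁₂ h₂₀ hκ.ne_zero) i

theorem KNFd.nonempty_equiv_ellipticAlg (ha : a ∈ knProlongation) (h₀₁ : e 0 ≠ e 1)
    (h₁₂ : e 1 ≠ e 2) (h₂₀ : e 2 ≠ e 0) {α : Module.Basis (Fin 3) ℂ SO3} (hα : IsStandardBasis α) :
    Nonempty (KNFd e a 1 ≃ₗ⁅ℂ⁆ ellipticAlg e α) := by
  obtain ⟨κ, hκ⟩ := exists_isNormalizing h₀₁ h₁₂ h₂₀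
  obtain ⟨ψ, hψ⟩ := KNFd.exists_hom ha h₀₁ h₁₂ h₂₀ hκ (ellipticTriple_tmul (e := e) hα)
  exact (KNFd.ellipticTriple ha h₀₁ h₁₂ h₂₀ hκ).nonempty_equiv hα
    (KNFd.lieSpan_quadCoeff ha h₀₁ h₁₂ h₂₀ hκ.ne_zero) hψ

end OrderOneAlgebra

/-! ### Central extensions and nilpotency -/

section CentralExtension

variable {e : Fin 3 → ℂ} {a : Coord → ℂ}

theorem isCentralExtension_of_surjective {L L₁ : Type*} [LieRing L] [LieAlgebra ℂ L] [LieRing L₁]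
    [LieAlgebra ℂ L₁] (φ : L₁ →ₗ⁅ℂ⁆ L) (hφ : Function.Surjective φ)
    (h : φ.ker ≤ LieAlgebra.center ℂ L₁) : IsCentralExtension L L₁ :=
  ⟨φ.ker, h, ⟨φ.quotKerEquivRange.trans
    ((LieEquiv.ofEq _ _ (by rw [(LieHom.range_eq_top φ).mpr hφ])).trans
      LieSubalgebra.topEquiv)⟩⟩

theorem KNFd.isCentralExtension (ha : a ∈ knProlongation) (p : ℕ) :
    IsCentralExtension (KNFd e a (p + 1)) (KNFd e a (p + 2)) :=
  isCentralExtension_of_surjective (KNFd.map e a (p + 1)) Fd.map_surjective (ker_map_le_center ha p)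

theorem isNilpotent_of_ker_le_center {L L₁ : Type*} [LieRing L] [LieAlgebra ℂ L] [LieRing L₁]
    [LieAlgebra ℂ L₁] (φ : L₁ →ₗ⁅ℂ⁆ L) (h : φ.ker ≤ LieAlgebra.center ℂ L₁)
    (hL : LieRing.IsNilpotent L) : LieRing.IsNilpotent L₁ := by
  refine LieAlgebra.nilpotent_of_nilpotent_quotient h ?_
  have : LieRing.IsNilpotent φ.range :=
    Function.Injective.lieAlgebra_isNilpotent (R := ℂ) (f := φ.range.incl) Subtype.val_injective
  exact (LieEquiv.nilpotent_iff_equiv_nilpotent φ.quotKerEquivRange).mpr this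

/-- The kernel of the composition maps to the kernel of `ψ`, and what is lost is central. -/
theorem isNilpotent_ker_comp {L L₁ L₂ : Type*} [LieRing L] [LieAlgebra ℂ L] [LieRing L₁]
    [LieAlgebra ℂ L₁] [LieRing L₂] [LieAlgebra ℂ L₂] (ψ : L₁ →ₗ⁅ℂ⁆ L) (φ : L₂ →ₗ⁅ℂ⁆ L₁)
    (hφ : φ.ker ≤ LieAlgebra.center ℂ L₂) (h : LieRing.IsNilpotent ψ.ker) :
    LieRing.IsNilpotent (ψ.comp φ).ker := by
  let θ : (ψ.comp φ).ker →ₗ⁅ℂ⁆ ψ.ker :=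
    { toFun := fun x => ⟨φ x.1, LieHom.mem_ker.mpr (LieHom.mem_ker.mp x.2)⟩
      map_add' := fun x y => Subtype.ext (map_add φ _ _)
      map_smul' := fun c x => Subtype.ext (map_smul φ c _)
      map_lie' := fun {x y} => Subtype.ext (LieHom.map_lie φ _ _) }
  refine isNilpotent_of_ker_le_center θ (fun x hx => ?_) h
  rw [LieModule.mem_maxTrivSubmodule]
  intro y
  have h1 : x.1 ∈ φ.ker := LieHom.mem_ker.mpr (congrArg Subtype.val (LieHom.mem_ker.mp hx))
  have h2 := hφ h1
  rw [LieModule.mem_maxTrivSubmodule] at h2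
  exact Subtype.ext (h2 y.1)

theorem KNFd.isNilpotent_ker_down (ha : a ∈ knProlongation) (j : ℕ) :
    LieRing.IsNilpotent (KNFd.down e a 1 j).ker := by
  induction j with
  | zero =>
    -- The kernel of the identity is zero; the target serves only as a Lie algebra known to be zero
    -- and hence nilpotent.
    refine isNilpotent_of_ker_le_center (L := KNFd e a 0)
      (0 : (KNFd.down e a 1 0).ker →ₗ⁅ℂ⁆ KNFd e a 0) (fun x _ => ?_) ?_
    · have hx : x = 0 := Subtype.ext (LieHom.mem_ker.mp x.2)
      rw [hx]
      exact zero_mem _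
    · have := subsingleton_KNFd_zero (e := e) ha
      infer_instance
  | succ j ih =>
    have h : (KNFd.map e a (1 + j)).ker ≤ LieAlgebra.center ℂ (KNFd e a (1 + j + 1)) := by
      obtain ⟨i, hi⟩ : ∃ i, 1 + j = i + 1 := ⟨j, by omega⟩
      rw [hi]
      exact ker_map_le_center ha i
    exact isNilpotent_ker_comp (KNFd.down e a 1 j) (KNFd.map e a (1 + j)) h ih

theorem KNFd.isIteratedCentralExtension {L : Type} [LieRing L] [LieAlgebra ℂ L]
    (ha : a ∈ knProlongation) (h : Nonempty (KNFd e a 1 ≃ₗ⁅ℂ⁆ L)) (k : ℕ) :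
    IsIteratedCentralExtension L (KNFd e a (k + 1)) :=
  ⟨k, fun i => KNFd e a (i + 1), inferInstance, inferInstance, h, ⟨LieEquiv.refl⟩,
    fun i _ => KNFd.isCentralExtension ha i⟩

end CentralExtension
end
end ZCR

theorem mainTheorem4 (e : Fin 3 → ℂ) (a : ZCR.Coord → ℂ) (ha : a ∈ ZCR.knProlongation) :
    Subsingleton (ZCR.KNFd e a 0) ∧
    (∀ p : ℕ, Function.Surjective (ZCR.KNFd.map e a p)) ∧
    (∀ p : ℕ, 1 ≤ p →
      (∀ v₁ ∈ (ZCR.KNFd.map e a p).ker, ∀ v₂ : ZCR.KNFd e a (p + 1), ⁅v₁, v₂⁆ = 0) ∧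
      ZCR.IsCentralExtension (ZCR.KNFd e a p) (ZCR.KNFd e a (p + 1))) ∧
    (∀ j : ℕ, LieRing.IsNilpotent (ZCR.KNFd.down e a 1 j).ker) ∧
    (e 0 ≠ e 1 → e 1 ≠ e 2 → e 2 ≠ e 0 →
      ∀ α : Module.Basis (Fin 3) ℂ ZCR.SO3, ZCR.IsStandardBasis α →
        Nonempty (ZCR.KNFd e a 1 ≃ₗ⁅ℂ⁆ ZCR.ellipticAlg e α) ∧
        ∀ k : ℕ, 2 ≤ k →
          ZCR.IsIteratedCentralExtension (ZCR.ellipticAlg e α) (ZCR.KNFd e a k)) := by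
  refine ⟨ZCR.subsingleton_KNFd_zero ha, fun p => ZCR.Fd.map_surjective, fun p hp => ?_,
    ZCR.KNFd.isNilpotent_ker_down ha, fun h₀₁ h₁₂ h₂₀ α hα => ?_⟩
  · obtain ⟨p, rfl⟩ : ∃ q, p = q + 1 := ⟨p - 1, by omega⟩
    refine ⟨fun v₁ h₁ v₂ => ?_, ZCR.KNFd.isCentralExtension ha p⟩
    have h := ZCR.ker_map_le_center ha p h₁
    rw [LieModule.mem_maxTrivSubmodule] at h
    rw [← lie_skew, h, neg_zero]
  · have h := ZCR.KNFd.nonempty_equiv_ellipticAlg ha h₀₁ h₁₂ h₂₀ hα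
    refine ⟨h, fun k hk => ?_⟩
    obtain ⟨k, rfl⟩ : ∃ q, k = q + 1 := ⟨k - 1, by omega⟩
    exact ZCR.KNFd.isIteratedCentralExtension ha h k
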